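/- Let $0<c\le\infty$ and let $f\in C((-c,c),\mathbb R)$ satisfy * $(f_1)$ $f$ is odd, $f(0)=0$, and there are $0<b<\beta<c$ with $f(s)>0$ for $s\in(b,c)$, $f(s)\le0$ and $f(s)\not\equiv0$ for $s\in[0,b]$, and $F(\beta)=0$, where $F(s):=\int_0^s f(t)\,dt$; * $(f_2)$ $f$ is continuously differentiable in $(0,c)$ and $f'$ is integrable near $0$ (if $c>1$: $f'\in L^1(0,1)$). Let $q:[0,\infty)\to[0,\infty)$ be continuous on $[0,\infty)$ and $C^1$ on $(0,\infty)$, put $Q(r):=\int_0^r q(s)\,ds$, and assume * $(q_1)$ $q\ge0$, $q(0)=0$ and $q'>0$ on $(0,\infty)$; * $(q_2)$ $q'/q$ is strictly decreasing on $(0,\infty)$; * $(q_3)$ $H:=(Q/q)'$ is nonincreasing on $(0,\infty)$ with $H(0):=\lim_{r\to0^+}H(r)<\frac12$ and $H_\infty:=\lim_{r\to\infty}H(r)>0$, and $q\,(H-H_\infty)$ is nondecreasing on $(0,\infty)$; * $(q_4)$ $1/q\in L^1(1,\infty)\setminus L^1(0,1)$, and $h(r):=q(r)\int_r^\infty\frac{ds}{q(s)}$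 is such that $h'$ is strictly positive and nonincreasing on $(0,\infty)$ with $\ell_\infty:=\lim_{r\to\infty}h'(r)>0$; * $(q_5)$ $qq'$ is strictly increasing on $(0,\infty)$. Consider the problem $$(q\,u')'+q\,f(u)=0\ \ (r>0),\qquad u'(0)=0,\qquad \lim_{r\to\infty}u(r)=0 \tag{P}$$ for functions $u:[0,\infty)\to(-c,c)$. Suppose that one of the following two cases holds: * (i) $\left(\frac Ff\right)'(s)\ge\frac12(1-2H_\infty)$ for all $s\in(\beta,c)$, and $f(s)\ge f'(s)(s-b)$ for all $s\in[b,c)$; * (ii) $s\mapsto \frac{s f'(s)}{f(s)}$ is nonincreasing on $(b,c)$, and $\frac{\beta f'(\beta)}{f(\beta)}\le1+2\ell_\infty$. Then problem (P) has at most one nonnegative solution satisfying $u(0)>0$, and at most one solution satisfying $u(0)>0$ that has exactly one sign change in $(0,\infty)$. -/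

import Mathlib

open Set Filter Topology MeasureTheory

namespace WeightedBoundState

noncomputable section

/-- The primitive `F(s) = ∫₀ˢ f(t) dt`. -/
def primF (f : ℝ → ℝ) (s : ℝ) : ℝ := ∫ t in (0 : ℝ)..s, f t

/-- The primitive `Q(r) = ∫₀ʳ q(s) ds`. -/
def primQ (q : ℝ → ℝ) (r : ℝ) : ℝ := ∫ s in (0 : ℝ)..r, q s

/-- The function `H = (Q / q)'`, used on `(0, ∞)`. -/
def funH (q : ℝ → ℝ) (r : ℝ) : ℝ := deriv (fun t => primQ q t / q t) r

/-- The function `h(r) = q(r) ∫_r^∞ ds / q(s)`, used on `(0, ∞)`. -/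
def funh (q : ℝ → ℝ) (r : ℝ) : ℝ := q r * ∫ s in Ioi r, 1 / q s

/-- `f` is a continuous odd function on `(-c, c)`, where `0 < c ≤ ∞`, with `f(0) = 0`, and
`0 < b < β < c` are such that `f ≤ 0`, `f ≢ 0` on `[0, b]`, `f > 0` on `(b, c)` and
`F(β) = 0`. -/
structure CondF1 (c : EReal) (b β : ℝ) (f : ℝ → ℝ) : Prop where
  b_pos : 0 < b
  b_lt_β : b < β
  β_lt_c : (β : EReal) < c
  cont : ContinuousOn f {s : ℝ | ((|s| : ℝ) : EReal) < c}
  odd : ∀ s : ℝ, ((|s| : ℝ) : EReal) < c → f (-s) = -f s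
  zero : f 0 = 0
  pos : ∀ s : ℝ, b < s → (s : EReal) < c → 0 < f s
  nonpos : ∀ s ∈ Icc 0 b, f s ≤ 0
  not_zero : ∃ s ∈ Icc 0 b, f s ≠ 0
  primF_β : primF f β = 0

/-- `f` is continuously differentiable in `(0, c)` and `f'` is integrable near `0`
(when `1 < c`, given the first clause, this is `f' ∈ L¹(0, 1)`). -/
structure CondF2 (c : EReal) (f : ℝ → ℝ) : Prop where
  contDiff : ContDiffOn ℝ 1 f {s : ℝ | 0 < s ∧ (s : EReal) < c}
  integrable : ∃ δ : ℝ, 0 < δ ∧ (δ : EReal) < c ∧ IntegrableOn (deriv f) (Ioo 0 δ)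

/-- The subcritical condition `(F / f)' ≥ (1 - 2 H_∞) / 2` on `(β, c)`. -/
def CondF3 (c : EReal) (β Hinf : ℝ) (f : ℝ → ℝ) : Prop :=
  ∀ s : ℝ, β < s → (s : EReal) < c →
    1 / 2 * (1 - 2 * Hinf) ≤ deriv (fun t => primF f t / f t) s

/-- `s f'(s) / f(s)` decreases (is nonincreasing) for `s > b`; at `s = b` the quotient is
not defined because `f(b) = 0`. -/
def CondF4 (c : EReal) (b : ℝ) (f : ℝ → ℝ) : Prop :=
  AntitoneOn (fun s => s * deriv f s / f s) {s : ℝ | b < s ∧ (s : EReal) < c}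

/-- The sublinear condition `f(s) ≥ f'(s) (s - b)` for `s ≥ b`. -/
def CondF5 (c : EReal) (b : ℝ) (f : ℝ → ℝ) : Prop :=
  ∀ s : ℝ, b ≤ s → (s : EReal) < c → deriv f s * (s - b) ≤ f s

/-- `β f'(β) / f(β) ≤ 1 + 2 ℓ_∞`. -/
def CondF6 (β linf : ℝ) (f : ℝ → ℝ) : Prop :=
  β * deriv f β / f β ≤ 1 + 2 * linf

/-- `q` is continuous and nonnegative on `[0, ∞)`, `C¹` on `(0, ∞)`, with `q(0) = 0` and
`q' > 0` on `(0, ∞)`. -/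
structure CondQ1 (q : ℝ → ℝ) : Prop where
  cont : ContinuousOn q (Ici 0)
  contDiff : ContDiffOn ℝ 1 q (Ioi 0)
  nonneg : ∀ r : ℝ, 0 ≤ r → 0 ≤ q r
  zero : q 0 = 0
  deriv_pos : ∀ r : ℝ, 0 < r → 0 < deriv q r

/-- `q' / q` is strictly decreasing on `(0, ∞)`. -/
def CondQ2 (q : ℝ → ℝ) : Prop :=
  StrictAntiOn (fun r => deriv q r / q r) (Ioi 0)

/-- `H` is nonincreasing on `(0, ∞)`, `H(0) := lim_{r → 0+} H(r) < 1/2`,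
`H_∞ := lim_{r → ∞} H(r) > 0`, and `q (H - H_∞)` is nondecreasing on `(0, ∞)`. -/
structure CondQ3 (q : ℝ → ℝ) (Hinf : ℝ) : Prop where
  anti : AntitoneOn (funH q) (Ioi 0)
  limit_zero : ∃ H0 : ℝ, H0 < 1 / 2 ∧ Tendsto (funH q) (𝓝[>] 0) (𝓝 H0)
  limit_top : Tendsto (funH q) atTop (𝓝 Hinf)
  Hinf_pos : 0 < Hinf
  mono : MonotoneOn (fun r => q r * (funH q r - Hinf)) (Ioi 0)

/-- `1 / q ∈ L¹(1, ∞) \ L¹(0, 1)`, and `h'` is strictly positive and nonincreasing on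
`(0, ∞)` with `ℓ_∞ := lim_{r → ∞} h'(r) > 0`. -/
structure CondQ4 (q : ℝ → ℝ) (linf : ℝ) : Prop where
  integrable_top : IntegrableOn (fun s => 1 / q s) (Ioi 1)
  not_integrable_zero : ¬ IntegrableOn (fun s => 1 / q s) (Ioo 0 1)
  deriv_pos : ∀ r : ℝ, 0 < r → 0 < deriv (funh q) r
  anti : AntitoneOn (deriv (funh q)) (Ioi 0)
  limit_top : Tendsto (deriv (funh q)) atTop (𝓝 linf)
  linf_pos : 0 < linf

/-- `q' q` is strictly increasing on `(0, ∞)`. -/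
def CondQ5 (q : ℝ → ℝ) : Prop :=
  StrictMonoOn (fun r => deriv q r * q r) (Ioi 0)

/-- `u : [0, ∞) → (-c, c)` is a solution of `(q u')' + q f(u) = 0` for `r > 0`, with
`u'(0) = 0` and `u(r) → 0` as `r → ∞`. (Values of `u` on `(-∞, 0)` are irrelevant.) -/
structure IsSolution (c : EReal) (f q u : ℝ → ℝ) : Prop where
  mem_dom : ∀ r : ℝ, 0 ≤ r → ((|u r| : ℝ) : EReal) < c
  deriv_zero : HasDerivWithinAt u 0 (Ici 0) 0
  differentiable : ∀ r : ℝ, 0 < r → DifferentiableAt ℝ u r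
  equation : ∀ r : ℝ, 0 < r →
    HasDerivAt (fun t => q t * deriv u t) (-(q r * f (u r))) r
  limit_top : Tendsto u atTop (𝓝 0)

/-- `u` has exactly one sign change in `(0, ∞)`: it takes values of opposite strict signs,
but there are no three points at which its strict signs alternate. -/
def ExactlyOneSignChange (u : ℝ → ℝ) : Prop :=
  (∃ r₀ r₁ : ℝ, 0 < r₀ ∧ r₀ < r₁ ∧ u r₀ * u r₁ < 0) ∧
  ¬ ∃ r₀ r₁ r₂ : ℝ, 0 < r₀ ∧ r₀ < r₁ ∧ r₁ < r₂ ∧ u r₀ * u r₁ < 0 ∧ u r₁ * u r₂ < 0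

/-- The problem has at most one solution on `[0, ∞)` with the property `P`. -/
def AtMostOneSolution (c : EReal) (f q : ℝ → ℝ) (P : (ℝ → ℝ) → Prop) : Prop :=
  ∀ u v : ℝ → ℝ, IsSolution c f q u → P u → IsSolution c f q v → P v →
    EqOn u v (Ici 0)

end

end WeightedBoundState

open WeightedBoundState

/-!
Two solutions `u₁`, `u₂` with `u₁(0) < u₂(0)` are compared with the level `s = u` as independent
variable. Along a falling branch (`Branch`, `Falls`) the unknowns are the time `r(s)` at which the
level is reached and the flux `V(s) = q |u'|`; the slope is `p = |u'| = V / q` and the energy is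
`E = p² + 2 F(s)`.

**The way down.** Near its top the lower solution is early and flatter: `r₁ < r₂` and `p₁ < p₂`.
As long as this lasts, `q(r₁) (p₂² - p₁²)` is nonincreasing in the level, because `q' / q`
decreases (`gap_antitoneOn`). So if it lasts down to the level `0`, then `q(r₁) (p₂² - p₁²)` stays
away from `0` there, although it is at most `V₂ p₂`, which tends to `0` for a nonnegative solution
(`false_of_r_lt`). Otherwise the lower solution is overtaken in time, at a level where it is
flatter (`first_crossing`). Below that crossing the state "late and flatter" propagates, by a
different quantity on each range of levels:

* above `β`, in the sublinear case, there is no crossing at all, because `(u₁ - b) / (u₂ - b)` is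
  monotone (`Sol.false_of_meet`). For a decreasing elasticity, the phase coordinates
  `x = h |u'| / u`, `w = h² f(u) / u` turn the equation into `dx/dτ = x² - x + w`, with
  `τ = log (q / h)`. Comparing the two trajectories at equal `x` shows that after a crossing the
  lower solution stays late, flatter and of smaller flux (`PhaseCurve.compare`, `crossing_above`);
* between `-β` and `β`, where `F ≤ 0`, one compares `q² E`, using that `q q'` increases
  (`sq_mul_nrg_compare`);
* below `-b`, where `f < 0`, one compares `V²` (`V_compare`).

**Nonnegative solutions.** Once the lower solution is late and flatter with the smaller value of
`(Q / q) √E` at a level in `(0, β]`, the gap between these values does not shrink down to the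
level `0`, although `(Q / q) √E₂ ≤ (Q / q²) V₂` tends to `0` there (`false_of_tail`,
`Branch.false_of_lt`).

**One sign change.** The same comparison shows that `u₂` has the deeper minimum, `M₁ < M₂`
(`FallsToMin.M_lt`). After the minimum `-u` is a nonnegative solution starting at the level `M`,
but now at a positive time, so that it is not known which of the two starts first. Here one uses
the functional `P = Q E - 2 V F / f` (`poh`), for which `P' = -V (2 (F / f)' - 1 + 2 H)` in the
level variable. The bound on `(F / f)'` makes it monotone, and the monotonicity of `H` and of
`q (H - H_∞)` orders its derivatives for the two solutions. Carrying the order of `P` through the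
minima (`ReturnPair.poh_lt`, with a factor `k ≥ 1`, the ratio of the fluxes at the level
considered) shows that the first solution stays flatter on its return down to `β`
(`ReturnPair.slp_lt`), and the argument for nonnegative solutions concludes (`ReturnPair.false`).
In the case of a decreasing elasticity the bound on `(F / f)'` is a consequence of `ℓ_∞ / (2 + 2 ℓ_∞) ≤ H_∞` (`Weight.le_Hinf`,
`Nonlin.condF3_of_elasticity`).

**Equal initial levels.** Near the start the integrated equation is a contraction
(`Sol.eqOn_start`), and afterwards the system for `(r, V)` is Lipschitz in the unknowns for every
continuous `f` (`Branch.eqOn`).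
-/

namespace WeightedBoundState

/-! ### The weight -/

/-- All the hypotheses on the weight `q`. -/
structure Weight (q : ℝ → ℝ) (Hinf linf : ℝ) : Prop where
  c1 : CondQ1 q
  c2 : CondQ2 q
  c3 : CondQ3 q Hinf
  c4 : CondQ4 q linf
  c5 : CondQ5 q

/-- The tail integral `∫_r^∞ 1 / q`. -/
noncomputable def tailInt (q : ℝ → ℝ) (r : ℝ) : ℝ := ∫ s in Ioi r, 1 / q s

namespace Weight

variable {q : ℝ → ℝ} {Hinf linf : ℝ}

theorem hasDerivAt (W : Weight q Hinf linf) {r : ℝ} (hr : 0 < r) :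
    HasDerivAt q (deriv q r) r :=
  ((W.c1.contDiff.differentiableOn (by norm_num)).differentiableAt
    (Ioi_mem_nhds hr)).hasDerivAt

theorem continuousOn_deriv (W : Weight q Hinf linf) : ContinuousOn (deriv q) (Ioi 0) :=
  W.c1.contDiff.continuousOn_deriv_of_isOpen isOpen_Ioi (by norm_num)

theorem strictMonoOn (W : Weight q Hinf linf) : StrictMonoOn q (Ici 0) := by
  refine strictMonoOn_of_deriv_pos (convex_Ici 0) W.c1.cont ?_
  intro x hx
  rw [interior_Ici] at hx
  exact W.c1.deriv_pos x hx

theorem pos (W : Weight q Hinf linf) {r : ℝ} (hr : 0 < r) : 0 < q r := by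
  have h := W.strictMonoOn (mem_Ici.2 le_rfl) (mem_Ici.2 hr.le) hr
  rwa [W.c1.zero] at h

theorem lt (W : Weight q Hinf linf) {r s : ℝ} (hr : 0 ≤ r) (hrs : r < s) : q r < q s :=
  W.strictMonoOn (mem_Ici.2 hr) (mem_Ici.2 (hr.trans hrs.le)) hrs

theorem le (W : Weight q Hinf linf) {r s : ℝ} (hr : 0 ≤ r) (hrs : r ≤ s) : q r ≤ q s :=
  W.strictMonoOn.monotoneOn (mem_Ici.2 hr) (mem_Ici.2 (hr.trans hrs)) hrs

theorem intervalIntegrable (W : Weight q Hinf linf) {r s : ℝ} (hr : 0 ≤ r) (hs : 0 ≤ s) :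
    IntervalIntegrable q volume r s := by
  apply ContinuousOn.intervalIntegrable
  apply W.c1.cont.mono
  intro x hx
  exact (le_min hr hs).trans hx.1

theorem hasDerivAt_primQ (W : Weight q Hinf linf) {r : ℝ} (hr : 0 < r) :
    HasDerivAt (primQ q) (q r) r := by
  have hc : ContinuousAt q r := (W.hasDerivAt hr).continuousAt
  refine intervalIntegral.integral_hasDerivAt_right (W.intervalIntegrable le_rfl hr.le) ?_ hc
  exact (W.c1.cont.mono Ioi_subset_Ici_self).stronglyMeasurableAtFilter isOpen_Ioi r hr

theorem primQ_pos (W : Weight q Hinf linf) {r : ℝ} (hr : 0 < r) : 0 < primQ q r :=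
  intervalIntegral.intervalIntegral_pos_of_pos_on (W.intervalIntegrable le_rfl hr.le)
    (fun _ hx => W.pos hx.1) hr

theorem primQ_le (W : Weight q Hinf linf) {r : ℝ} (hr : 0 ≤ r) : primQ q r ≤ r * q r := by
  have h := intervalIntegral.integral_mono_on hr (W.intervalIntegrable le_rfl hr)
    (intervalIntegrable_const (c := q r)) (fun x hx => W.le hx.1 hx.2)
  simpa [primQ] using h

theorem tendsto_primQ_zero (W : Weight q Hinf linf) :
    Tendsto (primQ q) (𝓝[>] 0) (𝓝 0) := by
  have hc : Tendsto q (𝓝[>] 0) (𝓝 0) := by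
    have := (W.c1.cont 0 (mem_Ici.2 le_rfl)).mono Ioi_subset_Ici_self
    simpa [ContinuousWithinAt, W.c1.zero] using this
  have hid : Tendsto (fun r : ℝ => r) (𝓝[>] 0) (𝓝 0) := tendsto_nhdsWithin_of_tendsto_nhds tendsto_id
  have hm := hid.mul hc
  rw [mul_zero] at hm
  refine tendsto_of_tendsto_of_tendsto_of_le_of_le' tendsto_const_nhds hm ?_ ?_
  · filter_upwards [self_mem_nhdsWithin] with r hr using (W.primQ_pos hr).le
  · filter_upwards [self_mem_nhdsWithin] with r hr using W.primQ_le (le_of_lt hr)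

theorem hasDerivAt_div (W : Weight q Hinf linf) {r : ℝ} (hr : 0 < r) :
    HasDerivAt (fun t => primQ q t / q t) (funH q r) r ∧
      funH q r = 1 - primQ q r / q r * (deriv q r / q r) := by
  have hq := W.pos hr
  have h := (W.hasDerivAt_primQ hr).div (W.hasDerivAt hr) hq.ne'
  have h2 : funH q r = (q r * q r - primQ q r * deriv q r) / q r ^ 2 := h.deriv
  refine ⟨?_, ?_⟩
  · rw [h2]; exact h
  · rw [h2]; field_simp

theorem le_funH (W : Weight q Hinf linf) {r : ℝ} (hr : 0 < r) : Hinf ≤ funH q r := by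
  refine le_of_tendsto W.c3.limit_top ?_
  filter_upwards [eventually_ge_atTop r] with t ht
  exact W.c3.anti hr (hr.trans_le ht) ht

theorem funH_pos (W : Weight q Hinf linf) {r : ℝ} (hr : 0 < r) : 0 < funH q r :=
  W.c3.Hinf_pos.trans_le (W.le_funH hr)

theorem funH_lt (W : Weight q Hinf linf) {r : ℝ} (hr : 0 < r) : funH q r < 1 / 2 := by
  obtain ⟨H0, h0, hl⟩ := W.c3.limit_zero
  refine lt_of_le_of_lt (ge_of_tendsto hl ?_) h0
  filter_upwards [Ioo_mem_nhdsGT hr] with t ht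
  exact W.c3.anti ht.1 hr ht.2.le

theorem div_strictMonoOn (W : Weight q Hinf linf) :
    StrictMonoOn (fun t => primQ q t / q t) (Ioi 0) := by
  refine strictMonoOn_of_deriv_pos (convex_Ioi 0) ?_ ?_
  · intro x hx
    exact (W.hasDerivAt_div hx).1.continuousAt.continuousWithinAt
  · intro x hx
    rw [interior_Ioi] at hx
    rw [(W.hasDerivAt_div hx).1.deriv]
    exact W.funH_pos hx

theorem div_sq_strictAntiOn (W : Weight q Hinf linf) :
    StrictAntiOn (fun t => primQ q t / q t ^ 2) (Ioi 0) := by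
  have key : ∀ r : ℝ, 0 < r → HasDerivAt (fun t => primQ q t / q t ^ 2)
      ((2 * funH q r - 1) / q r) r := by
    intro r hr
    have hq := W.pos hr
    have h := (W.hasDerivAt_primQ hr).div ((W.hasDerivAt hr).pow 2) (pow_pos hq 2).ne'
    refine h.congr_deriv ?_
    rw [(W.hasDerivAt_div hr).2]
    simp
    field_simp
    ring
  refine strictAntiOn_of_deriv_neg (convex_Ioi 0) ?_ ?_
  · intro x hx
    exact (key x hx).continuousAt.continuousWithinAt
  · intro x hx
    rw [interior_Ioi] at hx
    rw [(key x hx).deriv]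
    have := W.funH_lt hx
    exact div_neg_of_neg_of_pos (by linarith) (W.pos hx)

theorem continuousOn_one_div (W : Weight q Hinf linf) :
    ContinuousOn (fun s => 1 / q s) (Ioi 0) := by
  intro x hx
  exact ((continuousAt_const).div (W.hasDerivAt hx).continuousAt
    (W.pos hx).ne').continuousWithinAt

theorem integrableOn_one_div (W : Weight q Hinf linf) {r : ℝ} (hr : 0 < r) :
    IntegrableOn (fun s => 1 / q s) (Ioi r) := by
  have h1 : IntegrableOn (fun s => 1 / q s) (Icc r (max r 1)) :=
    (W.continuousOn_one_div.mono (fun x hx => hr.trans_le hx.1)).integrableOn_Icc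
  refine (h1.union W.c4.integrable_top).mono_set ?_
  intro x hx
  rcases le_or_gt x (max r 1) with h | h
  · exact Or.inl ⟨le_of_lt hx, h⟩
  · exact Or.inr ((le_max_right _ _).trans_lt h)

theorem hasDerivAt_tailInt (W : Weight q Hinf linf) {r : ℝ} (hr : 0 < r) :
    HasDerivAt (tailInt q) (-(1 / q r)) r := by
  have h1 : HasDerivAt (fun t => ∫ s in (r / 2)..t, 1 / q s) (1 / q r) r := by
    refine intervalIntegral.integral_hasDerivAt_right ?_
      (W.continuousOn_one_div.stronglyMeasurableAtFilter isOpen_Ioi r hr)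
      (W.continuousOn_one_div.continuousAt (Ioi_mem_nhds hr))
    apply (W.continuousOn_one_div.mono _).intervalIntegrable
    rw [uIcc_of_le (by linarith)]
    exact fun x hx => lt_of_lt_of_le (half_pos hr) hx.1
  have h2 := (h1.const_sub (∫ s in Ioi (r / 2), 1 / q s))
  refine h2.congr_of_eventuallyEq ?_
  filter_upwards [Ioi_mem_nhds (half_lt_self hr)] with t ht
  have ht' : r / 2 < t := ht
  have := intervalIntegral.integral_Ioi_sub_Ioi (W.integrableOn_one_div (half_pos hr)) ht'.le
  simp only [tailInt]
  linarith

theorem tailInt_nonneg (W : Weight q Hinf linf) {r : ℝ} (hr : 0 < r) : 0 ≤ tailInt q r := by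
  refine setIntegral_nonneg measurableSet_Ioi (fun x hx => ?_)
  exact one_div_nonneg.2 (W.pos (hr.trans hx)).le

theorem tailInt_strictAntiOn (W : Weight q Hinf linf) : StrictAntiOn (tailInt q) (Ioi 0) := by
  refine strictAntiOn_of_deriv_neg (convex_Ioi 0) ?_ ?_
  · intro x hx
    exact (W.hasDerivAt_tailInt hx).continuousAt.continuousWithinAt
  · intro x hx
    rw [interior_Ioi] at hx
    rw [(W.hasDerivAt_tailInt hx).deriv]
    have := one_div_pos.2 (W.pos hx)
    linarith

theorem tailInt_pos (W : Weight q Hinf linf) {r : ℝ} (hr : 0 < r) : 0 < tailInt q r := by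
  have h := W.tailInt_strictAntiOn hr (show (0:ℝ) < r + 1 by linarith) (lt_add_one r)
  exact (W.tailInt_nonneg (by linarith)).trans_lt h

theorem tendsto_tailInt (W : Weight q Hinf linf) : Tendsto (tailInt q) atTop (𝓝 0) := by
  have h1 := intervalIntegral_tendsto_integral_Ioi 1 W.c4.integrable_top tendsto_id
  have h2 := (tendsto_const_nhds (x := tailInt q 1)).sub h1
  have : tailInt q 1 - ∫ x in Ioi 1, 1 / q x = 0 := by simp [tailInt]
  rw [this] at h2
  refine h2.congr' ?_
  filter_upwards [eventually_ge_atTop 1] with t ht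
  have := intervalIntegral.integral_Ioi_sub_Ioi W.c4.integrable_top ht
  simp only [tailInt, id]
  linarith

theorem funh_eq (r : ℝ) : funh q r = q r * tailInt q r := rfl

theorem hasDerivAt_funh (W : Weight q Hinf linf) {r : ℝ} (hr : 0 < r) :
    HasDerivAt (funh q) (deriv (funh q) r) r ∧
      deriv (funh q) r = deriv q r * tailInt q r - 1 := by
  have h := (W.hasDerivAt hr).mul (W.hasDerivAt_tailInt hr)
  have h1 : HasDerivAt (funh q) (deriv q r * tailInt q r - 1) r := by
    refine h.congr_deriv ?_
    have := W.pos hr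
    field_simp
    ring
  exact ⟨by rw [h1.deriv]; exact h1, h1.deriv⟩

theorem funh_pos (W : Weight q Hinf linf) {r : ℝ} (hr : 0 < r) : 0 < funh q r :=
  mul_pos (W.pos hr) (W.tailInt_pos hr)

theorem le_deriv_funh (W : Weight q Hinf linf) {r : ℝ} (hr : 0 < r) :
    linf ≤ deriv (funh q) r := by
  refine le_of_tendsto W.c4.limit_top ?_
  filter_upwards [eventually_ge_atTop r] with t ht
  exact W.c4.anti hr (hr.trans_le ht) ht

theorem funh_strictMonoOn (W : Weight q Hinf linf) : StrictMonoOn (funh q) (Ioi 0) := by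
  refine strictMonoOn_of_deriv_pos (convex_Ioi 0) ?_ ?_
  · intro x hx
    exact (W.hasDerivAt_funh hx).1.continuousAt.continuousWithinAt
  · intro x hx
    rw [interior_Ioi] at hx
    exact W.c4.deriv_pos x hx

/-- `(q h)' = q (1 + 2 h')`. -/
theorem hasDerivAt_mul_funh (W : Weight q Hinf linf) {r : ℝ} (hr : 0 < r) :
    HasDerivAt (fun t => q t * funh q t) (q r * (1 + 2 * deriv (funh q) r)) r := by
  have h := (W.hasDerivAt hr).mul (W.hasDerivAt_funh hr).1
  refine h.congr_deriv ?_
  rw [(W.hasDerivAt_funh hr).2, funh_eq]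
  ring

/-- Integrating `(q h)' = q (1 + 2 h')` with `h'` nonincreasing. -/
theorem primQ_mul_le (W : Weight q Hinf linf) {r : ℝ} (hr : 0 < r) :
    primQ q r * (1 + 2 * deriv (funh q) r) ≤ q r * funh q r := by
  set k := 1 + 2 * deriv (funh q) r with hk
  have hd : ∀ t ∈ Ioc 0 r, HasDerivAt (fun t => q t * funh q t - primQ q t * k)
      (q t * (1 + 2 * deriv (funh q) t) - q t * k) t := fun t ht =>
    (W.hasDerivAt_mul_funh ht.1).sub ((W.hasDerivAt_primQ ht.1).mul_const k)
  have hmono : MonotoneOn (fun t => q t * funh q t - primQ q t * k) (Ioc 0 r) := by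
    refine monotoneOn_of_deriv_nonneg (convex_Ioc 0 r) ?_ ?_ ?_
    · exact fun t ht => (hd t ht).continuousAt.continuousWithinAt
    · intro t ht
      rw [interior_Ioc] at ht
      exact (hd t ⟨ht.1, ht.2.le⟩).differentiableAt.differentiableWithinAt
    · intro t ht
      rw [interior_Ioc] at ht
      rw [(hd t ⟨ht.1, ht.2.le⟩).deriv, ← mul_sub]
      have := W.c4.anti ht.1 hr ht.2.le
      exact mul_nonneg (W.pos ht.1).le (by linarith)
  have hlim : Tendsto (fun t => -(primQ q t * k)) (𝓝[>] 0) (𝓝 0) := by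
    simpa using (W.tendsto_primQ_zero.mul_const k).neg
  have : (0:ℝ) ≤ q r * funh q r - primQ q r * k := by
    refine le_of_tendsto hlim ?_
    filter_upwards [Ioo_mem_nhdsGT hr] with t ht
    have h1 := hmono ⟨ht.1, ht.2.le⟩ ⟨hr, le_rfl⟩ ht.2.le
    have h2 := mul_pos (W.pos ht.1) (W.funh_pos ht.1)
    simp only at h1
    linarith
  linarith

theorem primQ_le_mul_funh (W : Weight q Hinf linf) {r : ℝ} (hr : 0 < r) :
    primQ q r ≤ q r * funh q r := by
  have h := W.primQ_mul_le hr
  have h1 := mul_pos (W.primQ_pos hr) (W.c4.deriv_pos r hr)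
  linarith

theorem monotoneOn_primQ_div (W : Weight q Hinf linf) :
    MonotoneOn (fun t => primQ q t / (q t * funh q t)) (Ioi 0) := by
  have hd : ∀ t : ℝ, 0 < t → HasDerivAt (fun t => primQ q t / (q t * funh q t))
      ((q t * (q t * funh q t) - primQ q t * (q t * (1 + 2 * deriv (funh q) t))) /
        (q t * funh q t) ^ 2) t := fun t ht =>
    (W.hasDerivAt_primQ ht).div (W.hasDerivAt_mul_funh ht)
      (mul_pos (W.pos ht) (W.funh_pos ht)).ne'
  refine monotoneOn_of_deriv_nonneg (convex_Ioi 0) ?_ ?_ ?_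
  · exact fun t ht => (hd t ht).continuousAt.continuousWithinAt
  · intro t ht
    rw [interior_Ioi] at ht
    exact (hd t ht).differentiableAt.differentiableWithinAt
  · intro t ht
    rw [interior_Ioi] at ht
    rw [(hd t ht).deriv]
    apply div_nonneg _ (sq_nonneg _)
    have := mul_le_mul_of_nonneg_left (W.primQ_mul_le ht) (W.pos ht).le
    linarith

theorem primQ_div_sq_le (W : Weight q Hinf linf) {r : ℝ} (hr : 0 < r) :
    primQ q r / q r ^ 2 ≤ tailInt q r := by
  rw [div_le_iff₀ (pow_pos (W.pos hr) 2)]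
  have := W.primQ_le_mul_funh hr
  rw [funh_eq] at this
  linarith

/-- The relation between `ℓ_∞` and `H_∞`, from integrating `(q h)' = q (2 h' + 1)` over `(0, r)`. -/
theorem le_Hinf (W : Weight q Hinf linf) : linf / (2 + 2 * linf) ≤ Hinf := by
  have hl := W.c4.linf_pos
  refine ge_of_tendsto W.c3.limit_top ?_
  filter_upwards [eventually_gt_atTop 0] with r hr
  have h1 := W.primQ_mul_le hr
  have h2 := (W.hasDerivAt_funh hr).2
  have h3 := W.le_deriv_funh hr
  rw [funh_eq] at h1
  rw [(W.hasDerivAt_div hr).2, div_le_iff₀ (by linarith)]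
  set m := deriv (funh q) r
  have hq := W.pos hr
  have hI := W.tailInt_pos hr
  have hd := W.c1.deriv_pos r hr
  -- `Q q' / q² ≤ (1 + h') / (1 + 2 h')`
  have h4 : primQ q r / q r * (deriv q r / q r) * (1 + 2 * m) ≤ 1 + m := by
    have e : primQ q r / q r * (deriv q r / q r) * (1 + 2 * m) =
        (primQ q r * (1 + 2 * m)) * deriv q r / q r ^ 2 := by
      field_simp
    rw [e, div_le_iff₀ (pow_pos hq 2)]
    have : q r * (q r * tailInt q r) * deriv q r = (1 + m) * q r ^ 2 := by
      rw [h2]; ring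
    rw [← this]
    exact mul_le_mul_of_nonneg_right h1 hd.le
  set G := primQ q r / q r * (deriv q r / q r)
  have hG : 0 < G := by
    have := W.primQ_pos hr
    positivity
  have h5 : G ≤ 1 := by nlinarith
  nlinarith

theorem deriv_div_lt (W : Weight q Hinf linf) {r s : ℝ} (hr : 0 < r) (hrs : r < s) :
    deriv q s / q s < deriv q r / q r := W.c2 hr (hr.trans hrs) hrs

end Weight

/-! ### The nonlinearity -/

/-- The interval `(-c, c)` on which `f` is given. -/
def dom (c : EReal) : Set ℝ := {s : ℝ | ((|s| : ℝ) : EReal) < c}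

/-- The hypotheses on the nonlinearity `f` common to both cases. -/
structure Nonlin (c : EReal) (b β : ℝ) (f : ℝ → ℝ) : Prop where
  c1 : CondF1 c b β f
  c2 : CondF2 c f

theorem isOpen_dom (c : EReal) : IsOpen (dom c) :=
  isOpen_Iio.preimage (continuous_coe_real_ereal.comp continuous_abs)

theorem mem_dom_of_abs_le {c : EReal} {s t : ℝ} (ht : t ∈ dom c) (h : |s| ≤ |t|) : s ∈ dom c :=
  lt_of_le_of_lt (EReal.coe_le_coe_iff.2 h) ht

theorem neg_mem_dom {c : EReal} {s : ℝ} (hs : s ∈ dom c) : -s ∈ dom c :=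
  mem_dom_of_abs_le hs (by rw [abs_neg])

theorem uIcc_subset_dom {c : EReal} {s t : ℝ} (hs : s ∈ dom c) (ht : t ∈ dom c) :
    uIcc s t ⊆ dom c := by
  intro x hx
  have h1 : |x| ≤ max |s| |t| := by
    rw [mem_uIcc] at hx
    rcases hx with h | h
    · exact (abs_le_max_abs_abs h.1 h.2)
    · rw [max_comm]; exact (abs_le_max_abs_abs h.1 h.2)
  rcases le_max_iff.1 h1 with h | h
  · exact mem_dom_of_abs_le hs h
  · exact mem_dom_of_abs_le ht h

theorem Icc_subset_dom {c : EReal} {s t : ℝ} (hs : s ∈ dom c) (ht : t ∈ dom c) :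
    Icc s t ⊆ dom c := Icc_subset_uIcc.trans (uIcc_subset_dom hs ht)

theorem lt_of_mem_dom {c : EReal} {s : ℝ} (hs : s ∈ dom c) : (s : EReal) < c :=
  lt_of_le_of_lt (EReal.coe_le_coe_iff.2 (le_abs_self s)) hs

namespace Nonlin

variable {c : EReal} {b β : ℝ} {f : ℝ → ℝ}

theorem β_mem (N : Nonlin c b β f) : β ∈ dom c := by
  have : |β| = β := abs_of_pos (N.c1.b_pos.trans N.c1.b_lt_β)
  simpa [dom, this] using N.c1.β_lt_c

theorem β_pos (N : Nonlin c b β f) : 0 < β := N.c1.b_pos.trans N.c1.b_lt_β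

theorem zero_mem (N : Nonlin c b β f) : (0:ℝ) ∈ dom c :=
  mem_dom_of_abs_le N.β_mem (by simp)

theorem continuousOn (N : Nonlin c b β f) : ContinuousOn f (dom c) := N.c1.cont

theorem continuousAt (N : Nonlin c b β f) {s : ℝ} (hs : s ∈ dom c) : ContinuousAt f s :=
  N.continuousOn.continuousAt ((isOpen_dom c).mem_nhds hs)

theorem odd (N : Nonlin c b β f) {s : ℝ} (hs : s ∈ dom c) : f (-s) = -f s := N.c1.odd s hs

theorem pos (N : Nonlin c b β f) {s : ℝ} (hb : b < s) (hs : s ∈ dom c) : 0 < f s :=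
  N.c1.pos s hb (lt_of_mem_dom hs)

theorem intervalIntegrable (N : Nonlin c b β f) {s t : ℝ} (hs : s ∈ dom c) (ht : t ∈ dom c) :
    IntervalIntegrable f volume s t :=
  (N.continuousOn.mono (uIcc_subset_dom hs ht)).intervalIntegrable

theorem hasDerivAt_primF (N : Nonlin c b β f) {s : ℝ} (hs : s ∈ dom c) :
    HasDerivAt (primF f) (f s) s :=
  intervalIntegral.integral_hasDerivAt_right (N.intervalIntegrable N.zero_mem hs)
    (N.continuousOn.stronglyMeasurableAtFilter (isOpen_dom c) s hs) (N.continuousAt hs)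

theorem primF_zero : primF f 0 = 0 := by simp [primF]

theorem primF_neg (N : Nonlin c b β f) {s : ℝ} (hs : s ∈ dom c) :
    primF f (-s) = primF f s := by
  have h1 : primF f (-s) = ∫ t in (0:ℝ)..s, -f (-t) := by
    have := intervalIntegral.integral_comp_neg (a := 0) (b := s) f
    rw [intervalIntegral.integral_neg, this, neg_zero, ← intervalIntegral.integral_symm]
    rfl
  rw [h1]
  refine intervalIntegral.integral_congr fun t ht => ?_
  simp only [N.odd (uIcc_subset_dom N.zero_mem hs ht), neg_neg]

theorem strictMonoOn_primF (N : Nonlin c b β f) :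
    StrictMonoOn (primF f) (Ici b ∩ dom c) := by
  have ho : OrdConnected (Ici b ∩ dom c) :=
    ordConnected_Ici.inter ⟨fun _ hx _ hy => Icc_subset_dom hx hy⟩
  refine strictMonoOn_of_deriv_pos ho.convex ?_ ?_
  · exact fun x hx => (N.hasDerivAt_primF hx.2).continuousAt.continuousWithinAt
  · intro x hx
    rw [interior_inter, interior_Ici] at hx
    have hx2 := interior_subset hx.2
    rw [(N.hasDerivAt_primF hx2).deriv]
    exact N.pos hx.1 hx2

theorem primF_pos (N : Nonlin c b β f) {s : ℝ} (h : β < s) (hs : s ∈ dom c) :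
    0 < primF f s := by
  have := N.strictMonoOn_primF ⟨N.c1.b_lt_β.le, N.β_mem⟩
    ⟨(N.c1.b_lt_β.trans h).le, hs⟩ h
  rwa [N.c1.primF_β] at this

theorem mem_dom_of_abs_le_β (N : Nonlin c b β f) {s : ℝ} (h : |s| ≤ β) : s ∈ dom c :=
  mem_dom_of_abs_le N.β_mem (h.trans (le_abs_self β))

theorem primF_nonpos (N : Nonlin c b β f) {s : ℝ} (h : |s| ≤ β) : primF f s ≤ 0 := by
  have key : ∀ t : ℝ, 0 ≤ t → t ≤ β → primF f t ≤ 0 := by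
    intro t h0 h1
    have hd : t ∈ dom c := N.mem_dom_of_abs_le_β (by rwa [abs_of_nonneg h0])
    rcases le_or_gt t b with h2 | h2
    · have : 0 ≤ ∫ x in (0:ℝ)..t, -f x :=
        intervalIntegral.integral_nonneg h0 fun x hx => by
          have := N.c1.nonpos x ⟨hx.1, hx.2.trans h2⟩
          linarith
      rw [intervalIntegral.integral_neg] at this
      change (∫ x in (0:ℝ)..t, f x) ≤ 0
      linarith
    · have := N.strictMonoOn_primF.monotoneOn ⟨h2.le, hd⟩
        ⟨N.c1.b_lt_β.le, N.β_mem⟩ h1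
      rwa [N.c1.primF_β] at this
  rcases abs_cases s with ⟨h1, h2⟩ | ⟨h1, h2⟩
  · exact key s h2 (by rwa [h1] at h)
  · have hd := N.mem_dom_of_abs_le_β h
    rw [← N.primF_neg hd]
    exact key (-s) (by linarith) (by rwa [h1] at h)

/-- `f ≤ 0` only to the left of `b`. -/
theorem le_of_nonpos (N : Nonlin c b β f) {s : ℝ} (hs : s ∈ dom c) (h : f s ≤ 0) : s ≤ b := by
  by_contra! hb
  exact absurd (N.pos hb hs) (by linarith)

theorem mem_pos (_N : Nonlin c b β f) {s : ℝ} (h0 : 0 < s) (hs : s ∈ dom c) :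
    s ∈ {s : ℝ | 0 < s ∧ (s : EReal) < c} := ⟨h0, lt_of_mem_dom hs⟩

theorem isOpen_pos : IsOpen {s : ℝ | 0 < s ∧ (s : EReal) < c} :=
  isOpen_Ioi.inter (isOpen_Iio.preimage continuous_coe_real_ereal)

theorem hasDerivAt (N : Nonlin c b β f) {s : ℝ} (h0 : 0 < s) (hs : s ∈ dom c) :
    HasDerivAt f (deriv f s) s :=
  ((N.c2.contDiff.differentiableOn (by norm_num)).differentiableAt
    (isOpen_pos.mem_nhds (N.mem_pos h0 hs))).hasDerivAt

theorem exists_lipschitz (N : Nonlin c b β f) {s : ℝ} (h0 : 0 < s) (hs : s ∈ dom c) :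
    ∃ K, ∃ t ∈ 𝓝 s, LipschitzOnWith K f t :=
  (N.c2.contDiff.contDiffAt (isOpen_pos.mem_nhds (N.mem_pos h0 hs))).exists_lipschitzOnWith

theorem hasDerivAt_div (N : Nonlin c b β f) {s : ℝ} (h0 : b < s) (hs : s ∈ dom c) :
    HasDerivAt (fun t => primF f t / f t) (deriv (fun t => primF f t / f t) s) s ∧
      deriv (fun t => primF f t / f t) s = 1 - primF f s * deriv f s / f s ^ 2 := by
  have hp := N.pos h0 hs
  have h := (N.hasDerivAt_primF hs).div (N.hasDerivAt (N.c1.b_pos.trans h0) hs) hp.ne'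
  have h' : HasDerivAt (fun t => primF f t / f t)
      ((f s * f s - primF f s * deriv f s) / f s ^ 2) s := h
  refine ⟨by rw [h'.deriv]; exact h', ?_⟩
  rw [h'.deriv]
  field_simp

theorem continuousOn_deriv (N : Nonlin c b β f) :
    ContinuousOn (deriv f) {s : ℝ | 0 < s ∧ (s : EReal) < c} :=
  N.c2.contDiff.continuousOn_deriv_of_isOpen isOpen_pos (by norm_num)

/-- `s f'(s) / f(s)` is at most `1 + 2 ℓ_∞` on `[β, c)`. -/
theorem elasticity_le (N : Nonlin c b β f) {linf : ℝ} (h4 : CondF4 c b f)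
    (h6 : CondF6 β linf f) {s : ℝ} (h : β ≤ s) (hs : s ∈ dom c) :
    s * deriv f s / f s ≤ 1 + 2 * linf :=
  (h4 ⟨N.c1.b_lt_β, N.c1.β_lt_c⟩ ⟨N.c1.b_lt_β.trans_le h, lt_of_mem_dom hs⟩ h).trans h6

/-- The conditions of the second case imply the subcriticality condition of the first one:
`s f - (σ(s₀) + 1) F` increases on `[β, s₀]`, where `σ = s f' / f`. -/
theorem condF3_of_elasticity (N : Nonlin c b β f) {linf Hinf : ℝ} (hl : 0 < linf)
    (hH : linf / (2 + 2 * linf) ≤ Hinf) (h4 : CondF4 c b f) (h6 : CondF6 β linf f) :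
    CondF3 c β Hinf f := by
  intro s hβ hsc
  have hβ0 := N.β_pos
  have hs : s ∈ dom c := by
    have : |s| = s := abs_of_pos (hβ0.trans hβ)
    simpa [dom, this] using hsc
  have hbs := N.c1.b_lt_β.trans hβ
  have hfs := N.pos hbs hs
  rw [(N.hasDerivAt_div hbs hs).2]
  set σ := s * deriv f s / f s with hσ
  have hσ1 : σ ≤ 1 + 2 * linf := N.elasticity_le h4 h6 hβ.le hs
  have hmem : ∀ t ∈ Icc β s, t ∈ dom c := fun t ht => Icc_subset_dom N.β_mem hs ht
  have hd : ∀ t ∈ Icc β s, HasDerivAt (fun t => t * f t - (σ + 1) * primF f t)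
      (1 * f t + t * deriv f t - (σ + 1) * f t) t := fun t ht =>
    ((hasDerivAt_id t).mul (N.hasDerivAt (hβ0.trans_le ht.1) (hmem t ht))).sub
      ((N.hasDerivAt_primF (hmem t ht)).const_mul (σ + 1))
  have hmono : MonotoneOn (fun t => t * f t - (σ + 1) * primF f t) (Icc β s) := by
    refine monotoneOn_of_deriv_nonneg (convex_Icc β s) ?_ ?_ ?_
    · exact fun t ht => (hd t ht).continuousAt.continuousWithinAt
    · intro t ht
      exact (hd t (interior_subset ht)).differentiableAt.differentiableWithinAt
    · intro t ht
      have ht' := interior_subset ht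
      rw [(hd t ht').deriv]
      have hft := N.pos (N.c1.b_lt_β.trans_le ht'.1) (hmem t ht')
      have h1 : σ ≤ t * deriv f t / f t :=
        h4 ⟨N.c1.b_lt_β.trans_le ht'.1, lt_of_mem_dom (hmem t ht')⟩ ⟨hbs, hsc⟩ ht'.2
      rw [le_div_iff₀ hft] at h1
      linarith
  have h1 := hmono (left_mem_Icc.2 hβ.le) (right_mem_Icc.2 hβ.le) hβ.le
  simp only [N.c1.primF_β, mul_zero, sub_zero] at h1
  have h2 := mul_pos hβ0 (N.pos N.c1.b_lt_β N.β_mem)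
  have hF := N.primF_pos hβ hs
  have hs0 := hβ0.trans hβ
  have e : primF f s * deriv f s / f s ^ 2 = σ * (primF f s / (s * f s)) := by
    rw [hσ]; field_simp
  have hsf := mul_pos hs0 hfs
  have hA : 0 < primF f s / (s * f s) := div_pos hF hsf
  rw [e]
  set A := primF f s / (s * f s)
  have h3 : (σ + 1) * A ≤ 1 := by
    rw [← mul_div_assoc, div_le_one hsf]; linarith
  rw [div_le_iff₀ (by linarith)] at hH
  rcases le_or_gt σ 0 with h0 | h0
  · have := mul_nonpos_of_nonpos_of_nonneg h0 hA.le
    nlinarith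
  · have h4 : (2 + 2 * linf) * (1 - σ * A) ≥ 1 := by
      have h5 : A ≤ 1 := by nlinarith
      have h6 : A ≤ 1 - σ * A := by linarith
      have h7 : 1 ≤ (σ + 1) * (1 - σ * A) := by nlinarith
      nlinarith
    nlinarith

end Nonlin

/-! ### Falling branches parametrized by the level -/

theorem antitoneOn_Icc_of_hasDerivAt {g g' : ℝ → ℝ} {x y : ℝ}
    (h : ∀ s ∈ Icc x y, HasDerivAt g (g' s) s) (h' : ∀ s ∈ Ioo x y, g' s ≤ 0) :
    AntitoneOn g (Icc x y) := by
  refine antitoneOn_of_deriv_nonpos (convex_Icc x y)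
    (fun s hs => (h s hs).continuousAt.continuousWithinAt)
    (fun s hs => (h s (interior_subset hs)).differentiableAt.differentiableWithinAt) ?_
  intro s hs
  rw [(h s (interior_subset hs)).deriv]
  rw [interior_Icc] at hs
  exact h' s hs

theorem monotoneOn_Icc_of_hasDerivAt {g g' : ℝ → ℝ} {x y : ℝ}
    (h : ∀ s ∈ Icc x y, HasDerivAt g (g' s) s) (h' : ∀ s ∈ Ioo x y, 0 ≤ g' s) :
    MonotoneOn g (Icc x y) := by
  have := antitoneOn_Icc_of_hasDerivAt (g := fun s => -g s) (g' := fun s => -g' s)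
    (fun s hs => (h s hs).neg) (fun s hs => neg_nonpos.2 (h' s hs))
  exact fun s hs t ht hst => neg_le_neg_iff.1 (this hs ht hst)

theorem strictAntiOn_Icc_of_hasDerivAt {g g' : ℝ → ℝ} {x y : ℝ}
    (h : ∀ s ∈ Icc x y, HasDerivAt g (g' s) s) (h' : ∀ s ∈ Ioo x y, g' s < 0) :
    StrictAntiOn g (Icc x y) := by
  refine strictAntiOn_of_deriv_neg (convex_Icc x y)
    (fun s hs => (h s hs).continuousAt.continuousWithinAt) ?_
  intro s hs
  rw [(h s (interior_subset hs)).deriv]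
  rw [interior_Icc] at hs
  exact h' s hs

/-- A positive continuous function stays positive to the left of a point if it cannot vanish
at a point to the right of which it is positive. -/
theorem backward_barrier {D : ℝ → ℝ} {s₀ s₁ : ℝ} (hc : ContinuousOn D (Icc s₀ s₁))
    (h1 : 0 < D s₁)
    (hcontact : ∀ s ∈ Ico s₀ s₁, D s = 0 → (∀ t ∈ Ioc s s₁, 0 < D t) → False) :
    ∀ s ∈ Icc s₀ s₁, 0 < D s := by
  by_contra! hcon
  obtain ⟨s, hs, hDs⟩ := hcon
  have hcomp : IsCompact (Icc s₀ s₁ ∩ D ⁻¹' Iic 0) :=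
    isCompact_Icc.of_isClosed_subset (hc.preimage_isClosed_of_isClosed isClosed_Icc isClosed_Iic)
      inter_subset_left
  obtain ⟨t, ht, hmax⟩ := hcomp.exists_isGreatest ⟨s, hs, hDs⟩
  have ht1 : t < s₁ := lt_of_le_of_ne ht.1.2 (by rintro rfl; exact absurd h1 (not_lt.2 ht.2))
  have hpos : ∀ x ∈ Ioc t s₁, 0 < D x := by
    intro x hx
    by_contra! hle
    exact absurd (hmax ⟨⟨ht.1.1.trans hx.1.le, hx.2⟩, hle⟩) (not_le.2 hx.1)
  refine hcontact t ⟨ht.1.1, ht1⟩ (le_antisymm ht.2 ?_) hpos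
  have hct : Tendsto D (𝓝[>] t) (𝓝 (D t)) := by
    have : ContinuousWithinAt D (Ioc t s₁) t :=
      (hc t ht.1).mono (fun x hx => ⟨ht.1.1.trans hx.1.le, hx.2⟩)
    rwa [ContinuousWithinAt, nhdsWithin_Ioc_eq_nhdsGT ht1] at this
  refine ge_of_tendsto hct ?_
  filter_upwards [Ioc_mem_nhdsGT ht1] with x hx using (hpos x hx).le

theorem deriv_nonneg_of_nonneg_right {D : ℝ → ℝ} {d s s₁ : ℝ} (h : HasDerivAt D d s)
    (h0 : D s = 0) (hs : s < s₁) (hp : ∀ t ∈ Ioc s s₁, 0 ≤ D t) : 0 ≤ d := by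
  have h1 := h.tendsto_slope.mono_left
    (nhdsWithin_mono s (show Ioi s ⊆ {s}ᶜ from fun x hx => ne_of_gt hx))
  refine ge_of_tendsto h1 ?_
  filter_upwards [Ioc_mem_nhdsGT hs] with t ht
  rw [slope_def_field, h0, sub_zero]
  exact div_nonneg (hp t ht) (sub_nonneg.2 ht.1.le)

/-- A strictly falling piece of a solution, in terms of the level `s = u`: `r s` is the time at
which the level is reached and `V s = q |u'|` the flux there. The energy
`u'² + 2 F(u)` is required to be positive. -/
structure Branch (c : EReal) (f q r V : ℝ → ℝ) (a d : ℝ) : Prop where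
  mem : ∀ s ∈ Ioo a d, s ∈ dom c
  r_pos : ∀ s ∈ Ioo a d, 0 < r s
  V_pos : ∀ s ∈ Ioo a d, 0 < V s
  deriv_r : ∀ s ∈ Ioo a d, HasDerivAt r (-(q (r s) / V s)) s
  deriv_V : ∀ s ∈ Ioo a d, HasDerivAt V (-(q (r s) ^ 2 * f s / V s)) s
  energy : ∀ s ∈ Ioo a d, 0 < (V s / q (r s)) ^ 2 + 2 * primF f s

/-- The absolute slope `|u'|` at a given level. -/
noncomputable def slp (q r V : ℝ → ℝ) (s : ℝ) : ℝ := V s / q (r s)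

/-- The energy `u'² + 2 F(u)` at a given level. -/
noncomputable def nrg (f q r V : ℝ → ℝ) (s : ℝ) : ℝ := slp q r V s ^ 2 + 2 * primF f s

namespace Branch

variable {c : EReal} {b β Hinf linf : ℝ} {f q : ℝ → ℝ} {r V r₁ V₁ r₂ V₂ : ℝ → ℝ} {a d : ℝ}

theorem mono (B : Branch c f q r V a d) {a' d' : ℝ} (ha : a ≤ a') (hd : d' ≤ d) :
    Branch c f q r V a' d' := by
  have h : Ioo a' d' ⊆ Ioo a d := Ioo_subset_Ioo ha hd
  exact ⟨fun s hs => B.mem s (h hs), fun s hs => B.r_pos s (h hs), fun s hs => B.V_pos s (h hs),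
    fun s hs => B.deriv_r s (h hs), fun s hs => B.deriv_V s (h hs),
    fun s hs => B.energy s (h hs)⟩

theorem q_pos (B : Branch c f q r V a d) (W : Weight q Hinf linf) {s : ℝ} (hs : s ∈ Ioo a d) :
    0 < q (r s) := W.pos (B.r_pos s hs)

theorem slp_pos (B : Branch c f q r V a d) (W : Weight q Hinf linf) {s : ℝ}
    (hs : s ∈ Ioo a d) : 0 < slp q r V s := div_pos (B.V_pos s hs) (B.q_pos W hs)

theorem V_eq (B : Branch c f q r V a d) (W : Weight q Hinf linf) {s : ℝ}
    (hs : s ∈ Ioo a d) : V s = q (r s) * slp q r V s := by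
  have := (B.q_pos W hs).ne'
  simp only [slp]; field_simp

theorem nrg_pos (B : Branch c f q r V a d) {s : ℝ} (hs : s ∈ Ioo a d) :
    0 < nrg f q r V s := B.energy s hs

theorem hasDerivAt_r (B : Branch c f q r V a d) {s : ℝ} (hs : s ∈ Ioo a d) :
    HasDerivAt r (-(1 / slp q r V s)) s := by
  have := B.deriv_r s hs
  simpa [slp] using this

theorem hasDerivAt_slp (B : Branch c f q r V a d) (W : Weight q Hinf linf) {s : ℝ}
    (hs : s ∈ Ioo a d) :
    HasDerivAt (slp q r V) (deriv q (r s) / q (r s) - f s / slp q r V s) s := by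
  have hq := B.q_pos W hs
  have hV := B.V_pos s hs
  have h1 : HasDerivAt (fun s => q (r s)) _ s :=
    (W.hasDerivAt (B.r_pos s hs)).comp s (B.deriv_r s hs)
  have h2 := (B.deriv_V s hs).div h1 hq.ne'
  refine HasDerivAt.congr_deriv (f := slp q r V) h2 ?_
  simp only [slp]
  field_simp
  ring

theorem hasDerivAt_nrg (B : Branch c f q r V a d) (W : Weight q Hinf linf)
    (N : Nonlin c b β f) {s : ℝ} (hs : s ∈ Ioo a d) :
    HasDerivAt (nrg f q r V) (2 * slp q r V s * (deriv q (r s) / q (r s))) s := by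
  have h := ((B.hasDerivAt_slp W hs).pow 2).add ((N.hasDerivAt_primF (B.mem s hs)).const_mul 2)
  refine HasDerivAt.congr_deriv (f := nrg f q r V) h ?_
  have := (B.slp_pos W hs).ne'
  field_simp
  ring

theorem continuousAt_slp (B : Branch c f q r V a d) (W : Weight q Hinf linf) {s : ℝ}
    (hs : s ∈ Ioo a d) : ContinuousAt (slp q r V) s := (B.hasDerivAt_slp W hs).continuousAt

theorem strictAntiOn_r (B : Branch c f q r V a d) (W : Weight q Hinf linf) :
    StrictAntiOn r (Ioo a d) := by
  refine strictAntiOn_of_deriv_neg (convex_Ioo a d) ?_ ?_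
  · exact fun s hs => (B.deriv_r s hs).continuousAt.continuousWithinAt
  · intro s hs
    rw [interior_Ioo] at hs
    rw [(B.hasDerivAt_r hs).deriv]
    have := one_div_pos.2 (B.slp_pos W hs)
    linarith

/-- Where the second branch is steeper, `r₁ - r₂` decreases with the level. -/
theorem sub_r_strictAntiOn (B₁ : Branch c f q r₁ V₁ a d) (B₂ : Branch c f q r₂ V₂ a d)
    (W : Weight q Hinf linf) {s₀ s₁ : ℝ} (h0 : a < s₀) (h1 : s₁ < d)
    (hp : ∀ s ∈ Ioo s₀ s₁, slp q r₁ V₁ s < slp q r₂ V₂ s) :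
    StrictAntiOn (fun s => r₁ s - r₂ s) (Icc s₀ s₁) := by
  have hsub : Icc s₀ s₁ ⊆ Ioo a d := Icc_subset_Ioo h0 h1
  refine strictAntiOn_Icc_of_hasDerivAt
    (fun s hs => (B₁.hasDerivAt_r (hsub hs)).sub (B₂.hasDerivAt_r (hsub hs))) ?_
  intro s hs
  have := one_div_lt_one_div_of_lt (B₁.slp_pos W (hsub (Ioo_subset_Icc_self hs))) (hp s hs)
  linarith

/-- While the first branch is ahead in time and flatter at the start, it stays flatter,
because `q' / q` decreases. -/
theorem slp_lt_of_r_lt (B₁ : Branch c f q r₁ V₁ a d) (B₂ : Branch c f q r₂ V₂ a d)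
    (W : Weight q Hinf linf) {s₀ s₁ : ℝ} (h0 : a < s₀) (h1 : s₁ < d)
    (hr : ∀ s ∈ Ico s₀ s₁, r₁ s < r₂ s) (hp : slp q r₁ V₁ s₁ < slp q r₂ V₂ s₁) :
    ∀ s ∈ Icc s₀ s₁, slp q r₁ V₁ s < slp q r₂ V₂ s := by
  have hsub : Icc s₀ s₁ ⊆ Ioo a d := Icc_subset_Ioo h0 h1
  have := backward_barrier (D := fun s => slp q r₂ V₂ s - slp q r₁ V₁ s) (s₀ := s₀) (s₁ := s₁)
    (fun s hs => ((B₂.continuousAt_slp W (hsub hs)).sub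
      (B₁.continuousAt_slp W (hsub hs))).continuousWithinAt) (sub_pos.2 hp) ?_
  · exact fun s hs => sub_pos.1 (this s hs)
  · intro s hs hD hpos
    have hs' := hsub ⟨hs.1, hs.2.le⟩
    have hder := (B₂.hasDerivAt_slp W hs').sub (B₁.hasDerivAt_slp W hs')
    have h3 := deriv_nonneg_of_nonneg_right (s₁ := s₁) hder hD hs.2
      (fun t ht => (hpos t ht).le)
    have h4 := W.deriv_div_lt (B₁.r_pos s hs') (hr s hs)
    have h5 : slp q r₂ V₂ s = slp q r₁ V₁ s := by linarith
    rw [h5] at h3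
    linarith

/-- Local uniqueness for the system `r' = -q / V`, `V' = -q² f / V`. It is Lipschitz in `(r, V)`
for fixed `s`, so continuity of `f` suffices. -/
theorem eventuallyEq (B₁ : Branch c f q r₁ V₁ a d) (B₂ : Branch c f q r₂ V₂ a d)
    (W : Weight q Hinf linf) (N : Nonlin c b β f) {s₀ : ℝ} (hs : s₀ ∈ Ioo a d)
    (hr : r₁ s₀ = r₂ s₀) (hV : V₁ s₀ = V₂ s₀) :
    ∀ᶠ s in 𝓝 s₀, r₁ s = r₂ s ∧ V₁ s = V₂ s := by
  have hV0 := (B₁.V_pos s₀ hs)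
  have hr0 := (B₁.r_pos s₀ hs)
  have hq : ContDiffAt ℝ 1 q (r₁ s₀) := W.c1.contDiff.contDiffAt (Ioi_mem_nhds hr0)
  have hq' : ContDiffAt ℝ 1 (fun z : ℝ × ℝ => q z.1) (r₁ s₀, V₁ s₀) :=
    hq.comp (r₁ s₀, V₁ s₀) contDiffAt_fst
  have h1 : ContDiffAt ℝ 1 (fun z : ℝ × ℝ => -(q z.1 / z.2)) (r₁ s₀, V₁ s₀) :=
    (hq'.div contDiffAt_snd hV0.ne').neg
  have h2 : ContDiffAt ℝ 1 (fun z : ℝ × ℝ => -(q z.1 ^ 2 / z.2)) (r₁ s₀, V₁ s₀) :=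
    ((hq'.pow 2).div contDiffAt_snd hV0.ne').neg
  obtain ⟨K₁, t₁, ht₁, hL₁⟩ := h1.exists_lipschitzOnWith
  obtain ⟨K₂, t₂, ht₂, hL₂⟩ := h2.exists_lipschitzOnWith
  have hfc := N.continuousAt (B₁.mem s₀ hs)
  have hfb : ∀ᶠ s in 𝓝 s₀, |f s| ≤ |f s₀| + 1 :=
    (hfc.abs.eventually_lt_const (lt_add_one _)).mono fun _ h => h.le
  set M : NNReal := ⟨|f s₀| + 1, by positivity⟩ with hM
  have key := ODE_solution_unique_of_eventually (t₀ := s₀)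
    (v := fun s (z : ℝ × ℝ) => (-(q z.1 / z.2), f s * -(q z.1 ^ 2 / z.2)))
    (s := fun _ => t₁ ∩ t₂) (K := max K₁ (M * K₂))
    (f := fun s => (r₁ s, V₁ s)) (g := fun s => (r₂ s, V₂ s)) ?_ ?_ ?_ ?_
  · filter_upwards [key] with s hs
    exact ⟨congrArg Prod.fst hs, congrArg Prod.snd hs⟩
  · filter_upwards [hfb] with s hs
    refine LipschitzOnWith.prodMk (hL₁.mono inter_subset_left) ?_
    have := (lipschitzWith_smul (f s)).comp_lipschitzOnWith (hL₂.mono (s := t₁ ∩ t₂) inter_subset_right)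
    refine LipschitzOnWith.weaken this ?_
    gcongr
    exact hs
  · have hmem : ∀ᶠ s in 𝓝 s₀, s ∈ Ioo a d := Ioo_mem_nhds hs.1 hs.2
    have hcont : ContinuousAt (fun s => (r₁ s, V₁ s)) s₀ :=
      (B₁.deriv_r s₀ hs).continuousAt.prodMk (B₁.deriv_V s₀ hs).continuousAt
    filter_upwards [hmem, hcont (inter_mem ht₁ ht₂)] with s hs hst
    refine ⟨(HasDerivAt.prodMk (B₁.deriv_r s hs) (B₁.deriv_V s hs)).congr_deriv ?_, hst⟩
    ext
    · rfl
    · simp; ring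
  · have hmem : ∀ᶠ s in 𝓝 s₀, s ∈ Ioo a d := Ioo_mem_nhds hs.1 hs.2
    have hcont : ContinuousAt (fun s => (r₂ s, V₂ s)) s₀ :=
      (B₂.deriv_r s₀ hs).continuousAt.prodMk (B₂.deriv_V s₀ hs).continuousAt
    have hin : t₁ ∩ t₂ ∈ 𝓝 (r₂ s₀, V₂ s₀) := by rw [← hr, ← hV]; exact inter_mem ht₁ ht₂
    filter_upwards [hmem, hcont hin] with s hs hst
    refine ⟨(HasDerivAt.prodMk (B₂.deriv_r s hs) (B₂.deriv_V s hs)).congr_deriv ?_, hst⟩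
    ext
    · rfl
    · simp; ring
  · simp only [hr, hV]

/-- Branches over the same interval which agree at one level agree. -/
theorem eqOn (B₁ : Branch c f q r₁ V₁ a d) (B₂ : Branch c f q r₂ V₂ a d)
    (W : Weight q Hinf linf) (N : Nonlin c b β f) {s₀ : ℝ} (hs : s₀ ∈ Ioo a d)
    (hr : r₁ s₀ = r₂ s₀) (hV : V₁ s₀ = V₂ s₀) :
    ∀ s ∈ Ioo a d, r₁ s = r₂ s ∧ V₁ s = V₂ s := by
  set U : Set ℝ := {x | ∀ᶠ s in 𝓝 x, r₁ s = r₂ s ∧ V₁ s = V₂ s}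
  have hU : IsOpen U := isOpen_setOfPred_eventually_nhds
  have hsub : Ioo a d ⊆ U := by
    refine isPreconnected_Ioo.subset_of_closure_inter_subset hU
      ⟨s₀, hs, B₁.eventuallyEq B₂ W N hs hr hV⟩ ?_
    rintro x ⟨hx, hxm⟩
    have hfr : ∃ᶠ s in 𝓝 x, r₁ s = r₂ s ∧ V₁ s = V₂ s :=
      (mem_closure_iff_frequently.1 hx).mono fun s hs => hs.self_of_nhds
    have e1 : r₁ x - r₂ x = 0 := by
      by_contra hne
      have hcont : ContinuousAt (fun s => r₁ s - r₂ s) x :=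
        (B₁.deriv_r x hxm).continuousAt.sub (B₂.deriv_r x hxm).continuousAt
      obtain ⟨s, hs1, hs2⟩ := (hfr.and_eventually (hcont.eventually_ne hne)).exists
      exact hs2 (sub_eq_zero.2 hs1.1)
    have e2 : V₁ x - V₂ x = 0 := by
      by_contra hne
      have hcont : ContinuousAt (fun s => V₁ s - V₂ s) x :=
        (B₁.deriv_V x hxm).continuousAt.sub (B₂.deriv_V x hxm).continuousAt
      obtain ⟨s, hs1, hs2⟩ := (hfr.and_eventually (hcont.eventually_ne hne)).exists
      exact hs2 (sub_eq_zero.2 hs1.2)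
    exact B₁.eventuallyEq B₂ W N hxm (sub_eq_zero.1 e1) (sub_eq_zero.1 e2)
  exact fun s hs => (hsub hs).self_of_nhds

end Branch

/-! ### Comparison of two branches at low levels -/

namespace Branch

variable {c : EReal} {b β Hinf linf : ℝ} {f q : ℝ → ℝ} {r V r₁ V₁ r₂ V₂ : ℝ → ℝ} {a d : ℝ}

/-- Comparison of slopes by a barrier: the slopes cannot meet at a level above which the first
branch is flatter, if it is late (`r₂ ≤ r₁`) at the start. -/
theorem slp_lt_of_contact (B₁ : Branch c f q r₁ V₁ a d) (B₂ : Branch c f q r₂ V₂ a d)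
    (W : Weight q Hinf linf) {s₀ s₁ : ℝ} (h0 : a < s₀) (h1 : s₁ < d)
    (hr : r₂ s₁ ≤ r₁ s₁) (hp : slp q r₁ V₁ s₁ < slp q r₂ V₂ s₁)
    (hcon : ∀ s ∈ Ico s₀ s₁, slp q r₁ V₁ s = slp q r₂ V₂ s →
      (∀ t ∈ Ioc s s₁, slp q r₁ V₁ t < slp q r₂ V₂ t) →
      (∀ t ∈ Ico s s₁, r₂ t < r₁ t) → False) :
    ∀ s ∈ Icc s₀ s₁, slp q r₁ V₁ s < slp q r₂ V₂ s := by
  have hsub : Icc s₀ s₁ ⊆ Ioo a d := Icc_subset_Ioo h0 h1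
  have := backward_barrier (D := fun s => slp q r₂ V₂ s - slp q r₁ V₁ s) (s₀ := s₀) (s₁ := s₁)
    (fun s hs => ((B₂.continuousAt_slp W (hsub hs)).sub
      (B₁.continuousAt_slp W (hsub hs))).continuousWithinAt) (sub_pos.2 hp) ?_
  · exact fun s hs => sub_pos.1 (this s hs)
  · intro s hs hD hpos
    have hanti := B₁.sub_r_strictAntiOn B₂ W (s₀ := s) (h0.trans_le hs.1) h1
      (fun t ht => sub_pos.1 (hpos t ⟨ht.1, ht.2.le⟩))
    refine hcon s hs (by linarith) (fun t ht => sub_pos.1 (hpos t ht)) ?_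
    intro t ht
    have := hanti ⟨ht.1, ht.2.le⟩ (right_mem_Icc.2 (ht.1.trans ht.2.le)) ht.2
    simp only at this
    linarith

theorem r_lt_of_slp_lt (B₁ : Branch c f q r₁ V₁ a d) (B₂ : Branch c f q r₂ V₂ a d)
    (W : Weight q Hinf linf) {s₀ s₁ : ℝ} (h0 : a < s₀) (h1 : s₁ < d) (hr : r₂ s₁ ≤ r₁ s₁)
    (hp : ∀ s ∈ Ioo s₀ s₁, slp q r₁ V₁ s < slp q r₂ V₂ s) :
    ∀ s ∈ Ico s₀ s₁, r₂ s < r₁ s := by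
  intro s hs
  have := B₁.sub_r_strictAntiOn B₂ W h0 h1 hp ⟨hs.1, hs.2.le⟩
    (right_mem_Icc.2 (hs.1.trans hs.2.le)) hs.2
  simp only at this
  linarith

/-- `d/ds (q² E) = -4 q q' F / p`. -/
theorem hasDerivAt_sq_mul_nrg (B : Branch c f q r V a d) (W : Weight q Hinf linf)
    (N : Nonlin c b β f) {s : ℝ} (hs : s ∈ Ioo a d) :
    HasDerivAt (fun s => q (r s) ^ 2 * nrg f q r V s)
      (deriv q (r s) * q (r s) * (-(4 * primF f s)) * (1 / slp q r V s)) s := by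
  have h1 : HasDerivAt (fun s => q (r s)) _ s :=
    (W.hasDerivAt (B.r_pos s hs)).comp s (B.hasDerivAt_r hs)
  have h := (h1.pow 2).mul (B.hasDerivAt_nrg W N hs)
  refine HasDerivAt.congr_deriv (f := fun s => q (r s) ^ 2 * nrg f q r V s) h ?_
  have hp := (B.slp_pos W hs).ne'
  have hq := (B.q_pos W hs).ne'
  simp only [nrg]
  simp
  field_simp
  ring

/-- Between the levels `-β` and `β`, where `F ≤ 0`, the weighted energies `q² E` compare. -/
theorem sq_mul_nrg_compare (B₁ : Branch c f q r₁ V₁ a d) (B₂ : Branch c f q r₂ V₂ a d)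
    (W : Weight q Hinf linf) (N : Nonlin c b β f) {s₀ s₁ : ℝ} (h0 : a < s₀) (h1 : s₁ < d)
    (hβ0 : -β ≤ s₀) (hβ1 : s₁ ≤ β) (hr : r₂ s₁ ≤ r₁ s₁)
    (hE : q (r₁ s₁) ^ 2 * nrg f q r₁ V₁ s₁ ≤ q (r₂ s₁) ^ 2 * nrg f q r₂ V₂ s₁)
    (hp : slp q r₁ V₁ s₁ < slp q r₂ V₂ s₁) :
    (∀ s ∈ Icc s₀ s₁, slp q r₁ V₁ s < slp q r₂ V₂ s) ∧
    (∀ s ∈ Icc s₀ s₁, q (r₁ s) ^ 2 * nrg f q r₁ V₁ s ≤ q (r₂ s) ^ 2 * nrg f q r₂ V₂ s) := by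
  have hsub : Icc s₀ s₁ ⊆ Ioo a d := Icc_subset_Ioo h0 h1
  have step : ∀ s ∈ Icc s₀ s₁, (∀ t ∈ Ioc s s₁, slp q r₁ V₁ t < slp q r₂ V₂ t) →
      q (r₁ s) ^ 2 * nrg f q r₁ V₁ s ≤ q (r₂ s) ^ 2 * nrg f q r₂ V₂ s := by
    intro s hs hpos
    have hrr := B₁.r_lt_of_slp_lt B₂ W (s₀ := s) (h0.trans_le hs.1) h1 hr
      (fun t ht => hpos t ⟨ht.1, ht.2.le⟩)
    have hmono := monotoneOn_Icc_of_hasDerivAt (x := s) (y := s₁)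
      (g := fun s => q (r₁ s) ^ 2 * nrg f q r₁ V₁ s - q (r₂ s) ^ 2 * nrg f q r₂ V₂ s)
      (fun t ht => (B₁.hasDerivAt_sq_mul_nrg W N (hsub ⟨hs.1.trans ht.1, ht.2⟩)).sub
        (B₂.hasDerivAt_sq_mul_nrg W N (hsub ⟨hs.1.trans ht.1, ht.2⟩))) ?_
    · have := hmono (left_mem_Icc.2 hs.2) (right_mem_Icc.2 hs.2) hs.2
      simp only at this
      linarith
    · intro t ht
      have ht' := hsub ⟨hs.1.trans ht.1.le, ht.2.le⟩
      have hF : primF f t ≤ 0 := by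
        apply N.primF_nonpos
        have := ht.1; have := ht.2; have := hs.1
        exact abs_le.2 ⟨by linarith, by linarith⟩
      have hqq : deriv q (r₂ t) * q (r₂ t) ≤ deriv q (r₁ t) * q (r₁ t) :=
        (W.c5 (B₂.r_pos t ht') (B₁.r_pos t ht') (hrr t ⟨ht.1.le, ht.2⟩)).le
      have hpp := one_div_le_one_div_of_le (B₁.slp_pos W ht') (hpos t ⟨ht.1, ht.2.le⟩).le
      have h2 := mul_pos (W.c1.deriv_pos _ (B₂.r_pos t ht')) (B₂.q_pos W ht')
      have h3 := one_div_pos.2 (B₂.slp_pos W ht')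
      rw [sub_nonneg]
      apply mul_le_mul _ hpp h3.le (mul_nonneg (h2.le.trans hqq) (by linarith))
      exact mul_le_mul_of_nonneg_right hqq (by linarith)
  have hall := B₁.slp_lt_of_contact B₂ W h0 h1 hr hp (s₀ := s₀) ?_
  · exact ⟨hall, fun s hs => step s hs fun t ht => hall t ⟨hs.1.trans ht.1.le, ht.2⟩⟩
  · intro s hs heq hpos hrr
    have hs' := hsub ⟨hs.1, hs.2.le⟩
    have h2 := step s ⟨hs.1, hs.2.le⟩ hpos
    have hE1 := B₁.nrg_pos hs'
    have hEE : nrg f q r₂ V₂ s = nrg f q r₁ V₁ s := by simp only [nrg, heq]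
    rw [hEE] at h2
    have h3 := le_of_mul_le_mul_right h2 hE1
    have h4 := W.lt (B₂.r_pos s hs').le (hrr s ⟨le_rfl, hs.2⟩)
    have := pow_lt_pow_left₀ h4 (B₂.q_pos W hs').le (two_ne_zero)
    linarith

/-- `d/ds V² = -2 q² f`. -/
theorem hasDerivAt_V_sq (B : Branch c f q r V a d) {s : ℝ} (hs : s ∈ Ioo a d) :
    HasDerivAt (fun s => V s ^ 2) (-(2 * q (r s) ^ 2 * f s)) s := by
  refine ((B.deriv_V s hs).pow 2).congr_deriv ?_
  have := (B.V_pos s hs).ne'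
  simp
  field_simp

/-- Below the level `-b`, where `f < 0`, the fluxes compare. -/
theorem V_compare (B₁ : Branch c f q r₁ V₁ a d) (B₂ : Branch c f q r₂ V₂ a d)
    (W : Weight q Hinf linf) (N : Nonlin c b β f) {s₀ s₁ : ℝ} (h0 : a < s₀) (h1 : s₁ < d)
    (hβ1 : s₁ ≤ -b) (hr : r₂ s₁ ≤ r₁ s₁) (hV : V₁ s₁ ≤ V₂ s₁)
    (hp : slp q r₁ V₁ s₁ < slp q r₂ V₂ s₁) :
    (∀ s ∈ Icc s₀ s₁, slp q r₁ V₁ s < slp q r₂ V₂ s) ∧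
    StrictAntiOn (fun s => V₂ s ^ 2 - V₁ s ^ 2) (Icc s₀ s₁) := by
  have hsub : Icc s₀ s₁ ⊆ Ioo a d := Icc_subset_Ioo h0 h1
  have step : ∀ s ∈ Icc s₀ s₁, (∀ t ∈ Ioc s s₁, slp q r₁ V₁ t < slp q r₂ V₂ t) →
      StrictAntiOn (fun s => V₂ s ^ 2 - V₁ s ^ 2) (Icc s s₁) := by
    intro s hs hpos
    have hrr := B₁.r_lt_of_slp_lt B₂ W (s₀ := s) (h0.trans_le hs.1) h1 hr
      (fun t ht => hpos t ⟨ht.1, ht.2.le⟩)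
    refine strictAntiOn_Icc_of_hasDerivAt
      (fun t ht => (B₂.hasDerivAt_V_sq (hsub ⟨hs.1.trans ht.1, ht.2⟩)).sub
        (B₁.hasDerivAt_V_sq (hsub ⟨hs.1.trans ht.1, ht.2⟩))) ?_
    intro t ht
    have ht' := hsub ⟨hs.1.trans ht.1.le, ht.2.le⟩
    have hft : f t < 0 := by
      have h3 := N.pos (s := -t) (by have := ht.2; linarith) (neg_mem_dom (B₁.mem t ht'))
      rw [N.odd (B₁.mem t ht')] at h3
      linarith
    have h4 := W.lt (B₂.r_pos t ht').le (hrr t ⟨ht.1.le, ht.2⟩)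
    have h5 := pow_lt_pow_left₀ h4 (B₂.q_pos W ht').le (two_ne_zero)
    nlinarith
  have hall := B₁.slp_lt_of_contact B₂ W h0 h1 hr hp (s₀ := s₀) ?_
  · rcases le_or_gt s₀ s₁ with hle | hgt
    · have := step s₀ (left_mem_Icc.2 hle) fun t ht => hall t ⟨ht.1.le, ht.2⟩
      exact ⟨hall, this⟩
    · simp [Icc_eq_empty (not_le.2 hgt), StrictAntiOn]
  · intro s hs heq hpos hrr
    have hs' := hsub ⟨hs.1, hs.2.le⟩
    have h2 := step s ⟨hs.1, hs.2.le⟩ hpos (left_mem_Icc.2 hs.2.le) (right_mem_Icc.2 hs.2.le) hs.2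
    simp only at h2
    have h3 : V₁ s₁ ^ 2 ≤ V₂ s₁ ^ 2 := by
      have := (B₁.V_pos s₁ (hsub (right_mem_Icc.2 (hs.1.trans hs.2.le)))).le
      gcongr
    have h4 : V₁ s ^ 2 < V₂ s ^ 2 := by linarith
    have h5 := lt_of_pow_lt_pow_left₀ 2 (B₂.V_pos s hs').le h4
    rw [B₁.V_eq W hs', B₂.V_eq W hs', heq] at h5
    have h6 := lt_of_mul_lt_mul_right h5 (B₂.slp_pos W hs').le
    exact absurd (W.lt (B₂.r_pos s hs').le (hrr s ⟨le_rfl, hs.2⟩)) (not_lt.2 h6.le)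

/-- While the first branch is early and flatter, `q(r₁) (p₂² - p₁²)` decreases with the
level. -/
theorem gap_antitoneOn (B₁ : Branch c f q r₁ V₁ a d) (B₂ : Branch c f q r₂ V₂ a d)
    (W : Weight q Hinf linf) {s₀ s₁ : ℝ} (h0 : a < s₀) (h1 : s₁ < d)
    (hr : ∀ s ∈ Ioo s₀ s₁, r₁ s < r₂ s)
    (hp : ∀ s ∈ Ioo s₀ s₁, slp q r₁ V₁ s < slp q r₂ V₂ s) :
    AntitoneOn (fun s => q (r₁ s) * (slp q r₂ V₂ s ^ 2 - slp q r₁ V₁ s ^ 2)) (Icc s₀ s₁) := by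
  have hsub : Icc s₀ s₁ ⊆ Ioo a d := Icc_subset_Ioo h0 h1
  have hq1 : ∀ s ∈ Icc s₀ s₁, HasDerivAt (fun s => q (r₁ s)) _ s := fun s hs =>
    (W.hasDerivAt (B₁.r_pos s (hsub hs))).comp s (B₁.hasDerivAt_r (hsub hs))
  refine antitoneOn_Icc_of_hasDerivAt
    (fun s hs => (hq1 s hs).mul (((B₂.hasDerivAt_slp W (hsub hs)).pow 2).sub
      ((B₁.hasDerivAt_slp W (hsub hs)).pow 2))) ?_
  intro s hs
  have hs' := hsub (Ioo_subset_Icc_self hs)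
  have hp1 := B₁.slp_pos W hs'
  have hp2 := B₂.slp_pos W hs'
  have hB := W.deriv_div_lt (B₁.r_pos s hs') (hr s hs)
  have hpp := hp s hs
  have hq := B₁.q_pos W hs'
  have hd := W.c1.deriv_pos _ (B₁.r_pos s hs')
  have hB1 : 0 < deriv q (r₁ s) / q (r₁ s) := div_pos hd hq
  have e : deriv q (r₁ s) = q (r₁ s) * (deriv q (r₁ s) / q (r₁ s)) := by field_simp
  set P1 := slp q r₁ V₁ s
  set P2 := slp q r₂ V₂ s
  set b1 := deriv q (r₁ s) / q (r₁ s)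
  set b2 := deriv q (r₂ s) / q (r₂ s)
  have e2 : deriv q (r₁ s) * -(1 / P1) * (P2 ^ 2 - P1 ^ 2) +
      q (r₁ s) * ((2:ℕ) * P2 ^ (2 - 1) * (b2 - f s / P2) - (2:ℕ) * P1 ^ (2 - 1) * (b1 - f s / P1)) =
      q (r₁ s) * (2 * P2 * (b2 - b1) - b1 * (P2 - P1) ^ 2 / P1) := by
    rw [e]
    simp
    field_simp
    ring
  rw [e2]
  apply mul_nonpos_of_nonneg_of_nonpos hq.le
  have h5 : 0 ≤ b1 * (P2 - P1) ^ 2 / P1 := by positivity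
  have h6 : 2 * P2 * (b2 - b1) ≤ 0 := mul_nonpos_of_nonneg_of_nonpos (by linarith) (by linarith)
  linarith

/-- Below `b` the flux is bounded. -/
theorem V_le_of_le (B : Branch c f q r V 0 d) (N : Nonlin c b β f) {s s₁ : ℝ}
    (hs : 0 < s) (hss : s ≤ s₁) (h1 : s₁ < d) (hb : s₁ ≤ b) : V s ≤ V s₁ := by
  have hsub : Icc s s₁ ⊆ Ioo 0 d := Icc_subset_Ioo hs h1
  refine monotoneOn_Icc_of_hasDerivAt (fun t ht => B.deriv_V t (hsub ht)) ?_
    (left_mem_Icc.2 hss) (right_mem_Icc.2 hss) hss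
  intro t ht
  have ht' := hsub (Ioo_subset_Icc_self ht)
  have hf := N.c1.nonpos t ⟨ht'.1.le, ht.2.le.trans hb⟩
  rw [neg_nonneg]
  exact div_nonpos_of_nonpos_of_nonneg
    (mul_nonpos_of_nonneg_of_nonpos (sq_nonneg _) hf) (B.V_pos t ht').le

/-- The first branch cannot stay early and flatter down to the level `0`. -/
theorem false_of_r_lt (B₁ : Branch c f q r₁ V₁ 0 d) (B₂ : Branch c f q r₂ V₂ 0 d)
    (W : Weight q Hinf linf) (N : Nonlin c b β f) {s₁ : ℝ} (h0 : 0 < s₁) (h1 : s₁ < d)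
    (hr : ∀ s ∈ Ioo 0 s₁, r₁ s < r₂ s)
    (hp : ∀ s ∈ Ioo 0 s₁, slp q r₁ V₁ s < slp q r₂ V₂ s)
    (hlim : Tendsto (slp q r₂ V₂) (𝓝[>] 0) (𝓝 0)) : False := by
  set m := min s₁ b / 2 with hm
  have hmin : 0 < min s₁ b := lt_min h0 N.c1.b_pos
  have hm0 : 0 < m := half_pos hmin
  have hm1 : m < s₁ := (half_lt_self hmin).trans_le (min_le_left _ _)
  have hmb : m ≤ b := (half_lt_self hmin).le.trans (min_le_right _ _)
  have hmm : m ∈ Ioo 0 d := ⟨hm0, hm1.trans h1⟩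
  set δ := q (r₁ m) * (slp q r₂ V₂ m ^ 2 - slp q r₁ V₁ m ^ 2) with hδ
  have hδ0 : 0 < δ := by
    apply mul_pos (B₁.q_pos W hmm)
    have := pow_lt_pow_left₀ (hp m ⟨hm0, hm1⟩) (B₁.slp_pos W hmm).le two_ne_zero
    linarith
  have hV2 := B₂.V_pos m hmm
  have hev : ∀ᶠ s in 𝓝[>] 0, slp q r₂ V₂ s < δ / V₂ m :=
    hlim.eventually_lt_const (div_pos hδ0 hV2)
  obtain ⟨s, hs1, hs2⟩ := (hev.and (Ioo_mem_nhdsGT hm0)).exists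
  have hs' : s ∈ Ioo 0 d := ⟨hs2.1, hs2.2.trans (hm1.trans h1)⟩
  have hs3 : s ∈ Ioo 0 s₁ := ⟨hs2.1, hs2.2.trans hm1⟩
  have h3 := B₁.gap_antitoneOn B₂ W (s₀ := s) (s₁ := m) hs2.1 hmm.2
    (fun t ht => hr t ⟨hs2.1.trans ht.1, ht.2.trans hm1⟩)
    (fun t ht => hp t ⟨hs2.1.trans ht.1, ht.2.trans hm1⟩)
    (left_mem_Icc.2 hs2.2.le) (right_mem_Icc.2 hs2.2.le) hs2.2.le
  simp only at h3
  rw [lt_div_iff₀ hV2] at hs1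
  have h4 : V₂ s ≤ V₂ m := B₂.V_le_of_le N hs2.1 hs2.2.le hmm.2 hmb
  have h5 := W.lt (B₁.r_pos s hs').le (hr s hs3)
  have h6 := B₂.V_eq W hs'
  have hp2 := B₂.slp_pos W hs'
  have h7 : q (r₁ s) * (slp q r₂ V₂ s ^ 2 - slp q r₁ V₁ s ^ 2) ≤ V₂ s * slp q r₂ V₂ s := by
    rw [h6]
    have := B₁.q_pos W hs'
    nlinarith [mul_nonneg this.le (sq_nonneg (slp q r₁ V₁ s)), mul_le_mul_of_nonneg_right h5.le (sq_nonneg (slp q r₂ V₂ s))]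
  nlinarith

/-- `d/ds (Q/q √E) = (p² - H (2 p² + 2 F)) / (p √E)`. -/
theorem hasDerivAt_tail (B : Branch c f q r V a d) (W : Weight q Hinf linf)
    (N : Nonlin c b β f) {s : ℝ} (hs : s ∈ Ioo a d) :
    HasDerivAt (fun s => primQ q (r s) / q (r s) * √(nrg f q r V s))
      ((slp q r V s ^ 2 - funH q (r s) * (2 * slp q r V s ^ 2 + 2 * primF f s)) /
        (slp q r V s * √(nrg f q r V s))) s := by
  have hr := B.r_pos s hs
  have hE := B.nrg_pos hs
  have h1 : HasDerivAt (fun s => primQ q (r s) / q (r s)) _ s :=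
    (W.hasDerivAt_div hr).1.comp s (B.hasDerivAt_r hs)
  have h := h1.mul ((B.hasDerivAt_nrg W N hs).sqrt hE.ne')
  refine HasDerivAt.congr_deriv
    (f := fun s => primQ q (r s) / q (r s) * √(nrg f q r V s)) h ?_
  have hp := (B.slp_pos W hs).ne'
  have hsq : √(nrg f q r V s) ^ 2 = nrg f q r V s := Real.sq_sqrt hE.le
  have hsq0 : √(nrg f q r V s) ≠ 0 := (Real.sqrt_pos.2 hE).ne'
  have hH := (W.hasDerivAt_div hr).2
  have e : primQ q (r s) / q (r s) * (deriv q (r s) / q (r s)) = 1 - funH q (r s) := by linarith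
  have e2 : nrg f q r V s = slp q r V s ^ 2 + 2 * primF f s := rfl
  generalize √(nrg f q r V s) = R at *
  rw [e2] at hsq
  rw [eq_div_iff (mul_ne_zero hp hsq0)]
  have e3 : (funH q (r s) * -(1 / slp q r V s) * R +
      primQ q (r s) / q (r s) * (2 * slp q r V s * (deriv q (r s) / q (r s)) / (2 * R))) *
      (slp q r V s * R) = - funH q (r s) * R ^ 2 + (primQ q (r s) / q (r s) *
        (deriv q (r s) / q (r s))) * slp q r V s ^ 2 := by
    field_simp
  rw [e3, e, hsq]
  ring

/-- At a level in `(0, β]` a late first branch (`r₁ ≥ r₂`) cannot have the smaller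
`Q/q √E`: the gap would persist down to the level `0`. -/
theorem false_of_tail (B₁ : Branch c f q r₁ V₁ 0 d) (B₂ : Branch c f q r₂ V₂ 0 d)
    (W : Weight q Hinf linf) (N : Nonlin c b β f) {s₁ : ℝ} (h0 : 0 < s₁) (h1 : s₁ < d)
    (hβ : s₁ ≤ β) (hr : r₂ s₁ ≤ r₁ s₁)
    (hg : primQ q (r₁ s₁) / q (r₁ s₁) * √(nrg f q r₁ V₁ s₁) <
      primQ q (r₂ s₁) / q (r₂ s₁) * √(nrg f q r₂ V₂ s₁))
    (hlim : Tendsto (slp q r₂ V₂) (𝓝[>] 0) (𝓝 0)) : False := by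
  have hs1 : s₁ ∈ Ioo 0 d := ⟨h0, h1⟩
  have hgmono : ∀ {x y : ℝ}, 0 < x → x ≤ y → primQ q x / q x ≤ primQ q y / q y :=
    fun hx hxy => W.div_strictMonoOn.monotoneOn hx (hx.trans_le hxy) hxy
  have gpos : ∀ {x : ℝ}, 0 < x → 0 < primQ q x / q x :=
    fun hx => div_pos (W.primQ_pos hx) (W.pos hx)
  have slp_of_nrg : ∀ {s : ℝ}, s ∈ Ioo 0 d → nrg f q r₁ V₁ s < nrg f q r₂ V₂ s →
      slp q r₁ V₁ s < slp q r₂ V₂ s := by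
    intro s hs hE
    simp only [nrg] at hE
    exact lt_of_pow_lt_pow_left₀ 2 (B₂.slp_pos W hs).le (by linarith)
  have nrg_lt : ∀ {s : ℝ}, s ∈ Ioo 0 d → r₂ s ≤ r₁ s →
      primQ q (r₁ s) / q (r₁ s) * √(nrg f q r₁ V₁ s) <
      primQ q (r₂ s) / q (r₂ s) * √(nrg f q r₂ V₂ s) → slp q r₁ V₁ s < slp q r₂ V₂ s := by
    intro s hs hrs hlt
    apply slp_of_nrg hs
    have h2 := hgmono (B₂.r_pos s hs) hrs
    by_contra! hle
    have h3 := Real.sqrt_le_sqrt hle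
    have := mul_le_mul h2 h3 (Real.sqrt_nonneg _) (gpos (B₁.r_pos s hs)).le
    linarith
  have hp := nrg_lt hs1 hr hg
  have step : ∀ s ∈ Ioc 0 s₁, (∀ t ∈ Ioc s s₁, slp q r₁ V₁ t < slp q r₂ V₂ t) →
      primQ q (r₂ s₁) / q (r₂ s₁) * √(nrg f q r₂ V₂ s₁) -
      primQ q (r₁ s₁) / q (r₁ s₁) * √(nrg f q r₁ V₁ s₁) ≤
      primQ q (r₂ s) / q (r₂ s) * √(nrg f q r₂ V₂ s) -
      primQ q (r₁ s) / q (r₁ s) * √(nrg f q r₁ V₁ s) := by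
    intro s hs hpos
    have hsub : Icc s s₁ ⊆ Ioo 0 d := Icc_subset_Ioo hs.1 h1
    have hrr := B₁.r_lt_of_slp_lt B₂ W (s₀ := s) hs.1 h1 hr
      (fun t ht => hpos t ⟨ht.1, ht.2.le⟩)
    refine antitoneOn_Icc_of_hasDerivAt (x := s) (y := s₁)
      (fun t ht => (B₂.hasDerivAt_tail W N (hsub ht)).sub
        (B₁.hasDerivAt_tail W N (hsub ht))) ?_
      (left_mem_Icc.2 hs.2) (right_mem_Icc.2 hs.2) hs.2
    intro t ht
    have ht' := hsub (Ioo_subset_Icc_self ht)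
    have hF : primF f t ≤ 0 := N.primF_nonpos (by
      rw [abs_of_pos ht'.1]; exact ht.2.le.trans hβ)
    have hH : funH q (r₁ t) ≤ funH q (r₂ t) :=
      W.c3.anti (B₂.r_pos t ht') (B₁.r_pos t ht') (hrr t ⟨ht.1.le, ht.2⟩).le
    have hH1 := W.funH_pos (B₁.r_pos t ht')
    have hH2 := W.funH_lt (B₂.r_pos t ht')
    have hp1 := B₁.slp_pos W ht'
    have hpp := hpos t ⟨ht.1, ht.2.le⟩
    have hp2 := B₂.slp_pos W ht'
    have hE1 := B₁.nrg_pos ht'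
    have hE2 := B₂.nrg_pos ht'
    have hEE : nrg f q r₁ V₁ t ≤ nrg f q r₂ V₂ t := by
      simp only [nrg]; gcongr
    have hR1 := Real.sqrt_pos.2 hE1
    have hR2 := Real.sqrt_pos.2 hE2
    have hRR := Real.sqrt_le_sqrt hEE
    have hq1 : √(nrg f q r₁ V₁ t) ^ 2 = slp q r₁ V₁ t ^ 2 + 2 * primF f t := Real.sq_sqrt hE1.le
    have hq2 : √(nrg f q r₂ V₂ t) ^ 2 = slp q r₂ V₂ t ^ 2 + 2 * primF f t := Real.sq_sqrt hE2.le
    generalize √(nrg f q r₁ V₁ t) = R1 at *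
    generalize √(nrg f q r₂ V₂ t) = R2 at *
    generalize slp q r₁ V₁ t = p1 at *
    generalize slp q r₂ V₂ t = p2 at *
    generalize funH q (r₁ t) = H1 at *
    generalize funH q (r₂ t) = H2 at *
    generalize primF f t = F at *
    have hE1' : 0 ≤ 2 * p1 ^ 2 + 2 * F := by nlinarith [sq_nonneg R1, sq_nonneg p1]
    rw [sub_nonpos]
    -- the expression is antitone in `H`, and, for fixed `H < 1/2`, antitone in `p`
    have s1 : (p1 ^ 2 - H2 * (2 * p1 ^ 2 + 2 * F)) / (p1 * R1) ≤
        (p1 ^ 2 - H1 * (2 * p1 ^ 2 + 2 * F)) / (p1 * R1) := by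
      apply div_le_div_of_nonneg_right _ (mul_pos hp1 hR1).le
      nlinarith
    refine le_trans ?_ s1
    have t1 : p2 / R2 ≤ p1 / R1 := by
      rw [div_le_div_iff₀ hR2 hR1]
      apply le_of_sq_le_sq _ (mul_pos hp1 hR2).le
      rw [mul_pow, mul_pow, hq1, hq2]
      have : p1 ^ 2 ≤ p2 ^ 2 := by gcongr
      nlinarith
    have t2 : 1 / (p2 * R2) ≤ 1 / (p1 * R1) :=
      one_div_le_one_div_of_le (mul_pos hp1 hR1) (mul_le_mul hpp.le hRR hR1.le hp2.le)
    have e : ∀ p R : ℝ, 0 < p → 0 < R → (p ^ 2 - H2 * (2 * p ^ 2 + 2 * F)) / (p * R) =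
        (1 - 2 * H2) * (p / R) + (-(2 * H2 * F)) * (1 / (p * R)) := by
      intro p R hp hR
      field_simp
      ring
    rw [e p1 R1 hp1 hR1, e p2 R2 hp2 hR2]
    have hH2' : 0 < H2 := by linarith
    have k1 := mul_le_mul_of_nonneg_left t1 (show 0 ≤ 1 - 2 * H2 by linarith)
    have k2 := mul_le_mul_of_nonneg_left t2 (show 0 ≤ -(2 * H2 * F) by nlinarith)
    linarith
  have hall : ∀ s ∈ Ioc 0 s₁, slp q r₁ V₁ s < slp q r₂ V₂ s := by
    intro s hs
    refine B₁.slp_lt_of_contact B₂ W (s₀ := s) hs.1 h1 hr hp ?_ s ⟨le_rfl, hs.2⟩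
    intro t ht heq hpos hrr
    have ht0 : 0 < t := hs.1.trans_le ht.1
    have ht' : t ∈ Ioo 0 d := ⟨ht0, ht.2.trans h1⟩
    have h3 := step t ⟨ht0, ht.2.le⟩ hpos
    have := nrg_lt ht' (hrr t ⟨le_rfl, ht.2⟩).le (by linarith)
    linarith
  set δ := primQ q (r₂ s₁) / q (r₂ s₁) * √(nrg f q r₂ V₂ s₁) -
      primQ q (r₁ s₁) / q (r₁ s₁) * √(nrg f q r₁ V₁ s₁) with hδ
  have hδ0 : 0 < δ := sub_pos.2 hg
  have hlow : ∀ s ∈ Ioc 0 s₁, δ ≤ primQ q (r₂ s) / q (r₂ s) * slp q r₂ V₂ s := by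
    intro s hs
    have hs' : s ∈ Ioo 0 d := ⟨hs.1, hs.2.trans_lt h1⟩
    have h3 := step s hs fun t ht => hall t ⟨hs.1.trans ht.1, ht.2⟩
    have h4 := mul_nonneg (gpos (B₁.r_pos s hs')).le (Real.sqrt_nonneg (nrg f q r₁ V₁ s))
    have hF : primF f s ≤ 0 := N.primF_nonpos (by
      rw [abs_of_pos hs.1]; exact hs.2.trans hβ)
    have h5 : √(nrg f q r₂ V₂ s) ≤ slp q r₂ V₂ s := by
      rw [Real.sqrt_le_left (B₂.slp_pos W hs').le]
      simp only [nrg]; linarith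
    have := mul_le_mul_of_nonneg_left h5 (gpos (B₂.r_pos s hs')).le
    linarith
  -- but `Q/q p = (Q/q²) V` tends to `0` along the second branch
  set m := min s₁ b with hm
  have hm0 : 0 < m := lt_min h0 N.c1.b_pos
  have hmd : m < d := (min_le_left _ _).trans_lt h1
  have hVm := B₂.V_pos m ⟨hm0, hmd⟩
  obtain ⟨R, hR, hR0⟩ := ((W.tendsto_tailInt.eventually_lt_const
    (div_pos hδ0 hVm)).and (eventually_gt_atTop 0)).exists
  obtain ⟨s, hs1, hs2⟩ := ((hlim.eventually_lt_const
    (div_pos hδ0 (gpos hR0))).and (Ioo_mem_nhdsGT hm0)).exists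
  have hs' : s ∈ Ioo 0 d := ⟨hs2.1, hs2.2.trans hmd⟩
  have h3 := hlow s ⟨hs2.1, hs2.2.le.trans (min_le_left _ _)⟩
  rcases le_or_gt (r₂ s) R with hle | hgt
  · have h4 := mul_le_mul_of_nonneg_right (hgmono (B₂.r_pos s hs') hle)
      (B₂.slp_pos W hs').le
    rw [lt_div_iff₀ (gpos hR0)] at hs1
    linarith
  · have h4 := W.tailInt_strictAntiOn hR0 (B₂.r_pos s hs') hgt
    have h5 := W.primQ_div_sq_le (B₂.r_pos s hs')
    have h6 := B₂.V_le_of_le N hs2.1 hs2.2.le hmd (min_le_right _ _)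
    have e : primQ q (r₂ s) / q (r₂ s) * slp q r₂ V₂ s = primQ q (r₂ s) / q (r₂ s) ^ 2 * V₂ s := by
      have := (B₂.q_pos W hs').ne'
      simp only [slp]; field_simp
    rw [e] at h3
    rw [lt_div_iff₀ hVm] at hR
    have h7 : 0 < primQ q (r₂ s) / q (r₂ s) ^ 2 :=
      div_pos (W.primQ_pos (B₂.r_pos s hs')) (pow_pos (B₂.q_pos W hs') 2)
    have h8 := mul_le_mul (h5.trans (h4.le)) h6 (B₂.V_pos s hs').le (W.tailInt_nonneg hR0)
    linarith

end Branch

/-! ### The phase plane for a decreasing elasticity -/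

/-- A strictly decreasing function with nonvanishing derivative on an open interval has a
differentiable inverse. -/
theorem exists_inverse {φ φ' : ℝ → ℝ} {J : Set ℝ} (hJ : IsOpen J) (hφ : StrictAntiOn φ J)
    (hd : ∀ s ∈ J, HasDerivAt φ (φ' s) s) (h0 : ∀ s ∈ J, φ' s ≠ 0) :
    ∃ ψ : ℝ → ℝ, (∀ s ∈ J, ψ (φ s) = s) ∧ ∀ s ∈ J, HasDerivAt ψ (φ' s)⁻¹ (φ s) := by
  have hinj := hφ.injOn
  set ψ := Function.invFunOn φ J with hψ
  have hleft : ∀ s ∈ J, ψ (φ s) = s := fun s hs => hinj.leftInvOn_invFunOn hs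
  refine ⟨ψ, hleft, fun s hs => ?_⟩
  have himg : φ '' J ∈ 𝓝 (φ s) := by
    obtain ⟨ε, hε, hb⟩ := Metric.isOpen_iff.1 hJ s hs
    rw [Real.ball_eq_Ioo] at hb
    have hsub : Icc (s - ε / 2) (s + ε / 2) ⊆ J := fun x hx =>
      hb ⟨by linarith [hx.1], by linarith [hx.2]⟩
    have hivt := intermediate_value_Icc' (f := φ) (show s - ε / 2 ≤ s + ε / 2 by linarith)
      (fun x hx => (hd x (hsub hx)).continuousAt.continuousWithinAt)
    have h1 : φ s < φ (s - ε / 2) :=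
      hφ (hsub ⟨le_rfl, by linarith⟩) hs (by linarith)
    have h2 : φ (s + ε / 2) < φ s :=
      hφ hs (hsub ⟨by linarith, le_rfl⟩) (by linarith)
    exact mem_of_superset (Icc_mem_nhds h2 h1) (hivt.trans (image_mono hsub))
  have hanti : StrictMonoOn (fun y => -ψ y) (φ '' J) := by
    rintro _ ⟨x, hx, rfl⟩ _ ⟨y, hy, rfl⟩ hxy
    simp only [hleft x hx, hleft y hy]
    have := (hφ.lt_iff_gt hx hy).1 hxy
    linarith
  have hcont : ContinuousAt (fun y => -ψ y) (φ s) := by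
    refine hanti.continuousAt_of_image_mem_nhds himg ?_
    have : (fun y => -ψ y) '' (φ '' J) = (fun x => -x) ⁻¹' J := by
      ext x
      constructor
      · rintro ⟨_, ⟨y, hy, rfl⟩, rfl⟩
        simpa [hleft y hy] using hy
      · intro hx
        exact ⟨φ (-x), ⟨-x, hx, rfl⟩, by simp only [hleft (-x) hx, neg_neg]⟩
    rw [this]
    refine (hJ.preimage continuous_neg).mem_nhds ?_
    simpa [hleft s hs] using hs
  have hcont' : ContinuousAt ψ (φ s) :=
    hcont.neg.congr (Eventually.of_forall fun y => neg_neg (ψ y))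
  refine HasDerivAt.of_local_left_inverse hcont' (by rw [hleft s hs]; exact hd s hs)
    (h0 s hs) ?_
  filter_upwards [himg] with y hy
  obtain ⟨x, hx, rfl⟩ := hy
  rw [hleft x hx]

/-- A trajectory in the phase plane with coordinates `x = h |u'| / u` and `w = h² f(u) / u`,
parametrized by `x`: `S x` is the level `u` and `ρ x` the time `r` at which the first coordinate
takes the value `x`. In the time `log (q / h)` the equation becomes
`x' = x² - x + w`, and the right-hand side is positive along the trajectory. -/
structure PhaseCurve (c : EReal) (β : ℝ) (f q S ρ : ℝ → ℝ) (ξ : ℝ) : Prop where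
  S_gt : ∀ x ∈ Ioo 0 ξ, β < S x
  S_mem : ∀ x ∈ Ioo 0 ξ, S x ∈ dom c
  ρ_pos : ∀ x ∈ Ioo 0 ξ, 0 < ρ x
  X_pos : ∀ x ∈ Ioo 0 ξ, 0 < x ^ 2 - x + funh q (ρ x) ^ 2 * f (S x) / S x
  deriv_S : ∀ x ∈ Ioo 0 ξ, HasDerivAt S
    (-(x * S x / (x ^ 2 - x + funh q (ρ x) ^ 2 * f (S x) / S x))) x
  deriv_ρ : ∀ x ∈ Ioo 0 ξ, HasDerivAt ρ
    (funh q (ρ x) / (x ^ 2 - x + funh q (ρ x) ^ 2 * f (S x) / S x)) x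
  start : Tendsto (fun x => x / (funh q (ρ x) ^ 2 * f (S x) / S x) /
    (primQ q (ρ x) / (q (ρ x) * funh q (ρ x)))) (𝓝[>] 0) (𝓝 1)

/-- The second phase coordinate along a phase curve. -/
noncomputable def wco (f q S ρ : ℝ → ℝ) (x : ℝ) : ℝ := funh q (ρ x) ^ 2 * f (S x) / S x

namespace PhaseCurve

variable {c : EReal} {b β Hinf linf : ℝ} {f q S ρ S₁ ρ₁ S₂ ρ₂ : ℝ → ℝ} {ξ : ℝ}

theorem mono (P : PhaseCurve c β f q S ρ ξ) {ξ' : ℝ} (h : ξ' ≤ ξ) :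
    PhaseCurve c β f q S ρ ξ' := by
  have hs : Ioo 0 ξ' ⊆ Ioo 0 ξ := Ioo_subset_Ioo le_rfl h
  exact ⟨fun x hx => P.S_gt x (hs hx), fun x hx => P.S_mem x (hs hx),
    fun x hx => P.ρ_pos x (hs hx), fun x hx => P.X_pos x (hs hx),
    fun x hx => P.deriv_S x (hs hx), fun x hx => P.deriv_ρ x (hs hx), P.start⟩

theorem f_pos (P : PhaseCurve c β f q S ρ ξ) (N : Nonlin c b β f) {x : ℝ} (hx : x ∈ Ioo 0 ξ) :
    0 < f (S x) := N.pos (N.c1.b_lt_β.trans (P.S_gt x hx)) (P.S_mem x hx)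

theorem S_pos (P : PhaseCurve c β f q S ρ ξ) (N : Nonlin c b β f) {x : ℝ} (hx : x ∈ Ioo 0 ξ) :
    0 < S x := N.β_pos.trans (P.S_gt x hx)

theorem w_pos (P : PhaseCurve c β f q S ρ ξ) (W : Weight q Hinf linf) (N : Nonlin c b β f)
    {x : ℝ} (hx : x ∈ Ioo 0 ξ) : 0 < wco f q S ρ x :=
  div_pos (mul_pos (pow_pos (W.funh_pos (P.ρ_pos x hx)) 2) (P.f_pos N hx)) (P.S_pos N hx)

theorem continuousAt_w (P : PhaseCurve c β f q S ρ ξ) (W : Weight q Hinf linf)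
    (N : Nonlin c b β f) {x : ℝ} (hx : x ∈ Ioo 0 ξ) : ContinuousAt (wco f q S ρ) x := by
  have hS := P.S_pos N hx
  have h1 : ContinuousAt (fun x => funh q (ρ x)) x :=
    ((W.hasDerivAt_funh (P.ρ_pos x hx)).1.comp x (P.deriv_ρ x hx)).continuousAt
  have h2 : ContinuousAt (fun x => f (S x)) x :=
    ((N.hasDerivAt hS (P.S_mem x hx)).comp x (P.deriv_S x hx)).continuousAt
  exact ((h1.pow 2).mul h2).div (P.deriv_S x hx).continuousAt hS.ne'

end PhaseCurve

/-- `x² - x + w`, the speed of the first phase coordinate. -/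
noncomputable def Xco (f q S ρ : ℝ → ℝ) (x : ℝ) : ℝ := x ^ 2 - x + wco f q S ρ x

/-- `2 h' + (1 - u f'(u) / f(u)) x`, the logarithmic derivative of the second phase
coordinate. -/
noncomputable def Nco (f q S ρ : ℝ → ℝ) (x : ℝ) : ℝ :=
  2 * deriv (funh q) (ρ x) + (1 - S x * deriv f (S x) / f (S x)) * x

theorem nonpos_of_deriv_le {z z' : ℝ → ℝ} {C s t : ℝ} (hst : s ≤ t)
    (hd : ∀ x ∈ Icc s t, HasDerivAt z (z' x) x) (h' : ∀ x ∈ Ioo s t, z' x ≤ C * z x)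
    (h0 : z s ≤ 0) : z t ≤ 0 := by
  have hexp : ∀ x : ℝ, HasDerivAt (fun x => Real.exp (-C * x)) (Real.exp (-C * x) * (-C)) x :=
    fun x => by simpa using ((hasDerivAt_id x).const_mul (-C)).exp
  have hanti := antitoneOn_Icc_of_hasDerivAt (fun x hx => (hd x hx).mul (hexp x)) ?_
    (left_mem_Icc.2 hst) (right_mem_Icc.2 hst) hst
  · simp only [Pi.mul_apply] at hanti
    have h1 : z s * Real.exp (-C * s) ≤ 0 := mul_nonpos_of_nonpos_of_nonneg h0 (Real.exp_pos _).le
    by_contra! hcon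
    have := mul_pos hcon (Real.exp_pos (-C * t))
    linarith
  · intro x hx
    have := mul_nonneg (sub_nonneg.2 (h' x hx)) (Real.exp_pos (-C * x)).le
    linarith

namespace PhaseCurve

variable {c : EReal} {b β Hinf linf : ℝ} {f q S ρ S₁ ρ₁ S₂ ρ₂ : ℝ → ℝ} {ξ : ℝ}

theorem X_pos' (P : PhaseCurve c β f q S ρ ξ) {x : ℝ} (hx : x ∈ Ioo 0 ξ) : 0 < Xco f q S ρ x :=
  P.X_pos x hx

theorem hasDerivAt_w (P : PhaseCurve c β f q S ρ ξ) (W : Weight q Hinf linf)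
    (N : Nonlin c b β f) {x : ℝ} (hx : x ∈ Ioo 0 ξ) :
    HasDerivAt (wco f q S ρ) (wco f q S ρ x * (Nco f q S ρ x / Xco f q S ρ x)) x := by
  have hh := W.funh_pos (P.ρ_pos x hx)
  have hf := P.f_pos N hx
  have hS := P.S_pos N hx
  have hX := P.X_pos x hx
  have h1 : HasDerivAt (fun x => funh q (ρ x)) _ x :=
    (W.hasDerivAt_funh (P.ρ_pos x hx)).1.comp x (P.deriv_ρ x hx)
  have h2 : HasDerivAt (fun x => f (S x)) _ x :=
    (N.hasDerivAt hS (P.S_mem x hx)).comp x (P.deriv_S x hx)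
  have h3 : HasDerivAt (wco f q S ρ) _ x :=
    (((h1.pow 2).mul h2).div (P.deriv_S x hx) hS.ne')
  refine h3.congr_deriv ?_
  simp only [wco, Nco, Xco]
  have hX' := hX.ne'
  generalize hXX : x ^ 2 - x + funh q (ρ x) ^ 2 * f (S x) / S x = X at *
  simp
  field_simp
  ring

theorem hasDerivAt_log_tailInt (P : PhaseCurve c β f q S ρ ξ) (W : Weight q Hinf linf)
    {x : ℝ} (hx : x ∈ Ioo 0 ξ) :
    HasDerivAt (fun x => Real.log (tailInt q (ρ x))) (-(1 / Xco f q S ρ x)) x := by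
  have hρ := P.ρ_pos x hx
  have h := ((W.hasDerivAt_tailInt hρ).comp x (P.deriv_ρ x hx)).log (W.tailInt_pos hρ).ne'
  refine h.congr_deriv ?_
  have hX : (0:ℝ) < Xco f q S ρ x := P.X_pos x hx
  change -(1 / q (ρ x)) * (funh q (ρ x) / Xco f q S ρ x) / tailInt q (ρ x) = _
  have := (W.pos hρ).ne'
  have := (W.tailInt_pos hρ).ne'
  rw [Weight.funh_eq]
  field_simp

theorem hasDerivAt_log_S (P : PhaseCurve c β f q S ρ ξ) (N : Nonlin c b β f)
    {x : ℝ} (hx : x ∈ Ioo 0 ξ) :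
    HasDerivAt (fun x => Real.log (S x)) (-(x / Xco f q S ρ x)) x := by
  have hS := P.S_pos N hx
  refine ((P.deriv_S x hx).log hS.ne').congr_deriv ?_
  change -(x * S x / Xco f q S ρ x) / S x = _
  field_simp

theorem continuousAt_Nco (P : PhaseCurve c β f q S ρ ξ) (W : Weight q Hinf linf)
    (N : Nonlin c b β f) {x : ℝ} (hx : x ∈ Ioo 0 ξ) : ContinuousAt (Nco f q S ρ) x := by
  have hρ := P.ρ_pos x hx
  have hS := P.S_pos N hx
  have hcρ := (P.deriv_ρ x hx).continuousAt
  have hcS := (P.deriv_S x hx).continuousAt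
  have h1 : ContinuousAt (fun r => deriv q r * tailInt q r - 1) (ρ x) :=
    (((W.continuousOn_deriv).continuousAt (Ioi_mem_nhds hρ)).mul
      (W.hasDerivAt_tailInt hρ).continuousAt).sub continuousAt_const
  have h2 : ContinuousAt (deriv (funh q)) (ρ x) := by
    refine h1.congr ?_
    filter_upwards [Ioi_mem_nhds hρ] with r hr using ((W.hasDerivAt_funh hr).2).symm
  have h3 : ContinuousAt (deriv f) (S x) :=
    N.continuousOn_deriv.continuousAt (Nonlin.isOpen_pos.mem_nhds (N.mem_pos hS (P.S_mem x hx)))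
  have h4 := N.continuousAt (P.S_mem x hx)
  have h5 : ContinuousAt (fun x => deriv (funh q) (ρ x)) x := h2.comp hcρ
  have h6 : ContinuousAt (fun x => deriv f (S x)) x := h3.comp hcS
  have h7 : ContinuousAt (fun x => f (S x)) x := h4.comp hcS
  exact (continuousAt_const.mul h5).add ((continuousAt_const.sub ((hcS.mul h6).div h7
    (P.f_pos N hx).ne')).mul continuousAt_id)

/-- The elasticity bound makes the logarithmic derivative of `w` nonnegative for `x ≤ 1`. -/
theorem Nco_nonneg (P : PhaseCurve c β f q S ρ ξ) (W : Weight q Hinf linf)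
    (N : Nonlin c b β f) (h4 : CondF4 c b f) (h6 : CondF6 β linf f)
    {x : ℝ} (hx : x ∈ Ioo 0 ξ) (hx1 : x ≤ 1) : 0 ≤ Nco f q S ρ x := by
  have h1 := N.elasticity_le h4 h6 (P.S_gt x hx).le (P.S_mem x hx)
  have h2 := W.le_deriv_funh (P.ρ_pos x hx)
  have h3 := W.c4.linf_pos
  simp only [Nco]
  have := hx.1
  nlinarith

theorem Nco_le (P₁ : PhaseCurve c β f q S₁ ρ₁ ξ) (P₂ : PhaseCurve c β f q S₂ ρ₂ ξ)
    (W : Weight q Hinf linf) (N : Nonlin c b β f) (h4 : CondF4 c b f)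
    {x : ℝ} (hx : x ∈ Ioo 0 ξ) (hρ : ρ₂ x ≤ ρ₁ x) (hS : S₁ x ≤ S₂ x) :
    Nco f q S₁ ρ₁ x ≤ Nco f q S₂ ρ₂ x := by
  have h1 := W.c4.anti (P₂.ρ_pos x hx) (P₁.ρ_pos x hx) hρ
  have hb := N.c1.b_lt_β
  have h2 := h4 ⟨hb.trans (P₁.S_gt x hx), lt_of_mem_dom (P₁.S_mem x hx)⟩
    ⟨hb.trans (P₂.S_gt x hx), lt_of_mem_dom (P₂.S_mem x hx)⟩ hS
  simp only at h2
  simp only [Nco]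
  have := hx.1
  nlinarith

/-- A linear differential inequality for `w₁ - w₂` while the first curve is late and low. -/
theorem deriv_w_sub_le (P₁ : PhaseCurve c β f q S₁ ρ₁ ξ) (P₂ : PhaseCurve c β f q S₂ ρ₂ ξ)
    (W : Weight q Hinf linf) (N : Nonlin c b β f) (h4 : CondF4 c b f)
    {x : ℝ} (hx : x ∈ Ioo 0 ξ) (hρ : ρ₂ x ≤ ρ₁ x) (hS : S₁ x ≤ S₂ x) :
    wco f q S₁ ρ₁ x * (Nco f q S₁ ρ₁ x / Xco f q S₁ ρ₁ x) -
      wco f q S₂ ρ₂ x * (Nco f q S₂ ρ₂ x / Xco f q S₂ ρ₂ x) ≤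
    Nco f q S₁ ρ₁ x * (x ^ 2 - x) / (Xco f q S₁ ρ₁ x * Xco f q S₂ ρ₂ x) *
      (wco f q S₁ ρ₁ x - wco f q S₂ ρ₂ x) := by
  have h1 := P₁.Nco_le P₂ W N h4 hx hρ hS
  have hX1 := P₁.X_pos' hx
  have hX2 := P₂.X_pos' hx
  have hw2 := P₂.w_pos W N hx
  have h2 : wco f q S₂ ρ₂ x * (Nco f q S₁ ρ₁ x / Xco f q S₂ ρ₂ x) ≤
      wco f q S₂ ρ₂ x * (Nco f q S₂ ρ₂ x / Xco f q S₂ ρ₂ x) := by gcongr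
  have e : Nco f q S₁ ρ₁ x * (x ^ 2 - x) / (Xco f q S₁ ρ₁ x * Xco f q S₂ ρ₂ x) *
      (wco f q S₁ ρ₁ x - wco f q S₂ ρ₂ x) =
      wco f q S₁ ρ₁ x * (Nco f q S₁ ρ₁ x / Xco f q S₁ ρ₁ x) -
      wco f q S₂ ρ₂ x * (Nco f q S₁ ρ₁ x / Xco f q S₂ ρ₂ x) := by
    have e1 : wco f q S₁ ρ₁ x = Xco f q S₁ ρ₁ x - (x ^ 2 - x) := by simp only [Xco]; ring
    have e2 : wco f q S₂ ρ₂ x = Xco f q S₂ ρ₂ x - (x ^ 2 - x) := by simp only [Xco]; ring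
    rw [e1, e2]
    field_simp
    ring
  rw [e]
  linarith

/-- The coefficient in `deriv_w_sub_le` is bounded above away from the ends of `(0, ξ)`. -/
theorem exists_bound (P₁ : PhaseCurve c β f q S₁ ρ₁ ξ) (P₂ : PhaseCurve c β f q S₂ ρ₂ ξ)
    (W : Weight q Hinf linf) (N : Nonlin c b β f) {x₀ x₁ : ℝ} (h0 : 0 < x₀) (h1 : x₁ < ξ) :
    ∃ C, ∀ x ∈ Icc x₀ x₁,
      Nco f q S₁ ρ₁ x * (x ^ 2 - x) / (Xco f q S₁ ρ₁ x * Xco f q S₂ ρ₂ x) ≤ C := by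
  have hsub : Icc x₀ x₁ ⊆ Ioo 0 ξ := Icc_subset_Ioo h0 h1
  have hc : ContinuousOn (fun x => Nco f q S₁ ρ₁ x * (x ^ 2 - x) /
      (Xco f q S₁ ρ₁ x * Xco f q S₂ ρ₂ x)) (Icc x₀ x₁) := by
    intro x hx
    have hx' := hsub hx
    have hp : ContinuousAt (fun x : ℝ => x ^ 2 - x) x := by fun_prop
    exact (((P₁.continuousAt_Nco W N hx').mul hp).div
      ((hp.add (P₁.continuousAt_w W N hx')).mul (hp.add (P₂.continuousAt_w W N hx')))
      (mul_pos (P₁.X_pos' hx') (P₂.X_pos' hx')).ne').continuousWithinAt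
  obtain ⟨C, hC⟩ := isCompact_Icc.bddAbove_image hc
  exact ⟨C, fun x hx => hC (mem_image_of_mem _ hx)⟩

theorem hasDerivAt_time_sub (P₁ : PhaseCurve c β f q S₁ ρ₁ ξ)
    (P₂ : PhaseCurve c β f q S₂ ρ₂ ξ) (W : Weight q Hinf linf) {x : ℝ} (hx : x ∈ Ioo 0 ξ) :
    HasDerivAt (fun x => Real.log (tailInt q (ρ₂ x)) - Real.log (tailInt q (ρ₁ x)))
      (-((wco f q S₁ ρ₁ x - wco f q S₂ ρ₂ x) / (Xco f q S₁ ρ₁ x * Xco f q S₂ ρ₂ x))) x := by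
  refine ((P₂.hasDerivAt_log_tailInt W hx).sub (P₁.hasDerivAt_log_tailInt W hx)).congr_deriv ?_
  have hX1 := P₁.X_pos' hx
  have hX2 := P₂.X_pos' hx
  have e : wco f q S₁ ρ₁ x - wco f q S₂ ρ₂ x = Xco f q S₁ ρ₁ x - Xco f q S₂ ρ₂ x := by
    simp only [Xco]; ring
  rw [e]
  field_simp
  ring

theorem hasDerivAt_level_sub (P₁ : PhaseCurve c β f q S₁ ρ₁ ξ)
    (P₂ : PhaseCurve c β f q S₂ ρ₂ ξ) (N : Nonlin c b β f) {x : ℝ} (hx : x ∈ Ioo 0 ξ) :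
    HasDerivAt (fun x => Real.log (S₂ x) - Real.log (S₁ x))
      (-(x * (wco f q S₁ ρ₁ x - wco f q S₂ ρ₂ x) / (Xco f q S₁ ρ₁ x * Xco f q S₂ ρ₂ x))) x := by
  refine ((P₂.hasDerivAt_log_S N hx).sub (P₁.hasDerivAt_log_S N hx)).congr_deriv ?_
  have hX1 := P₁.X_pos' hx
  have hX2 := P₂.X_pos' hx
  have e : wco f q S₁ ρ₁ x - wco f q S₂ ρ₂ x = Xco f q S₁ ρ₁ x - Xco f q S₂ ρ₂ x := by
    simp only [Xco]; ring
  rw [e]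
  field_simp
  ring

/-- Logarithmic form of the ordering `ρ₂ < ρ₁`, `S₁ < S₂`. -/
theorem order_iff (P₁ : PhaseCurve c β f q S₁ ρ₁ ξ) (P₂ : PhaseCurve c β f q S₂ ρ₂ ξ)
    (W : Weight q Hinf linf) (N : Nonlin c b β f) {x : ℝ} (hx : x ∈ Ioo 0 ξ) :
    (ρ₂ x < ρ₁ x ↔ 0 < Real.log (tailInt q (ρ₂ x)) - Real.log (tailInt q (ρ₁ x))) ∧
    (S₁ x < S₂ x ↔ 0 < Real.log (S₂ x) - Real.log (S₁ x)) := by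
  have h1 := P₁.ρ_pos x hx
  have h2 := P₂.ρ_pos x hx
  constructor
  · rw [sub_pos, Real.log_lt_log_iff (W.tailInt_pos h1) (W.tailInt_pos h2)]
    exact (W.tailInt_strictAntiOn.lt_iff_gt h1 h2).symm
  · rw [sub_pos, Real.log_lt_log_iff (P₁.S_pos N hx) (P₂.S_pos N hx)]

/-- Where `w₁ > w₂`, the ordering `ρ₂ < ρ₁`, `S₁ < S₂` propagates to smaller `x`. -/
theorem order_backward (P₁ : PhaseCurve c β f q S₁ ρ₁ ξ) (P₂ : PhaseCurve c β f q S₂ ρ₂ ξ)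
    (W : Weight q Hinf linf) (N : Nonlin c b β f) {x₀ x₁ : ℝ} (h0 : 0 < x₀) (h1 : x₁ < ξ)
    (hρ : ρ₂ x₁ < ρ₁ x₁) (hS : S₁ x₁ < S₂ x₁)
    (hz : ∀ x ∈ Ioc x₀ x₁, wco f q S₂ ρ₂ x < wco f q S₁ ρ₁ x) :
    ∀ x ∈ Icc x₀ x₁, ρ₂ x < ρ₁ x ∧ S₁ x < S₂ x := by
  intro x hx
  have hsub : Icc x x₁ ⊆ Ioo 0 ξ := Icc_subset_Ioo (h0.trans_le hx.1) h1
  have hx' := hsub (left_mem_Icc.2 hx.2)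
  have hx1 := hsub (right_mem_Icc.2 hx.2)
  have ho := P₁.order_iff P₂ W N hx'
  have ho1 := P₁.order_iff P₂ W N hx1
  have pos : ∀ y ∈ Ioo x x₁, 0 < wco f q S₁ ρ₁ y - wco f q S₂ ρ₂ y ∧
      0 < Xco f q S₁ ρ₁ y * Xco f q S₂ ρ₂ y ∧ 0 < y := by
    intro y hy
    have hy' := hsub (Ioo_subset_Icc_self hy)
    exact ⟨sub_pos.2 (hz y ⟨hx.1.trans_lt hy.1, hy.2.le⟩),
      mul_pos (P₁.X_pos' hy') (P₂.X_pos' hy'), hy'.1⟩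
  have a1 := antitoneOn_Icc_of_hasDerivAt
    (fun y hy => P₁.hasDerivAt_time_sub P₂ W (hsub hy)) (fun y hy => by
      obtain ⟨h2, h3, h4⟩ := pos y hy
      exact neg_nonpos.2 (div_nonneg h2.le h3.le))
    (left_mem_Icc.2 hx.2) (right_mem_Icc.2 hx.2) hx.2
  have a2 := antitoneOn_Icc_of_hasDerivAt
    (fun y hy => P₁.hasDerivAt_level_sub P₂ N (hsub hy)) (fun y hy => by
      obtain ⟨h2, h3, h4⟩ := pos y hy
      exact neg_nonpos.2 (div_nonneg (mul_nonneg h4.le h2.le) h3.le))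
    (left_mem_Icc.2 hx.2) (right_mem_Icc.2 hx.2) hx.2
  exact ⟨ho.1.2 ((ho1.1.1 hρ).trans_le a1), ho.2.2 ((ho1.2.1 hS).trans_le a2)⟩

/-- The late curve has the smaller `w`: otherwise `log (w₁ / w₂)` would stay positive down to
`x = 0`, contradicting `x / w ∼ Q / (q h)` there. -/
theorem w_le_of_order (P₁ : PhaseCurve c β f q S₁ ρ₁ ξ) (P₂ : PhaseCurve c β f q S₂ ρ₂ ξ)
    (W : Weight q Hinf linf) (N : Nonlin c b β f) (h4 : CondF4 c b f) (h6 : CondF6 β linf f)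
    {x₁ : ℝ} (hx₁ : x₁ ∈ Ioo 0 ξ) (hρ : ρ₂ x₁ < ρ₁ x₁) (hS : S₁ x₁ < S₂ x₁) :
    wco f q S₁ ρ₁ x₁ ≤ wco f q S₂ ρ₂ x₁ := by
  by_contra! hcon
  have hall : ∀ x ∈ Ioc 0 x₁, wco f q S₂ ρ₂ x < wco f q S₁ ρ₁ x := by
    intro x hx
    have hsub : Icc x x₁ ⊆ Ioo 0 ξ := Icc_subset_Ioo hx.1 hx₁.2
    have := backward_barrier (D := fun x => wco f q S₁ ρ₁ x - wco f q S₂ ρ₂ x) (s₀ := x)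
      (s₁ := x₁) (fun y hy => ((P₁.continuousAt_w W N (hsub hy)).sub
        (P₂.continuousAt_w W N (hsub hy))).continuousWithinAt) (sub_pos.2 hcon) ?_
      x (left_mem_Icc.2 hx.2)
    · exact sub_pos.1 this
    · intro y hy hy0 hpos
      have hy' : 0 < y := hx.1.trans_le hy.1
      have hsub' : Icc y x₁ ⊆ Ioo 0 ξ := Icc_subset_Ioo hy' hx₁.2
      have hord := P₁.order_backward P₂ W N hy' hx₁.2 hρ hS
        (fun t ht => sub_pos.1 (hpos t ht))
      obtain ⟨C, hC⟩ := P₁.exists_bound P₂ W N hy' hx₁.2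
      have := nonpos_of_deriv_le hy.2.le (C := C)
        (fun t ht => (P₁.hasDerivAt_w W N (hsub' ht)).sub (P₂.hasDerivAt_w W N (hsub' ht)))
        (fun t ht => by
          have ht' := Ioo_subset_Icc_self ht
          have h5 := hord t ht'
          refine (P₁.deriv_w_sub_le P₂ W N h4 (hsub' ht') h5.1.le h5.2.le).trans ?_
          exact mul_le_mul_of_nonneg_right (hC t ht') (hpos t ⟨ht.1, ht.2.le⟩).le) hy0.le
      simp only [Pi.sub_apply] at this
      linarith
  set m := min x₁ 1 with hm
  have hm0 : 0 < m := lt_min hx₁.1 one_pos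
  have hmx : m ≤ x₁ := min_le_left _ _
  have hmξ : m < ξ := hmx.trans_lt hx₁.2
  have hmm : m ∈ Ioo 0 ξ := ⟨hm0, hmξ⟩
  have hord : ∀ x ∈ Ioc 0 x₁, ρ₂ x < ρ₁ x ∧ S₁ x < S₂ x := fun x hx =>
    P₁.order_backward P₂ W N hx.1 hx₁.2 hρ hS
      (fun t ht => hall t ⟨hx.1.trans ht.1, ht.2⟩) x ⟨le_rfl, hx.2⟩
  have hanti : ∀ x ∈ Ioc 0 m,
      Real.log (wco f q S₁ ρ₁ m) - Real.log (wco f q S₂ ρ₂ m) ≤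
      Real.log (wco f q S₁ ρ₁ x) - Real.log (wco f q S₂ ρ₂ x) := by
    intro x hx
    have hsub : Icc x m ⊆ Ioo 0 ξ := Icc_subset_Ioo hx.1 hmξ
    refine antitoneOn_Icc_of_hasDerivAt
      (fun y hy => ((P₁.hasDerivAt_w W N (hsub hy)).log (P₁.w_pos W N (hsub hy)).ne').sub
        ((P₂.hasDerivAt_w W N (hsub hy)).log (P₂.w_pos W N (hsub hy)).ne')) ?_
      (left_mem_Icc.2 hx.2) (right_mem_Icc.2 hx.2) hx.2
    intro y hy
    have hy' := hsub (Ioo_subset_Icc_self hy)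
    have hyx : y ∈ Ioc 0 x₁ := ⟨hy'.1, hy.2.le.trans hmx⟩
    have hw1 := P₁.w_pos W N hy'
    have hw2 := P₂.w_pos W N hy'
    have hX1 := P₁.X_pos' hy'
    have hX2 := P₂.X_pos' hy'
    rw [mul_div_cancel_left₀ _ hw1.ne', mul_div_cancel_left₀ _ hw2.ne', sub_nonpos]
    have hN := P₁.Nco_le P₂ W N h4 hy' (hord y hyx).1.le (hord y hyx).2.le
    have hN1 := P₁.Nco_nonneg W N h4 h6 hy' (hy.2.le.trans (min_le_right _ _))
    have hXX : Xco f q S₂ ρ₂ y ≤ Xco f q S₁ ρ₁ y := by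
      have := hall y hyx
      simp only [Xco]; linarith
    exact div_le_div₀ (hN1.trans hN) hN hX2 hXX
  set k := wco f q S₂ ρ₂ m / wco f q S₁ ρ₁ m with hk
  have hk1 : k < 1 := (div_lt_one (P₁.w_pos W N hmm)).2 (hall m ⟨hm0, hmx⟩)
  have hratio : ∀ x ∈ Ioc 0 m, wco f q S₂ ρ₂ x ≤ k * wco f q S₁ ρ₁ x := by
    intro x hx
    have hx' : x ∈ Ioo 0 ξ := ⟨hx.1, hx.2.trans_lt hmξ⟩
    have h5 := hanti x hx
    have w1 := P₁.w_pos W N hx'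
    have w2 := P₂.w_pos W N hx'
    have v1 := P₁.w_pos W N hmm
    have v2 := P₂.w_pos W N hmm
    rw [← Real.log_div v1.ne' v2.ne', ← Real.log_div w1.ne' w2.ne',
      Real.log_le_log_iff (div_pos v1 v2) (div_pos w1 w2), div_le_div_iff₀ v2 w2] at h5
    rw [hk, div_mul_eq_mul_div, le_div_iff₀ v1]
    linarith
  have hlim := P₁.start.div P₂.start one_ne_zero
  rw [div_one] at hlim
  have : (1:ℝ) ≤ k := by
    refine le_of_tendsto hlim ?_
    filter_upwards [Ioo_mem_nhdsGT hm0] with x hx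
    have hx' : x ∈ Ioo 0 ξ := ⟨hx.1, hx.2.trans hmξ⟩
    have hx0 := hx.1
    have w1 := P₁.w_pos W N hx'
    have w2 := P₂.w_pos W N hx'
    have hr1 := P₁.ρ_pos x hx'
    have hr2 := P₂.ρ_pos x hx'
    have R1 := div_pos (W.primQ_pos hr1) (mul_pos (W.pos hr1) (W.funh_pos hr1))
    have R2 := div_pos (W.primQ_pos hr2) (mul_pos (W.pos hr2) (W.funh_pos hr2))
    have hR := W.monotoneOn_primQ_div hr2 hr1 (hord x ⟨hx.1, hx.2.le.trans hmx⟩).1.le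
    simp only at hR
    have h5 := hratio x ⟨hx.1, hx.2.le⟩
    change x / wco f q S₁ ρ₁ x / _ / (x / wco f q S₂ ρ₂ x / _) ≤ k
    generalize wco f q S₁ ρ₁ x = a1 at *
    generalize wco f q S₂ ρ₂ x = a2 at *
    generalize primQ q (ρ₁ x) / (q (ρ₁ x) * funh q (ρ₁ x)) = k1 at *
    generalize primQ q (ρ₂ x) / (q (ρ₂ x) * funh q (ρ₂ x)) = k2 at *
    have e : x / a1 / k1 / (x / a2 / k2) = (a2 * k2) / (a1 * k1) := by field_simp
    rw [e, div_le_iff₀ (by positivity)]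
    calc a2 * k2 ≤ a2 * k1 := by gcongr
      _ ≤ (k * a1) * k1 := by gcongr
      _ = k * (a1 * k1) := by ring
  linarith

/-- `log h - ℓ log (q / h)` is nondecreasing. -/
theorem _root_.WeightedBoundState.Weight.log_funh_monotoneOn (W : Weight q Hinf linf) :
    MonotoneOn (fun r => Real.log (funh q r) + linf * Real.log (tailInt q r)) (Ioi 0) := by
  have hd : ∀ r : ℝ, 0 < r → HasDerivAt
      (fun r => Real.log (funh q r) + linf * Real.log (tailInt q r))
      (deriv (funh q) r / funh q r + linf * (-(1 / q r) / tailInt q r)) r := fun r hr =>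
    ((W.hasDerivAt_funh hr).1.log (W.funh_pos hr).ne').add
      (((W.hasDerivAt_tailInt hr).log (W.tailInt_pos hr).ne').const_mul linf)
  refine monotoneOn_of_deriv_nonneg (convex_Ioi 0)
    (fun r hr => (hd r hr).continuousAt.continuousWithinAt)
    (fun r hr => (hd r (interior_subset hr)).differentiableAt.differentiableWithinAt) ?_
  intro r hr
  have hr' : 0 < r := interior_subset hr
  rw [(hd r hr').deriv]
  have h1 := W.le_deriv_funh hr'
  have hq := W.pos hr'
  have hI := W.tailInt_pos hr'
  have e : deriv (funh q) r / funh q r + linf * (-(1 / q r) / tailInt q r) =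
      (deriv (funh q) r - linf) / (q r * tailInt q r) := by
    rw [Weight.funh_eq]; field_simp; ring
  rw [e]
  exact div_nonneg (by linarith) (by positivity)

/-- The elasticity bound, integrated: `f(s) / s^(1 + 2ℓ)` is nonincreasing on `[β, c)`. -/
theorem _root_.WeightedBoundState.Nonlin.log_antitone (N : Nonlin c b β f) (h4 : CondF4 c b f)
    (h6 : CondF6 β linf f) {s t : ℝ} (hs : β ≤ s) (hst : s ≤ t) (ht : t ∈ dom c) :
    Real.log (f t) - (1 + 2 * linf) * Real.log t ≤
      Real.log (f s) - (1 + 2 * linf) * Real.log s := by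
  have hβ := N.β_pos
  have hmem : ∀ x ∈ Icc s t, x ∈ dom c := fun x hx => by
    refine mem_dom_of_abs_le ht ?_
    rw [abs_of_pos (by linarith [hx.1]), abs_of_pos (by linarith)]
    exact hx.2
  have hf : ∀ x ∈ Icc s t, 0 < f x := fun x hx =>
    N.pos (N.c1.b_lt_β.trans_le (hs.trans hx.1)) (hmem x hx)
  have h0 : ∀ x ∈ Icc s t, 0 < x := fun x hx => by linarith [hx.1]
  refine antitoneOn_Icc_of_hasDerivAt (fun x hx => ((N.hasDerivAt (h0 x hx) (hmem x hx)).log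
    (hf x hx).ne').sub (((hasDerivAt_id x).log (h0 x hx).ne').const_mul (1 + 2 * linf))) ?_
    (left_mem_Icc.2 hst) (right_mem_Icc.2 hst) hst
  intro x hx
  have hx' := Ioo_subset_Icc_self hx
  have h1 := N.elasticity_le h4 h6 (hs.trans hx.1.le) (hmem x hx')
  have hfx := hf x hx'
  have hx0 := h0 x hx'
  simp only [id]
  rw [div_le_iff₀ hfx] at h1
  rw [sub_nonpos, ← mul_div_assoc, mul_one, div_le_div_iff₀ hfx hx0]
  linarith

/-- At equal `x`, the curve which is late and low stays late and low, and its flux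
`x (q / h) u` is the smaller one. -/
theorem compare (P₁ : PhaseCurve c β f q S₁ ρ₁ ξ) (P₂ : PhaseCurve c β f q S₂ ρ₂ ξ)
    (W : Weight q Hinf linf) (N : Nonlin c b β f) (h4 : CondF4 c b f) (h6 : CondF6 β linf f)
    {x₁ : ℝ} (hx₁ : x₁ ∈ Ioo 0 ξ) (hρ : ρ₂ x₁ < ρ₁ x₁) (hS : S₁ x₁ < S₂ x₁) :
    ∀ x ∈ Ico x₁ ξ, S₁ x < S₂ x ∧ S₁ x / tailInt q (ρ₁ x) ≤ S₂ x / tailInt q (ρ₂ x) := by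
  have hz1 := P₁.w_le_of_order P₂ W N h4 h6 hx₁ hρ hS
  -- `w₁ ≤ w₂` as long as the ordering holds
  have grow : ∀ y ∈ Ico x₁ ξ, (∀ t ∈ Ico x₁ y, ρ₂ t < ρ₁ t ∧ S₁ t < S₂ t) →
      ∀ t ∈ Icc x₁ y, wco f q S₁ ρ₁ t ≤ wco f q S₂ ρ₂ t := by
    intro y hy hord t ht
    by_contra! hcon
    have hsub : Icc x₁ t ⊆ Ioo 0 ξ := Icc_subset_Ioo hx₁.1 (ht.2.trans_lt hy.2)
    have := backward_barrier (D := fun x => wco f q S₁ ρ₁ x - wco f q S₂ ρ₂ x) (s₀ := x₁)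
      (s₁ := t) (fun y hy => ((P₁.continuousAt_w W N (hsub hy)).sub
        (P₂.continuousAt_w W N (hsub hy))).continuousWithinAt) (sub_pos.2 hcon) ?_
      x₁ (left_mem_Icc.2 ht.1)
    · linarith
    · intro u hu hu0 hpos
      have hsub' : Icc u t ⊆ Ioo 0 ξ := fun v hv => hsub ⟨hu.1.trans hv.1, hv.2⟩
      obtain ⟨C, hC⟩ := P₁.exists_bound P₂ W N (hx₁.1.trans_le hu.1) (ht.2.trans_lt hy.2)
      have := nonpos_of_deriv_le hu.2.le (C := C)
        (fun t ht => (P₁.hasDerivAt_w W N (hsub' ht)).sub (P₂.hasDerivAt_w W N (hsub' ht)))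
        (fun v hv => by
          have hv' := Ioo_subset_Icc_self hv
          have h5 := hord v ⟨hu.1.trans hv.1.le, hv.2.trans_le ht.2⟩
          refine (P₁.deriv_w_sub_le P₂ W N h4 (hsub' hv') h5.1.le h5.2.le).trans ?_
          exact mul_le_mul_of_nonneg_right (hC v hv') (hpos v ⟨hv.1, hv.2.le⟩).le) hu0.le
      simp only [Pi.sub_apply] at this
      linarith
  have keep : ∀ y ∈ Ico x₁ ξ, (∀ t ∈ Ico x₁ y, ρ₂ t < ρ₁ t ∧ S₁ t < S₂ t) →
      ρ₂ y < ρ₁ y ∧ S₁ y < S₂ y := by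
    intro y hy hord
    have hw := grow y hy hord
    have hsub : Icc x₁ y ⊆ Ioo 0 ξ := Icc_subset_Ioo hx₁.1 hy.2
    have ho := P₁.order_iff P₂ W N (hsub (right_mem_Icc.2 hy.1))
    have ho1 := P₁.order_iff P₂ W N hx₁
    have a1 := monotoneOn_Icc_of_hasDerivAt
      (fun t ht => P₁.hasDerivAt_time_sub P₂ W (hsub ht)) (fun t ht => by
        have ht' := Ioo_subset_Icc_self ht
        exact neg_nonneg.2 (div_nonpos_of_nonpos_of_nonneg (sub_nonpos.2 (hw t ht'))
          (mul_pos (P₁.X_pos' (hsub ht')) (P₂.X_pos' (hsub ht'))).le))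
      (left_mem_Icc.2 hy.1) (right_mem_Icc.2 hy.1) hy.1
    have a2 := monotoneOn_Icc_of_hasDerivAt
      (fun t ht => P₁.hasDerivAt_level_sub P₂ N (hsub ht)) (fun t ht => by
        have ht' := Ioo_subset_Icc_self ht
        exact neg_nonneg.2 (div_nonpos_of_nonpos_of_nonneg
          (mul_nonpos_of_nonneg_of_nonpos (hsub ht').1.le (sub_nonpos.2 (hw t ht')))
          (mul_pos (P₁.X_pos' (hsub ht')) (P₂.X_pos' (hsub ht'))).le))
      (left_mem_Icc.2 hy.1) (right_mem_Icc.2 hy.1) hy.1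
    exact ⟨ho.1.2 ((ho1.1.1 hρ).trans_le a1), ho.2.2 ((ho1.2.1 hS).trans_le a2)⟩
  have hord : ∀ x ∈ Ico x₁ ξ, ρ₂ x < ρ₁ x ∧ S₁ x < S₂ x := by
    intro x hx
    have hc : ∀ t ∈ Icc x₁ x, ContinuousAt (fun t => min (ρ₁ t - ρ₂ t) (S₂ t - S₁ t)) t := by
      intro t ht
      have ht' : t ∈ Ioo 0 ξ := ⟨hx₁.1.trans_le ht.1, ht.2.trans_lt hx.2⟩
      exact ((P₁.deriv_ρ t ht').continuousAt.sub (P₂.deriv_ρ t ht').continuousAt).min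
        ((P₂.deriv_S t ht').continuousAt.sub (P₁.deriv_S t ht').continuousAt)
    have := backward_barrier (D := fun t => min (ρ₁ (-t) - ρ₂ (-t)) (S₂ (-t) - S₁ (-t)))
      (s₀ := -x) (s₁ := -x₁) ?_ ?_ ?_ (-x) ⟨le_rfl, neg_le_neg hx.1⟩
    · simp only [neg_neg, lt_min_iff, sub_pos] at this
      exact this
    · intro t ht
      have h5 : -t ∈ Icc x₁ x := ⟨by linarith [ht.2], by linarith [ht.1]⟩
      exact (ContinuousAt.comp (f := fun t : ℝ => -t) (hc (-t) h5)
        continuous_neg.continuousAt).continuousWithinAt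
    · simp only [neg_neg, lt_min_iff, sub_pos]
      exact ⟨hρ, hS⟩
    · intro t ht h0 hpos
      have := keep (-t) ⟨by linarith [ht.2], by linarith [ht.1, hx.2]⟩ (fun u hu => by
        have := hpos (-u) ⟨by linarith [hu.2], by linarith [hu.1]⟩
        simp only [neg_neg, lt_min_iff, sub_pos] at this
        exact this)
      have h6 : 0 < min (ρ₁ (-t) - ρ₂ (-t)) (S₂ (-t) - S₁ (-t)) :=
        lt_min (sub_pos.2 this.1) (sub_pos.2 this.2)
      exact h6.ne' h0
  intro x hx
  have hx' : x ∈ Ioo 0 ξ := ⟨hx₁.1.trans_le hx.1, hx.2⟩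
  refine ⟨(hord x hx).2, ?_⟩
  have hw := grow x hx (fun t ht => hord t ⟨ht.1, ht.2.trans hx.2⟩) x (right_mem_Icc.2 hx.1)
  obtain ⟨o1, o2⟩ := hord x hx
  have r1 := P₁.ρ_pos x hx'
  have r2 := P₂.ρ_pos x hx'
  have s1 := P₁.S_pos N hx'
  have s2 := P₂.S_pos N hx'
  have m1 := W.log_funh_monotoneOn r2 r1 o1.le
  have m2 := N.log_antitone h4 h6 (P₁.S_gt x hx').le o2.le (P₂.S_mem x hx')
  have i1 := W.tailInt_pos r1
  have i2 := W.tailInt_pos r2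
  have f1 := P₁.f_pos N hx'
  have f2 := P₂.f_pos N hx'
  have t1 := W.funh_pos r1
  have t2 := W.funh_pos r2
  have hlw := Real.log_le_log (P₁.w_pos W N hx') hw
  simp only [wco] at hlw
  rw [Real.log_div (by positivity) (by positivity), Real.log_div (by positivity) (by positivity),
    Real.log_mul (by positivity) (by positivity), Real.log_mul (by positivity) (by positivity),
    Real.log_pow, Real.log_pow] at hlw
  rw [← Real.log_le_log_iff (by positivity) (by positivity),
    Real.log_div (by positivity) (by positivity), Real.log_div (by positivity) (by positivity)]
  have hl := W.c4.linf_pos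
  simp only at m1
  push_cast at hlw
  have key : 2 * linf * (Real.log (S₁ x) - Real.log (tailInt q (ρ₁ x))) ≤
      2 * linf * (Real.log (S₂ x) - Real.log (tailInt q (ρ₂ x))) := by linarith
  exact le_of_mul_le_mul_left key (by linarith)

end PhaseCurve

/-- Behaviour of a branch at its highest level `α`, where the solution starts to fall at the
time `T` with vanishing slope. -/
structure StartsAt (q r V : ℝ → ℝ) (α T : ℝ) : Prop where
  r_lim : Tendsto r (𝓝[<] α) (𝓝 T)
  V_lim : Tendsto V (𝓝[<] α) (𝓝 0)
  slp_lim : Tendsto (slp q r V) (𝓝[<] α) (𝓝 0)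

/-- The first phase coordinate `h |u'| / u` as a function of the level. -/
noncomputable def xco (q r V : ℝ → ℝ) (s : ℝ) : ℝ := V s * tailInt q (r s) / s

namespace Branch

variable {c : EReal} {b β Hinf linf : ℝ} {f q : ℝ → ℝ} {r V r₁ V₁ r₂ V₂ : ℝ → ℝ}
  {a d α α₁ α₂ : ℝ}

theorem hasDerivAt_V_mul (B : Branch c f q r V a d) (W : Weight q Hinf linf) {s : ℝ}
    (hs : s ∈ Ioo a d) :
    HasDerivAt (fun s => V s * tailInt q (r s))
      (1 - q (r s) ^ 2 * f s / V s * tailInt q (r s)) s := by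
  have h := (B.deriv_V s hs).mul
    ((W.hasDerivAt_tailInt (B.r_pos s hs)).comp s (B.deriv_r s hs))
  refine HasDerivAt.congr_deriv (f := fun s => V s * tailInt q (r s)) h ?_
  have := (B.q_pos W hs).ne'
  have := (B.V_pos s hs).ne'
  simp
  field_simp
  ring

theorem hasDerivAt_xco (B : Branch c f q r V a d) (W : Weight q Hinf linf) {s : ℝ}
    (hs : s ∈ Ioo a d) (h0 : 0 < s) :
    HasDerivAt (xco q r V)
      (-((xco q r V s ^ 2 - xco q r V s + funh q (r s) ^ 2 * f s / s) / (xco q r V s * s))) s := by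
  have h := (B.hasDerivAt_V_mul W hs).div (hasDerivAt_id s) h0.ne'
  refine HasDerivAt.congr_deriv (f := xco q r V) h ?_
  have := (B.q_pos W hs).ne'
  have := (B.V_pos s hs).ne'
  have := (W.tailInt_pos (B.r_pos s hs)).ne'
  simp only [xco, Weight.funh_eq, id]
  field_simp
  ring

/-- `x² - x + w` up to a positive factor; its derivative has a sign while `x < 1`. -/
noncomputable def xi (f q r V : ℝ → ℝ) (s : ℝ) : ℝ :=
  V s * (V s * tailInt q (r s)) - V s * s + q (r s) * funh q (r s) * (f s * s)

theorem xi_eq (B : Branch c f q r V a d) (W : Weight q Hinf linf) {s : ℝ}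
    (hs : s ∈ Ioo a d) (h0 : 0 < s) :
    xco q r V s ^ 2 - xco q r V s + funh q (r s) ^ 2 * f s / s =
      tailInt q (r s) / s ^ 2 * xi f q r V s := by
  have := (B.q_pos W hs).ne'
  simp only [xco, xi, Weight.funh_eq]
  field_simp

theorem hasDerivAt_xi (B : Branch c f q r V a d) (W : Weight q Hinf linf)
    (N : Nonlin c b β f) {s : ℝ} (hs : s ∈ Ioo a d) (h0 : 0 < s) (hf : f s ≠ 0) :
    HasDerivAt (xi f q r V)
      (-(q (r s) ^ 2 * f s * s / V s * (2 * deriv (funh q) (r s) +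
        (1 - s * deriv f s / f s) * xco q r V s))) s := by
  have hr := B.r_pos s hs
  have h1 : HasDerivAt (fun s => q (r s) * funh q (r s)) _ s :=
    (W.hasDerivAt_mul_funh hr).comp s (B.deriv_r s hs)
  have h := (((B.deriv_V s hs).mul (B.hasDerivAt_V_mul W hs)).sub
    ((B.deriv_V s hs).mul (hasDerivAt_id s))).add
    (h1.mul ((N.hasDerivAt h0 (B.mem s hs)).mul (hasDerivAt_id s)))
  refine HasDerivAt.congr_deriv (f := xi f q r V) h ?_
  have := (B.q_pos W hs).ne'
  have := (B.V_pos s hs).ne'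
  simp only [xco, Weight.funh_eq, id]
  field_simp
  simp
  ring

theorem tendsto_xco (B : Branch c f q r V a α) (W : Weight q Hinf linf) (ha : a < α)
    (hα : 0 < α) (T : StartsAt q r V α 0) :
    Tendsto (fun s => V s * tailInt q (r s)) (𝓝[<] α) (𝓝 0) ∧
    Tendsto (xco q r V) (𝓝[<] α) (𝓝 0) := by
  have h1 : Tendsto (fun s => V s * tailInt q (r s)) (𝓝[<] α) (𝓝 0) := by
    have hlim : Tendsto (fun s => funh q 1 * slp q r V s) (𝓝[<] α) (𝓝 0) := by
      simpa using T.slp_lim.const_mul (funh q 1)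
    refine tendsto_of_tendsto_of_tendsto_of_le_of_le' tendsto_const_nhds hlim ?_ ?_
    · filter_upwards [Ioo_mem_nhdsLT ha] with s hs
      exact (mul_pos (B.V_pos s hs) (W.tailInt_pos (B.r_pos s hs))).le
    · filter_upwards [Ioo_mem_nhdsLT ha, T.r_lim.eventually_lt_const one_pos] with s hs hs1
      have h2 := W.funh_strictMonoOn (B.r_pos s hs) (show (0:ℝ) < 1 from one_pos) hs1
      rw [B.V_eq W hs]
      have h3 := mul_le_mul_of_nonneg_right h2.le (B.slp_pos W hs).le
      rw [Weight.funh_eq (r s)] at h3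
      linarith
  refine ⟨h1, ?_⟩
  have hid : Tendsto (fun s : ℝ => s) (𝓝[<] α) (𝓝 α) :=
    tendsto_nhdsWithin_of_tendsto_nhds tendsto_id
  have h := h1.div hid hα.ne'
  rw [zero_div] at h
  exact h

theorem tendsto_q (B : Branch c f q r V a α) (W : Weight q Hinf linf) (ha : a < α)
    (T : StartsAt q r V α 0) : Tendsto (fun s => q (r s)) (𝓝[<] α) (𝓝 0) := by
  have h0 := (W.c1.cont 0 (mem_Ici.2 le_rfl))
  rw [ContinuousWithinAt, W.c1.zero] at h0
  refine h0.comp (tendsto_nhdsWithin_iff.2 ⟨T.r_lim, ?_⟩)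
  filter_upwards [Ioo_mem_nhdsLT ha] with s hs using (B.r_pos s hs).le

theorem tendsto_xi (B : Branch c f q r V a α) (W : Weight q Hinf linf) (N : Nonlin c b β f)
    (ha : a < α) (hα : 0 < α) (hd : α ∈ dom c) (T : StartsAt q r V α 0) :
    Tendsto (xi f q r V) (𝓝[<] α) (𝓝 0) := by
  have hid : Tendsto (fun s : ℝ => s) (𝓝[<] α) (𝓝 α) :=
    tendsto_nhdsWithin_of_tendsto_nhds tendsto_id
  have hf : Tendsto f (𝓝[<] α) (𝓝 (f α)) :=
    tendsto_nhdsWithin_of_tendsto_nhds (N.continuousAt hd)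
  have h1 := T.V_lim.mul (B.tendsto_xco W ha hα T).1
  have h2 := T.V_lim.mul hid
  have h3 : Tendsto (fun s => q (r s) * funh q (r s)) (𝓝[<] α) (𝓝 0) := by
    have hlim : Tendsto (fun s => q (r s) * funh q 1) (𝓝[<] α) (𝓝 0) := by
      simpa using (B.tendsto_q W ha T).mul_const (funh q 1)
    refine tendsto_of_tendsto_of_tendsto_of_le_of_le' tendsto_const_nhds hlim ?_ ?_
    · filter_upwards [Ioo_mem_nhdsLT ha] with s hs
      exact (mul_pos (B.q_pos W hs) (W.funh_pos (B.r_pos s hs))).le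
    · filter_upwards [Ioo_mem_nhdsLT ha, T.r_lim.eventually_lt_const one_pos] with s hs hs1
      have h2 := W.funh_strictMonoOn (B.r_pos s hs) (show (0:ℝ) < 1 from one_pos) hs1
      exact mul_le_mul_of_nonneg_left h2.le (B.q_pos W hs).le
  have h : Tendsto (xi f q r V) (𝓝[<] α) (𝓝 (0 * 0 - 0 * α + 0 * (f α * α))) :=
    (h1.sub h2).add (h3.mul (hf.mul hid))
  simpa using h

/-- The first phase coordinate strictly increases in time. -/
theorem xi_pos (B : Branch c f q r V a α) (W : Weight q Hinf linf) (N : Nonlin c b β f)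
    (h4 : CondF4 c b f) (h6 : CondF6 β linf f) (ha : a < β) (hα : β < α) (hd : α ∈ dom c)
    (T : StartsAt q r V α 0) : ∀ s ∈ Ioo β α, 0 < xi f q r V s := by
  have hβ := N.β_pos
  have hsub : Ioo β α ⊆ Ioo a α := Ioo_subset_Ioo ha.le le_rfl
  have hfp : ∀ s ∈ Ioo β α, 0 < f s := fun s hs =>
    N.pos (N.c1.b_lt_β.trans hs.1) (B.mem s (hsub hs))
  have hxp : ∀ s ∈ Ioo β α, 0 < xco q r V s := fun s hs =>
    div_pos (mul_pos (B.V_pos s (hsub hs)) (W.tailInt_pos (B.r_pos s (hsub hs))))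
      (hβ.trans hs.1)
  have hder : ∀ s ∈ Ioo β α, HasDerivAt (xi f q r V) _ s := fun s hs =>
    B.hasDerivAt_xi W N (hsub hs) (hβ.trans hs.1) (hfp s hs).ne'
  have hneg : ∀ s ∈ Ioo β α, xco q r V s < 1 →
      -(q (r s) ^ 2 * f s * s / V s * (2 * deriv (funh q) (r s) +
        (1 - s * deriv f s / f s) * xco q r V s)) < 0 := by
    intro s hs hx
    have h1 := N.elasticity_le h4 h6 hs.1.le (B.mem s (hsub hs))
    have h2 := W.le_deriv_funh (B.r_pos s (hsub hs))
    have h3 := W.c4.linf_pos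
    have h5 := hxp s hs
    have h7 : 0 < 2 * deriv (funh q) (r s) + (1 - s * deriv f s / f s) * xco q r V s := by
      nlinarith
    have h8 : 0 < q (r s) ^ 2 * f s * s / V s := div_pos (mul_pos (mul_pos
      (pow_pos (B.q_pos W (hsub hs)) 2) (hfp s hs)) (hβ.trans hs.1)) (B.V_pos s (hsub hs))
    have := mul_pos h8 h7
    linarith
  have hx0 := (B.tendsto_xco W (ha.trans hα) (hβ.trans hα) T).2
  obtain ⟨m, hm, hmx⟩ : ∃ m ∈ Ico β α, Ioo m α ⊆ {s | xco q r V s < 1} :=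
    (mem_nhdsLT_iff_exists_mem_Ico_Ioo_subset hα).1 (hx0.eventually_lt_const one_pos)
  have htop : ∀ s ∈ Ioo m α, 0 < xi f q r V s := by
    intro s hs
    obtain ⟨t, ht1, ht2⟩ := exists_between hs.2
    have hanti : ∀ u ∈ Ioo t α, xi f q r V u ≤ xi f q r V t := by
      intro u hu
      refine antitoneOn_Icc_of_hasDerivAt (fun v hv => hder v
        ⟨hm.1.trans_lt (hs.1.trans (ht1.trans_le hv.1)), hv.2.trans_lt hu.2⟩)
        (fun v hv => (hneg v ⟨hm.1.trans_lt (hs.1.trans (ht1.trans hv.1)), hv.2.trans hu.2⟩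
          (hmx ⟨hs.1.trans (ht1.trans hv.1), hv.2.trans hu.2⟩)).le)
        (left_mem_Icc.2 hu.1.le) (right_mem_Icc.2 hu.1.le) hu.1.le
    have h0 : 0 ≤ xi f q r V t := by
      refine le_of_tendsto (B.tendsto_xi W N (ha.trans hα) (hβ.trans hα) hd T) ?_
      filter_upwards [Ioo_mem_nhdsLT ht2] with u hu using hanti u hu
    refine h0.trans_lt ?_
    refine strictAntiOn_Icc_of_hasDerivAt (fun v hv => hder v
        ⟨hm.1.trans_lt (hs.1.trans_le hv.1), hv.2.trans_lt ht2⟩)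
        (fun v hv => (hneg v ⟨hm.1.trans_lt (hs.1.trans hv.1), hv.2.trans ht2⟩
          (hmx ⟨hs.1.trans hv.1, hv.2.trans ht2⟩)))
        (left_mem_Icc.2 ht1.le) (right_mem_Icc.2 ht1.le) ht1
  intro s hs
  rcases lt_or_ge m s with hms | hms
  · exact htop s ⟨hms, hs.2⟩
  obtain ⟨t, ht1, ht2⟩ := exists_between hm.2
  refine backward_barrier (D := xi f q r V) (s₀ := s) (s₁ := t) (fun u hu =>
    (hder u ⟨hs.1.trans_le hu.1, hu.2.trans_lt ht2⟩).continuousAt.continuousWithinAt)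
    (htop t ⟨ht1, ht2⟩) ?_ s ⟨le_rfl, hms.trans ht1.le⟩
  intro u hu hu0 hpos
  have hu' : u ∈ Ioo β α := ⟨hs.1.trans_le hu.1, hu.2.trans ht2⟩
  have h5 := deriv_nonneg_of_nonneg_right (hder u hu') hu0 hu.2 (fun v hv => (hpos v hv).le)
  have h7 := B.xi_eq W (hsub hu') (hβ.trans hu'.1)
  rw [hu0, mul_zero] at h7
  have hw : 0 < funh q (r u) ^ 2 * f u / u := div_pos (mul_pos
    (pow_pos (W.funh_pos (B.r_pos u (hsub hu'))) 2) (hfp u hu')) (hβ.trans hu'.1)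
  have hx1 : xco q r V u < 1 := by
    by_contra! h
    nlinarith
  linarith [hneg u hu' hx1]

/-- Near the start the flux is `∼ f(α) Q`. -/
theorem tendsto_flux (B : Branch c f q r V a α) (W : Weight q Hinf linf) (N : Nonlin c b β f)
    (ha : a < α) (hα : b < α) (hd : α ∈ dom c) (T : StartsAt q r V α 0) :
    Tendsto (fun s => V s / (primQ q (r s) * f s)) (𝓝[<] α) (𝓝 1) := by
  have hfα := N.pos hα hd
  have hf : Tendsto f (𝓝[<] α) (𝓝 (f α)) :=
    tendsto_nhdsWithin_of_tendsto_nhds (N.continuousAt hd)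
  have hQ : Tendsto (fun s => primQ q (r s)) (𝓝[<] α) (𝓝 0) := by
    refine W.tendsto_primQ_zero.comp (tendsto_nhdsWithin_iff.2 ⟨T.r_lim, ?_⟩)
    filter_upwards [Ioo_mem_nhdsLT ha] with s hs using B.r_pos s hs
  have hder : ∀ k : ℝ, ∀ s ∈ Ioo a α, HasDerivAt (fun s => V s - k * primQ q (r s))
      (-(q (r s) ^ 2 / V s * (f s - k))) s := by
    intro k s hs
    have h1 : HasDerivAt (fun s => primQ q (r s)) _ s :=
      (W.hasDerivAt_primQ (B.r_pos s hs)).comp s (B.deriv_r s hs)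
    refine ((B.deriv_V s hs).sub (h1.const_mul k)).congr_deriv ?_
    have := (B.V_pos s hs).ne'
    field_simp
    ring
  have hlimk : ∀ k : ℝ, Tendsto (fun s => V s - k * primQ q (r s)) (𝓝[<] α) (𝓝 0) := by
    intro k
    simpa using T.V_lim.sub (hQ.const_mul k)
  have hlow : ∀ k < f α, ∀ᶠ s in 𝓝[<] α, k * primQ q (r s) ≤ V s := by
    intro k hk
    obtain ⟨m, hm, hmx⟩ : ∃ m ∈ Ico a α, Ioo m α ⊆ {s | k < f s} :=
      (mem_nhdsLT_iff_exists_mem_Ico_Ioo_subset ha).1 (hf.eventually_const_lt hk)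
    filter_upwards [Ioo_mem_nhdsLT hm.2] with s hs
    have : (0:ℝ) ≤ V s - k * primQ q (r s) := by
      refine le_of_tendsto (hlimk k) ?_
      filter_upwards [Ioo_mem_nhdsLT hs.2] with u hu
      refine antitoneOn_Icc_of_hasDerivAt (fun v hv => hder k v
        ⟨hm.1.trans_lt (hs.1.trans_le hv.1), hv.2.trans_lt hu.2⟩) (fun v hv => ?_)
        (left_mem_Icc.2 hu.1.le) (right_mem_Icc.2 hu.1.le) hu.1.le
      have hv1 : k < f v := hmx ⟨hs.1.trans hv.1, hv.2.trans hu.2⟩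
      exact neg_nonpos.2 (mul_nonneg (div_nonneg (sq_nonneg _) (B.V_pos v
        ⟨hm.1.trans_lt (hs.1.trans hv.1), hv.2.trans hu.2⟩).le) (by linarith))
    linarith
  have hhigh : ∀ k > f α, ∀ᶠ s in 𝓝[<] α, V s ≤ k * primQ q (r s) := by
    intro k hk
    obtain ⟨m, hm, hmx⟩ : ∃ m ∈ Ico a α, Ioo m α ⊆ {s | f s < k} :=
      (mem_nhdsLT_iff_exists_mem_Ico_Ioo_subset ha).1 (hf.eventually_lt_const hk)
    filter_upwards [Ioo_mem_nhdsLT hm.2] with s hs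
    have : V s - k * primQ q (r s) ≤ 0 := by
      refine ge_of_tendsto (hlimk k) ?_
      filter_upwards [Ioo_mem_nhdsLT hs.2] with u hu
      refine monotoneOn_Icc_of_hasDerivAt (fun v hv => hder k v
        ⟨hm.1.trans_lt (hs.1.trans_le hv.1), hv.2.trans_lt hu.2⟩) (fun v hv => ?_)
        (left_mem_Icc.2 hu.1.le) (right_mem_Icc.2 hu.1.le) hu.1.le
      have hv1 : f v < k := hmx ⟨hs.1.trans hv.1, hv.2.trans hu.2⟩
      exact neg_nonneg.2 (mul_nonpos_of_nonneg_of_nonpos (div_nonneg (sq_nonneg _) (B.V_pos v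
        ⟨hm.1.trans_lt (hs.1.trans hv.1), hv.2.trans hu.2⟩).le) (by linarith))
    linarith
  have hmain : Tendsto (fun s => V s / primQ q (r s)) (𝓝[<] α) (𝓝 (f α)) := by
    refine tendsto_order.2 ⟨fun k hk => ?_, fun k hk => ?_⟩
    · obtain ⟨k', h1, h2⟩ := exists_between hk
      filter_upwards [hlow k' h2, Ioo_mem_nhdsLT ha] with s hs hs'
      exact h1.trans_le ((le_div_iff₀ (W.primQ_pos (B.r_pos s hs'))).2 hs)
    · obtain ⟨k', h1, h2⟩ := exists_between hk
      filter_upwards [hhigh k' h1, Ioo_mem_nhdsLT ha] with s hs hs'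
      exact ((div_le_iff₀ (W.primQ_pos (B.r_pos s hs'))).2 hs).trans_lt h2
  have := hmain.div hf hfα.ne'
  rw [div_self hfα.ne'] at this
  exact this.congr fun s => by simp [div_div]

/-- Above the level `β` a branch starting at time `0` is a phase curve. -/
theorem exists_phaseCurve (B : Branch c f q r V a α) (W : Weight q Hinf linf)
    (N : Nonlin c b β f) (h4 : CondF4 c b f) (h6 : CondF6 β linf f) (ha : a < β) (hα : β < α)
    (hd : α ∈ dom c) (T : StartsAt q r V α 0) :
    StrictAntiOn (xco q r V) (Ico β α) ∧
    ∃ S ρ : ℝ → ℝ, PhaseCurve c β f q S ρ (xco q r V β) ∧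
      (∀ s ∈ Ioo β α, xco q r V s ∈ Ioo 0 (xco q r V β) ∧ S (xco q r V s) = s ∧
        ρ (xco q r V s) = r s) ∧
      ∀ x ∈ Ioo 0 (xco q r V β), ∃ s ∈ Ioo β α, xco q r V s = x := by
  have hβ := N.β_pos
  have hsub : Ico β α ⊆ Ioo a α := fun s hs => ⟨ha.trans_le hs.1, hs.2⟩
  have hsub' : Ioo β α ⊆ Ioo a α := Ioo_subset_Ioo ha.le le_rfl
  have hxi := B.xi_pos W N h4 h6 ha hα hd T
  have hfp : ∀ s ∈ Ioo β α, 0 < f s := fun s hs =>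
    N.pos (N.c1.b_lt_β.trans hs.1) (B.mem s (hsub' hs))
  have hxp : ∀ s ∈ Ico β α, 0 < xco q r V s := fun s hs =>
    div_pos (mul_pos (B.V_pos s (hsub hs)) (W.tailInt_pos (B.r_pos s (hsub hs))))
      (hβ.trans_le hs.1)
  have hX : ∀ s ∈ Ioo β α,
      0 < xco q r V s ^ 2 - xco q r V s + funh q (r s) ^ 2 * f s / s := by
    intro s hs
    rw [B.xi_eq W (hsub' hs) (hβ.trans hs.1)]
    exact mul_pos (div_pos (W.tailInt_pos (B.r_pos s (hsub' hs)))
      (pow_pos (hβ.trans hs.1) 2)) (hxi s hs)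
  have hder : ∀ s ∈ Ico β α, HasDerivAt (xco q r V) _ s := fun s hs =>
    B.hasDerivAt_xco W (hsub hs) (hβ.trans_le hs.1)
  have hanti : StrictAntiOn (xco q r V) (Ico β α) := by
    refine strictAntiOn_of_deriv_neg (convex_Ico β α)
      (fun s hs => (hder s hs).continuousAt.continuousWithinAt) ?_
    intro s hs
    rw [interior_Ico] at hs
    rw [(hder s (Ioo_subset_Ico_self hs)).deriv]
    exact neg_lt_zero.2 (div_pos (hX s hs) (mul_pos (hxp s (Ioo_subset_Ico_self hs))
      (hβ.trans hs.1)))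
  obtain ⟨S, hS, hSd⟩ := exists_inverse isOpen_Ioo (hanti.mono Ioo_subset_Ico_self)
    (fun s hs => hder s (Ioo_subset_Ico_self hs)) (fun s hs => (neg_lt_zero.2 (div_pos (hX s hs)
      (mul_pos (hxp s (Ioo_subset_Ico_self hs)) (hβ.trans hs.1)))).ne)
  have hx0 := (B.tendsto_xco W (ha.trans hα) (hβ.trans hα) T).2
  have hsurj : ∀ x ∈ Ioo 0 (xco q r V β), ∃ s ∈ Ioo β α, xco q r V s = x := by
    intro x hx
    obtain ⟨t, ht1, ht2⟩ := ((hx0.eventually_lt_const hx.1).and (Ioo_mem_nhdsLT hα)).exists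
    obtain ⟨s, hs, hsx⟩ := intermediate_value_Icc' ht2.1.le (fun u hu => (hder u
      ⟨hu.1, hu.2.trans_lt ht2.2⟩).continuousAt.continuousWithinAt) ⟨ht1.le, hx.2.le⟩
    refine ⟨s, ⟨lt_of_le_of_ne hs.1 ?_, hs.2.trans_lt ht2.2⟩, hsx⟩
    rintro rfl
    exact hx.2.ne hsx.symm
  have hmaps : ∀ s ∈ Ioo β α, xco q r V s ∈ Ioo 0 (xco q r V β) := fun s hs =>
    ⟨hxp s (Ioo_subset_Ico_self hs), hanti (left_mem_Ico.2 hα) (Ioo_subset_Ico_self hs) hs.1⟩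
  refine ⟨hanti, S, fun x => r (S x), ⟨?_, ?_, ?_, ?_, ?_, ?_, ?_⟩,
    fun s hs => ⟨hmaps s hs, hS s hs, by simp only [hS s hs]⟩, hsurj⟩
  · intro x hx
    obtain ⟨s, hs, rfl⟩ := hsurj x hx
    rw [hS s hs]; exact hs.1
  · intro x hx
    obtain ⟨s, hs, rfl⟩ := hsurj x hx
    rw [hS s hs]; exact B.mem s (hsub' hs)
  · intro x hx
    obtain ⟨s, hs, rfl⟩ := hsurj x hx
    simp only [hS s hs]; exact B.r_pos s (hsub' hs)
  · intro x hx
    obtain ⟨s, hs, rfl⟩ := hsurj x hx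
    simp only [hS s hs]; exact hX s hs
  · intro x hx
    obtain ⟨s, hs, rfl⟩ := hsurj x hx
    refine (hSd s hs).congr_deriv ?_
    simp only [hS s hs]
    rw [inv_neg, inv_div]
  · intro x hx
    obtain ⟨s, hs, rfl⟩ := hsurj x hx
    have h1 := B.deriv_r s (hsub' hs)
    rw [← hS s hs] at h1
    refine (h1.comp (xco q r V s) (hSd s hs)).congr_deriv ?_
    simp only [hS s hs]
    rw [inv_neg, inv_div]
    have hx := hX s hs
    generalize xco q r V s ^ 2 - xco q r V s + funh q (r s) ^ 2 * f s / s = X at *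
    have := (B.V_pos s (hsub' hs)).ne'
    have := (hβ.trans hs.1).ne'
    simp only [xco, Weight.funh_eq]
    field_simp
  · have hSlim : Tendsto S (𝓝[>] 0) (𝓝[<] α) := by
      have hξ := hxp β (left_mem_Ico.2 hα)
      refine tendsto_nhdsWithin_iff.2 ⟨tendsto_order.2 ⟨fun k hk => ?_, fun k hk => ?_⟩, ?_⟩
      · obtain ⟨t, ht1, ht2⟩ := exists_between (max_lt hk hα)
        have ht : t ∈ Ioo β α := ⟨(le_max_right _ _).trans_lt ht1, ht2⟩
        filter_upwards [Ioo_mem_nhdsGT (hmaps t ht).1, Ioo_mem_nhdsGT hξ] with x hx hx'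
        obtain ⟨s, hs, rfl⟩ := hsurj x hx'
        rw [hS s hs]
        have := (hanti.lt_iff_gt (Ioo_subset_Ico_self hs) (Ioo_subset_Ico_self ht)).1 hx.2
        exact (le_max_left _ _).trans_lt (ht1.trans this)
      · filter_upwards [Ioo_mem_nhdsGT hξ] with x hx'
        obtain ⟨s, hs, rfl⟩ := hsurj x hx'
        rw [hS s hs]
        exact hs.2.trans hk
      · filter_upwards [Ioo_mem_nhdsGT hξ] with x hx'
        obtain ⟨s, hs, rfl⟩ := hsurj x hx'
        rw [hS s hs]
        exact hs.2
    refine ((B.tendsto_flux W N (ha.trans hα) (N.c1.b_lt_β.trans hα) hd T).comp hSlim).congr' ?_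
    filter_upwards [Ioo_mem_nhdsGT (hxp β (left_mem_Ico.2 hα))] with x hx'
    obtain ⟨s, hs, rfl⟩ := hsurj x hx'
    simp only [Function.comp, hS s hs]
    simp only [xco, Weight.funh_eq]
    have := (hβ.trans hs.1).ne'
    have := (B.V_pos s (hsub' hs)).ne'
    have := (hfp s hs).ne'
    have := (B.q_pos W (hsub' hs)).ne'
    have := (W.primQ_pos (B.r_pos s (hsub' hs))).ne'
    have := (W.tailInt_pos (B.r_pos s (hsub' hs))).ne'
    field_simp

/-- For a decreasing elasticity: if the first branch, which starts lower, is overtaken in time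
above the level `β`, then down to `β` it stays late, flatter and with smaller flux. -/
theorem crossing_above (B₁ : Branch c f q r₁ V₁ a α₁) (B₂ : Branch c f q r₂ V₂ a α₂)
    (W : Weight q Hinf linf) (N : Nonlin c b β f) (h4 : CondF4 c b f) (h6 : CondF6 β linf f)
    (ha : a < β) (h12 : α₁ ≤ α₂) (hd₁ : α₁ ∈ dom c) (hd₂ : α₂ ∈ dom c)
    (T₁ : StartsAt q r₁ V₁ α₁ 0) (T₂ : StartsAt q r₂ V₂ α₂ 0) {s₁ : ℝ} (hs₁ : s₁ ∈ Ioo β α₁)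
    (hr : r₁ s₁ = r₂ s₁) (hp : slp q r₁ V₁ s₁ < slp q r₂ V₂ s₁) :
    (∀ s ∈ Icc β s₁, slp q r₁ V₁ s < slp q r₂ V₂ s) ∧ V₁ β ≤ V₂ β := by
  have hβ := N.β_pos
  have hβα := hs₁.1.trans hs₁.2
  obtain ⟨hx1, S₁, ρ₁, P₁, hS₁, hj₁⟩ := B₁.exists_phaseCurve W N h4 h6 ha hβα hd₁ T₁
  obtain ⟨hx2, S₂, ρ₂, P₂, hS₂, hj₂⟩ :=
    B₂.exists_phaseCurve W N h4 h6 ha (hβα.trans_le h12) hd₂ T₂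
  have hsub1 : Ico β α₁ ⊆ Ioo a α₁ := fun s hs => ⟨ha.trans_le hs.1, hs.2⟩
  have hsub2 : Ico β α₂ ⊆ Ioo a α₂ := fun s hs => ⟨ha.trans_le hs.1, hs.2⟩
  have h12' : Ioo β α₁ ⊆ Ioo β α₂ := Ioo_subset_Ioo le_rfl h12
  have hs1 := hsub1 (Ioo_subset_Ico_self hs₁)
  have hs2 := hsub2 (Ioo_subset_Ico_self (h12' hs₁))
  have hI := W.tailInt_pos (B₁.r_pos s₁ hs1)
  have hs0 : 0 < s₁ := hβ.trans hs₁.1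
  set x := xco q r₁ V₁ s₁ with hx
  have hxlt : x < xco q r₂ V₂ s₁ := by
    have : V₁ s₁ < V₂ s₁ := by
      rw [B₁.V_eq W hs1, B₂.V_eq W hs2, hr]
      exact mul_lt_mul_of_pos_left hp (B₂.q_pos W hs2)
    simp only [hx, xco, ← hr]
    gcongr
  have hxξ1 := (hS₁ s₁ hs₁).1
  have hxξ2 := (hS₂ s₁ (h12' hs₁)).1
  obtain ⟨s', hs', hs'x⟩ := hj₂ x ⟨hxξ1.1, hxlt.trans hxξ2.2⟩
  have hs's : s₁ < s' := by
    rw [← hs'x] at hxlt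
    exact (hx2.lt_iff_gt (Ioo_subset_Ico_self hs') (Ioo_subset_Ico_self (h12' hs₁))).1 hxlt
  set ξ := min (xco q r₁ V₁ β) (xco q r₂ V₂ β) with hξ
  have hcmp := (P₁.mono (min_le_left _ _)).compare (P₂.mono (min_le_right _ _)) W N h4 h6
    (x₁ := x) ⟨hxξ1.1, lt_min hxξ1.2 (hxlt.trans hxξ2.2)⟩
    (by
      rw [(hS₁ s₁ hs₁).2.2, ← hs'x, (hS₂ s' hs').2.2, hr]
      exact B₂.strictAntiOn_r W hs2 (hsub2 (Ioo_subset_Ico_self hs')) hs's)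
    (by rw [(hS₁ s₁ hs₁).2.1, ← hs'x, (hS₂ s' hs').2.1]; exact hs's)
  -- at lower levels the second branch has the larger `x`
  have hxx : ∀ s ∈ Ioo β s₁, xco q r₁ V₁ s < xco q r₂ V₂ s := by
    intro s hs
    have hsα1 : s ∈ Ioo β α₁ := ⟨hs.1, hs.2.trans hs₁.2⟩
    by_contra! hle
    have e1 : x < xco q r₂ V₂ s := hxlt.trans
      (hx2 (Ioo_subset_Ico_self (h12' hsα1)) (Ioo_subset_Ico_self (h12' hs₁)) hs.2)
    have e2 : xco q r₂ V₂ s < xco q r₁ V₁ β := hle.trans_lt (hS₁ s hsα1).1.2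
    have e3 := (hcmp (xco q r₂ V₂ s) ⟨e1.le, lt_min e2 (hS₂ s (h12' hsα1)).1.2⟩).1
    rw [(hS₂ s (h12' hsα1)).2.1] at e3
    obtain ⟨u, hu, hux⟩ := hj₁ (xco q r₂ V₂ s) ⟨(hS₂ s (h12' hsα1)).1.1, e2⟩
    rw [← hux, (hS₁ u hu).2.1] at e3
    have := hx1 (Ioo_subset_Ico_self hu) (Ioo_subset_Ico_self hsα1) e3
    linarith
  have hVV : ∀ s ∈ Ioo β s₁, V₁ s < V₂ s := by
    intro s hs
    have hsα1 : s ∈ Ioo β α₁ := ⟨hs.1, hs.2.trans hs₁.2⟩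
    have hsα2 := h12' hsα1
    have e1 : x < xco q r₁ V₁ s :=
      hx1 (Ioo_subset_Ico_self hsα1) (Ioo_subset_Ico_self hs₁) hs.2
    have e2 := (hxx s hs).trans (hS₂ s hsα2).1.2
    obtain ⟨e3, e4⟩ := hcmp _ ⟨e1.le, lt_min (hS₁ s hsα1).1.2 e2⟩
    obtain ⟨u, hu, hux⟩ := hj₂ (xco q r₁ V₁ s) ⟨(hS₁ s hsα1).1.1, e2⟩
    rw [(hS₁ s hsα1).2.1, ← hux, (hS₂ u hu).2.1] at e3
    rw [(hS₁ s hsα1).2.1, (hS₁ s hsα1).2.2, ← hux, (hS₂ u hu).2.1, (hS₂ u hu).2.2] at e4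
    have flux : ∀ {r V : ℝ → ℝ} {d t : ℝ}, Branch c f q r V a d → t ∈ Ioo a d → 0 < t →
        V t = xco q r V t * (t / tailInt q (r t)) := by
      intro r V d t B ht h0
      have := (W.tailInt_pos (B.r_pos t ht)).ne'
      simp only [xco]; field_simp
    rw [flux B₁ (hsub1 (Ioo_subset_Ico_self hsα1)) (hβ.trans hs.1)]
    have hx0 := (hS₁ s hsα1).1.1
    refine (mul_le_mul_of_nonneg_left e4 hx0.le).trans_lt ?_
    rw [← hux, ← flux B₂ (hsub2 (Ioo_subset_Ico_self hu)) (hβ.trans hu.1)]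
    have hsub : Icc s u ⊆ Ioo a α₂ := fun t ht => ⟨ha.trans (hs.1.trans_le ht.1),
      ht.2.trans_lt hu.2⟩
    refine strictAntiOn_Icc_of_hasDerivAt (fun t ht => B₂.deriv_V t (hsub ht)) ?_
      (left_mem_Icc.2 e3.le) (right_mem_Icc.2 e3.le) e3
    intro t ht
    have ht' := hsub (Ioo_subset_Icc_self ht)
    exact neg_lt_zero.2 (div_pos (mul_pos (pow_pos (B₂.q_pos W ht') 2)
      (N.pos (N.c1.b_lt_β.trans (hs.1.trans ht.1)) (B₂.mem t ht'))) (B₂.V_pos t ht'))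
  have hβ1 := hsub1 (left_mem_Ico.2 hβα)
  have hβ2 := hsub2 (left_mem_Ico.2 (hβα.trans_le h12))
  have hVβ : V₁ β ≤ V₂ β := by
    have c1 : Tendsto V₁ (𝓝[>] β) (𝓝 (V₁ β)) :=
      tendsto_nhdsWithin_of_tendsto_nhds (B₁.deriv_V β hβ1).continuousAt
    have c2 : Tendsto V₂ (𝓝[>] β) (𝓝 (V₂ β)) :=
      tendsto_nhdsWithin_of_tendsto_nhds (B₂.deriv_V β hβ2).continuousAt
    refine le_of_tendsto_of_tendsto c1 c2 ?_
    filter_upwards [Ioo_mem_nhdsGT hs₁.1] with s hs using (hVV s hs).le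
  refine ⟨?_, hVβ⟩
  refine B₁.slp_lt_of_contact (B₂.mono le_rfl h12) W ha hs₁.2 hr.ge hp ?_
  intro s hs heq _ hrr
  have hs1 : s ∈ Ioo a α₁ := ⟨ha.trans_le hs.1, hs.2.trans hs₁.2⟩
  have hs2 : s ∈ Ioo a α₂ := ⟨hs1.1, hs1.2.trans_le h12⟩
  have hV : V₁ s ≤ V₂ s := by
    rcases hs.1.eq_or_lt with h | h
    · rw [← h]; exact hVβ
    · exact (hVV s ⟨h, hs.2⟩).le
  rw [B₁.V_eq W hs1, B₂.V_eq W hs2, heq] at hV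
  have h5 := le_of_mul_le_mul_right hV (B₂.slp_pos W hs2)
  exact absurd (W.lt (B₂.r_pos s hs2).le (hrr s ⟨le_rfl, hs.2⟩)) (not_lt.2 h5)

end Branch

/-! ### Solutions starting with vanishing slope -/

/-- A solution on `[T, ∞)` which starts at the time `T` at the level `m` with vanishing slope
and tends to `0` at infinity. -/
structure Sol (c : EReal) (f q : ℝ → ℝ) (T m : ℝ) (v : ℝ → ℝ) : Prop where
  T_nonneg : 0 ≤ T
  mem : ∀ r, T ≤ r → v r ∈ dom c
  start : v T = m
  cont : ContinuousWithinAt v (Ici T) T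
  diff : ∀ r, T < r → DifferentiableAt ℝ v r
  eqn : ∀ r, T < r → HasDerivAt (fun t => q t * deriv v t) (-(q r * f (v r))) r
  flux_lim : Tendsto (fun t => q t * deriv v t) (𝓝[>] T) (𝓝 0)
  deriv_lim : Tendsto (deriv v) (𝓝[>] T) (𝓝 0)
  lim : Tendsto v atTop (𝓝 0)

/-- The energy `v'² + 2 F(v)` as a function of time. -/
noncomputable def nrgT (f v : ℝ → ℝ) (r : ℝ) : ℝ := deriv v r ^ 2 + 2 * primF f (v r)

/-- Near `0` the flux is at most `sup |f(u)| Q`, as otherwise `u'` would not vanish at `0`. -/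
theorem flux_le_of_isSolution {c : EReal} {b β Hinf linf : ℝ} {f q u : ℝ → ℝ}
    (W : Weight q Hinf linf) (N : Nonlin c b β f) (hu : IsSolution c f q u) :
    ∃ M : ℝ, ∀ r ∈ Ioc 0 1, |q r * deriv u r| ≤ M * primQ q r := by
  have hcu : ContinuousOn u (Icc 0 1) := by
    intro r hr
    rcases hr.1.eq_or_lt with h | h
    · rw [← h]
      exact hu.deriv_zero.continuousWithinAt.mono Icc_subset_Ici_self
    · exact (hu.differentiable r h).continuousAt.continuousWithinAt
  have hcf : ContinuousOn (fun r => |f (u r)|) (Icc 0 1) :=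
    (N.continuousOn.comp hcu fun r hr => hu.mem_dom r hr.1).abs
  obtain ⟨M, hM⟩ := isCompact_Icc.bddAbove_image hcf
  have hM' : ∀ r ∈ Icc (0:ℝ) 1, |f (u r)| ≤ M := fun r hr => hM (mem_image_of_mem _ hr)
  -- a one-sided version, applied with both signs
  have key : ∀ σ : ℝ, |σ| = 1 → ∀ r ∈ Ioc (0:ℝ) 1, σ * (q r * deriv u r) ≤ M * primQ q r := by
    intro σ hσ r hr
    by_contra! hcon
    set δ := σ * (q r * deriv u r) - M * primQ q r with hδ
    have hδ0 : 0 < δ := sub_pos.2 hcon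
    have hlow : ∀ t ∈ Ioc 0 r, δ ≤ σ * (q t * deriv u t) := by
      intro t ht
      have hanti := antitoneOn_Icc_of_hasDerivAt (x := t) (y := r)
        (fun x hx => ((hu.equation x (ht.1.trans_le hx.1)).const_mul σ).sub
          ((W.hasDerivAt_primQ (ht.1.trans_le hx.1)).const_mul M)) (fun x hx => by
          have hx0 := ht.1.trans hx.1
          have h1 := hM' x ⟨hx0.le, hx.2.le.trans hr.2⟩
          have h2 : -(σ * f (u x)) ≤ M := by
            have := neg_abs_le (σ * f (u x))
            rw [abs_mul, hσ, one_mul] at this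
            linarith
          have := mul_le_mul_of_nonneg_left h2 (W.pos hx0).le
          linarith)
        (left_mem_Icc.2 ht.2) (right_mem_Icc.2 ht.2) ht.2
      simp only [Pi.sub_apply] at hanti
      have hM0 : 0 ≤ M := (abs_nonneg _).trans (hM' 0 (left_mem_Icc.2 zero_le_one))
      have := mul_nonneg hM0 (W.primQ_pos ht.1).le
      linarith
    have hq0 : Tendsto q (𝓝[>] 0) (𝓝 0) := by
      have := (W.c1.cont 0 (mem_Ici.2 le_rfl)).mono Ioi_subset_Ici_self
      simpa [ContinuousWithinAt, W.c1.zero] using this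
    obtain ⟨ε, hε, hεq⟩ : ∃ ε ∈ Ioi (0:ℝ), Ioo 0 ε ⊆ {t | q t < δ} :=
      mem_nhdsGT_iff_exists_Ioo_subset.1 (hq0.eventually_lt_const hδ0)
    have hε' : (0:ℝ) < ε := hε
    have hmε : 0 < min ε r := lt_min hε' hr.1
    have hd1 : ∀ t ∈ Ioo 0 (min ε r), 1 ≤ σ * deriv u t := by
      intro t ht
      have h1 := hlow t ⟨ht.1, ht.2.le.trans (min_le_right _ _)⟩
      have h2 : q t < δ := hεq ⟨ht.1, ht.2.trans_le (min_le_left _ _)⟩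
      have h3 := W.pos ht.1
      by_contra! hlt
      nlinarith
    have hslope : ∀ t ∈ Ioo 0 (min ε r), 1 ≤ σ * slope u 0 t := by
      intro t ht
      have hsub : Icc 0 t ⊆ Icc 0 1 :=
        Icc_subset_Icc le_rfl (ht.2.le.trans ((min_le_right _ _).trans hr.2))
      obtain ⟨x, hx, hxe⟩ := exists_deriv_eq_slope u ht.1 (hcu.mono hsub)
        (fun x hx => (hu.differentiable x hx.1).differentiableWithinAt)
      rw [slope_def_field, ← hxe]
      exact hd1 x ⟨hx.1, hx.2.trans ht.2⟩
    have hlim : Tendsto (fun t => σ * slope u 0 t) (𝓝[>] 0) (𝓝 (σ * 0)) := by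
      have := (hasDerivWithinAt_iff_tendsto_slope' (s := Ioi (0:ℝ)) (by simp)).1
        (hu.deriv_zero.mono Ioi_subset_Ici_self)
      exact this.const_mul σ
    rw [mul_zero] at hlim
    have := ge_of_tendsto hlim (by filter_upwards [Ioo_mem_nhdsGT hmε] with t ht using hslope t ht)
    linarith
  refine ⟨M, fun r hr => abs_le.2 ⟨?_, ?_⟩⟩
  · have := key (-1) (by simp) r hr
    linarith
  · have := key 1 (by simp) r hr
    linarith

/-- A solution of the problem is a solution starting at the time `0`; the equation and `u'(0) = 0`
give `u'(r) → 0` as `r → 0`. -/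
theorem Sol.of_isSolution {c : EReal} {b β Hinf linf : ℝ} {f q u : ℝ → ℝ}
    (W : Weight q Hinf linf) (N : Nonlin c b β f) (hu : IsSolution c f q u) :
    Sol c f q 0 (u 0) u := by
  obtain ⟨M, hM⟩ := flux_le_of_isSolution W N hu
  have hid : Tendsto (fun r : ℝ => r) (𝓝[>] 0) (𝓝 0) :=
    tendsto_nhdsWithin_of_tendsto_nhds tendsto_id
  refine ⟨le_rfl, hu.mem_dom, rfl, hu.deriv_zero.continuousWithinAt, hu.differentiable,
    hu.equation, ?_, ?_, hu.limit_top⟩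
  · refine squeeze_zero_norm' (a := fun r => M * primQ q r) ?_
      (by simpa using W.tendsto_primQ_zero.const_mul M)
    filter_upwards [Ioo_mem_nhdsGT one_pos] with r hr using hM r ⟨hr.1, hr.2.le⟩
  · refine squeeze_zero_norm' (a := fun r => |M| * r) ?_ (by simpa using hid.const_mul |M|)
    filter_upwards [Ioo_mem_nhdsGT one_pos] with r hr
    have h1 := hM r ⟨hr.1, hr.2.le⟩
    have h2 := W.primQ_le hr.1.le
    have h3 := W.pos hr.1
    rw [abs_mul, abs_of_pos h3] at h1
    have h4 : M * primQ q r ≤ |M| * (r * q r) :=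
      mul_le_mul (le_abs_self M) h2 (W.primQ_pos hr.1).le (abs_nonneg _)
    rw [Real.norm_eq_abs]
    refine le_of_mul_le_mul_left ?_ h3
    linarith

namespace Sol

variable {c : EReal} {b β Hinf linf : ℝ} {f q v v₁ v₂ : ℝ → ℝ} {T m : ℝ}

theorem pos (S : Sol c f q T m v) {r : ℝ} (hr : T < r) : 0 < r := S.T_nonneg.trans_lt hr

theorem continuousOn (S : Sol c f q T m v) : ContinuousOn v (Ici T) := by
  intro r hr
  rcases (mem_Ici.1 hr).eq_or_lt with h | h
  · rw [← h]; exact S.cont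
  · exact (S.diff r h).continuousAt.continuousWithinAt

theorem hasDerivAt_deriv (S : Sol c f q T m v) (W : Weight q Hinf linf) {r : ℝ} (hr : T < r) :
    HasDerivAt (deriv v) (-(f (v r)) - deriv q r / q r * deriv v r) r := by
  have hq := W.pos (S.pos hr)
  have h := (S.eqn r hr).div (W.hasDerivAt (S.pos hr)) hq.ne'
  refine (h.congr_of_eventuallyEq ?_).congr_deriv ?_
  · filter_upwards [Ioi_mem_nhds hr] with t ht
    have := (W.pos (S.pos ht)).ne'
    simp only [Pi.div_apply]
    field_simp
  · field_simp

theorem hasDerivAt_nrgT (S : Sol c f q T m v) (W : Weight q Hinf linf) (N : Nonlin c b β f)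
    {r : ℝ} (hr : T < r) :
    HasDerivAt (nrgT f v) (-(2 * (deriv q r / q r) * deriv v r ^ 2)) r := by
  have h := ((S.hasDerivAt_deriv W hr).pow 2).add
    (((N.hasDerivAt_primF (S.mem r hr.le)).comp r (S.diff r hr).hasDerivAt).const_mul 2)
  refine HasDerivAt.congr_deriv (f := nrgT f v) h ?_
  simp
  ring

theorem nrgT_anti (S : Sol c f q T m v) (W : Weight q Hinf linf) (N : Nonlin c b β f)
    {r t : ℝ} (hr : T < r) (hrt : r ≤ t) : nrgT f v t ≤ nrgT f v r := by
  refine antitoneOn_Icc_of_hasDerivAt (fun x hx => S.hasDerivAt_nrgT W N (hr.trans_le hx.1)) ?_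
    (left_mem_Icc.2 hrt) (right_mem_Icc.2 hrt) hrt
  intro x hx
  have hx0 := S.pos (hr.trans hx.1)
  have := div_pos (W.c1.deriv_pos x hx0) (W.pos hx0)
  exact neg_nonpos.2 (mul_nonneg (by linarith) (sq_nonneg _))

theorem nrgT_nonneg (S : Sol c f q T m v) (W : Weight q Hinf linf) (N : Nonlin c b β f)
    {r : ℝ} (hr : T < r) : 0 ≤ nrgT f v r := by
  have h1 : Tendsto (fun t => 2 * primF f (v t)) atTop (𝓝 0) := by
    have h := ((N.hasDerivAt_primF N.zero_mem).continuousAt.tendsto.comp S.lim).const_mul 2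
    rw [Nonlin.primF_zero, mul_zero] at h
    exact h
  refine le_of_tendsto h1 ?_
  filter_upwards [eventually_ge_atTop r] with t ht
  have := S.nrgT_anti W N hr ht
  simp only [nrgT] at this ⊢
  nlinarith [sq_nonneg (deriv v t)]

/-- Once the energy vanishes, the solution vanishes. -/
theorem eq_zero_of_nrgT (S : Sol c f q T m v) (W : Weight q Hinf linf) (N : Nonlin c b β f)
    {r : ℝ} (hr : T < r) (h : nrgT f v r ≤ 0) : ∀ t, r ≤ t → v t = 0 ∧ deriv v t = 0 := by
  have hE : ∀ t, r ≤ t → nrgT f v t = 0 := fun t ht =>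
    le_antisymm ((S.nrgT_anti W N hr ht).trans h) (S.nrgT_nonneg W N (hr.trans_le ht))
  have hd : ∀ t, r < t → deriv v t = 0 := by
    intro t ht
    have h1 : nrgT f v =ᶠ[𝓝 t] fun _ => 0 := by
      filter_upwards [Ioi_mem_nhds ht] with x hx using hE x (le_of_lt hx)
    have h2 := (S.hasDerivAt_nrgT W N (hr.trans ht)).unique
      ((hasDerivAt_const t (0:ℝ)).congr_of_eventuallyEq h1)
    have ht0 := S.pos (hr.trans ht)
    have := div_pos (W.c1.deriv_pos t ht0) (W.pos ht0)
    have h3 : deriv v t ^ 2 = 0 := by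
      have : 2 * (deriv q t / q t) * deriv v t ^ 2 = 0 := by linarith
      rcases mul_eq_zero.1 this with h | h
      · linarith
      · exact h
    exact pow_eq_zero_iff (two_ne_zero) |>.1 h3
  have hconst : ∀ t, r ≤ t → v t = 0 := by
    intro t ht
    have : ∀ x, t ≤ x → v x = v t := by
      intro x hx
      refine constant_of_derivWithin_zero (a := t) (b := x)
        (fun y hy => (S.diff y (hr.trans_le (ht.trans hy.1))).differentiableWithinAt) ?_ x
        (right_mem_Icc.2 hx)
      intro y hy
      rcases eq_or_lt_of_le (ht.trans hy.1) with h | h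
      · -- at the left end the derivative is a limit of vanishing derivatives
        have hc := (S.hasDerivAt_deriv W hr).continuousAt
        have hlim : Tendsto (deriv v) (𝓝[>] r) (𝓝 (deriv v r)) :=
          tendsto_nhdsWithin_of_tendsto_nhds hc
        have h0 : deriv v r = 0 := by
          refine tendsto_nhds_unique hlim (tendsto_const_nhds.congr' ?_)
          filter_upwards [self_mem_nhdsWithin] with z hz using (hd z hz).symm
        rw [← h, (S.diff r hr).derivWithin ((uniqueDiffOn_Icc (by
          linarith [hy.1, hy.2])) r (by rw [h]; exact Ico_subset_Icc_self hy)), h0]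
      · rw [(S.diff y (hr.trans h)).derivWithin ((uniqueDiffOn_Icc (by
          linarith [hy.1, hy.2])) y (Ico_subset_Icc_self hy)), hd y h]
    have h2 : Tendsto v atTop (𝓝 (v t)) := by
      refine tendsto_const_nhds.congr' ?_
      filter_upwards [eventually_ge_atTop t] with x hx using (this x hx).symm
    exact tendsto_nhds_unique h2 S.lim
  intro t ht
  refine ⟨hconst t ht, ?_⟩
  have h1 := hE t ht
  simp only [nrgT, hconst t ht, Nonlin.primF_zero, mul_zero, add_zero] at h1
  exact pow_eq_zero_iff (two_ne_zero) |>.1 h1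

theorem nrgT_pos (S : Sol c f q T m v) (W : Weight q Hinf linf) (N : Nonlin c b β f)
    {r : ℝ} (hr : T < r) (h : deriv v r ≠ 0) : 0 < nrgT f v r := by
  by_contra! hcon
  exact h (S.eq_zero_of_nrgT W N hr hcon r le_rfl).2

/-- The initial level of a nontrivial solution is above `β`. -/
theorem β_lt (S : Sol c f q T m v) (W : Weight q Hinf linf) (N : Nonlin c b β f)
    (hm : 0 < m) : β < m := by
  by_contra! hle
  have hF : primF f m ≤ 0 := N.primF_nonpos (by rwa [abs_of_pos hm])
  have hmd : m ∈ dom c := S.start ▸ S.mem T le_rfl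
  have hlimv : Tendsto v (𝓝[>] T) (𝓝 m) := by
    have := S.cont.mono Ioi_subset_Ici_self
    rwa [ContinuousWithinAt, S.start] at this
  have hlimE : Tendsto (nrgT f v) (𝓝[>] T) (𝓝 (0 ^ 2 + 2 * primF f m)) :=
    (S.deriv_lim.pow 2).add
      (((N.hasDerivAt_primF hmd).continuousAt.tendsto.comp hlimv).const_mul 2)
  have hE : ∀ r, T < r → nrgT f v r ≤ 0 := by
    intro r hr
    have : nrgT f v r ≤ 0 ^ 2 + 2 * primF f m := by
      refine ge_of_tendsto hlimE ?_
      filter_upwards [Ioo_mem_nhdsGT hr] with t ht using S.nrgT_anti W N ht.1 ht.2.le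
    linarith
  have h0 : Tendsto v (𝓝[>] T) (𝓝 0) := by
    refine tendsto_const_nhds.congr' ?_
    filter_upwards [self_mem_nhdsWithin] with r hr
    exact ((S.eq_zero_of_nrgT W N hr (hE r hr) r le_rfl).1).symm
  exact hm.ne (tendsto_nhds_unique h0 hlimv)

/-- A solution starting above `b` falls at first. -/
theorem deriv_neg_start (S : Sol c f q T m v) (W : Weight q Hinf linf) (N : Nonlin c b β f)
    (hm : b < m) : ∃ R > T, ∀ r ∈ Ioo T R, deriv v r < 0 := by
  have hmd : m ∈ dom c := S.start ▸ S.mem T le_rfl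
  have hlimv : Tendsto v (𝓝[>] T) (𝓝 m) := by
    have := S.cont.mono Ioi_subset_Ici_self
    rwa [ContinuousWithinAt, S.start] at this
  obtain ⟨R, hR, hRs⟩ : ∃ R ∈ Ioi T, Ioo T R ⊆ {r | b < v r} :=
    mem_nhdsGT_iff_exists_Ioo_subset.1 (hlimv.eventually_const_lt hm)
  refine ⟨R, hR, fun r hr => ?_⟩
  obtain ⟨t, ht1, ht2⟩ := exists_between hr.1
  have hanti : ∀ x y, T < x → x < y → y < R → q y * deriv v y < q x * deriv v x := by
    intro x y hx hxy hy
    refine strictAntiOn_Icc_of_hasDerivAt (fun z hz => S.eqn z (hx.trans_le hz.1)) ?_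
      (left_mem_Icc.2 hxy.le) (right_mem_Icc.2 hxy.le) hxy
    intro z hz
    have hz1 := hx.trans hz.1
    have : b < v z := hRs ⟨hz1, hz.2.trans hy⟩
    exact neg_lt_zero.2 (mul_pos (W.pos (S.pos hz1)) (N.pos this (S.mem z hz1.le)))
  have h1 : q t * deriv v t ≤ 0 := by
    refine ge_of_tendsto S.flux_lim ?_
    filter_upwards [Ioo_mem_nhdsGT ht1] with x hx
    exact (hanti x t hx.1 hx.2 (ht2.trans hr.2)).le
  have h2 := hanti t r ht1 ht2 hr.2
  have h3 := W.pos (S.pos hr.1)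
  by_contra! hcon
  have := mul_nonneg h3.le hcon
  linarith

/-- Either the solution falls forever or the slope has a first zero, where `f(v) ≤ 0`. -/
theorem first_zero (S : Sol c f q T m v) (W : Weight q Hinf linf) (N : Nonlin c b β f)
    (hm : b < m) {r : ℝ} (hr : T < r) (hd : 0 ≤ deriv v r) :
    ∃ R, T < R ∧ R ≤ r ∧ (∀ t ∈ Ioo T R, deriv v t < 0) ∧ deriv v R = 0 ∧ f (v R) ≤ 0 := by
  obtain ⟨R₀, hR₀, hneg⟩ := S.deriv_neg_start W N hm
  obtain ⟨t₀, ht₀⟩ := exists_between (lt_min hR₀ hr)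
  have ht0 : t₀ ∈ Ioo T R₀ := ⟨ht₀.1, ht₀.2.trans_le (min_le_left _ _)⟩
  have ht0r : t₀ ≤ r := (ht₀.2.trans_le (min_le_right _ _)).le
  have hcomp : IsCompact (Icc t₀ r ∩ deriv v ⁻¹' Ici 0) := by
    refine isCompact_Icc.of_isClosed_subset (ContinuousOn.preimage_isClosed_of_isClosed
      (fun t ht => ?_) isClosed_Icc isClosed_Ici) inter_subset_left
    exact (S.hasDerivAt_deriv W (ht0.1.trans_le ht.1)).continuousAt.continuousWithinAt
  obtain ⟨R, hR, hmin⟩ := hcomp.exists_isLeast ⟨r, ⟨ht0r, le_rfl⟩, hd⟩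
  have hTR : T < R := ht0.1.trans_le hR.1.1
  have hlt : ∀ t ∈ Ioo T R, deriv v t < 0 := by
    intro t ht
    rcases lt_or_ge t t₀ with h | h
    · exact hneg t ⟨ht.1, h.trans ht0.2⟩
    · by_contra! hcon
      exact absurd (hmin ⟨⟨h, ht.2.le.trans hR.1.2⟩, hcon⟩) (not_le.2 ht.2)
  have hc := (S.hasDerivAt_deriv W hTR).continuousAt
  have hzero : deriv v R = 0 := by
    refine le_antisymm ?_ hR.2
    have hlim : Tendsto (deriv v) (𝓝[<] R) (𝓝 (deriv v R)) :=
      tendsto_nhdsWithin_of_tendsto_nhds hc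
    refine le_of_tendsto hlim ?_
    filter_upwards [Ioo_mem_nhdsLT hTR] with t ht using (hlt t ht).le
  refine ⟨R, hTR, hR.1.2, hlt, hzero, ?_⟩
  have h1 := (S.eqn R hTR).tendsto_slope.mono_left
    (nhdsWithin_mono R (show Iio R ⊆ {R}ᶜ from fun x hx => ne_of_lt hx))
  have h2 : 0 ≤ -(q R * f (v R)) := by
    refine ge_of_tendsto h1 ?_
    filter_upwards [Ioo_mem_nhdsLT hTR] with t ht
    rw [slope_def_field, hzero, mul_zero, sub_zero]
    exact div_nonneg_of_nonpos (mul_nonpos_of_nonneg_of_nonpos (W.pos (S.pos ht.1)).le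
      (hlt t ht).le) (sub_nonpos.2 ht.2.le)
  have := W.pos (S.pos hTR)
  by_contra! hcon
  nlinarith

end Sol

/-- The branch of levels `(a, m)` along which a solution falls during the time interval `J`
beginning at `T`. -/
structure Falls (c : EReal) (f q : ℝ → ℝ) (T m : ℝ) (v : ℝ → ℝ) (J : Set ℝ) (a : ℝ)
    (r V : ℝ → ℝ) : Prop where
  branch : Branch c f q r V a m
  starts : StartsAt q r V m T
  mem_J : ∀ s ∈ Ioo a m, r s ∈ J
  v_r : ∀ s ∈ Ioo a m, v (r s) = s
  V_eq : ∀ s ∈ Ioo a m, V s = -(q (r s) * deriv v (r s))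
  v_mem : ∀ t ∈ J, v t ∈ Ioo a m
  r_v : ∀ t ∈ J, r (v t) = t

namespace Sol

variable {c : EReal} {b β Hinf linf : ℝ} {f q v v₁ v₂ : ℝ → ℝ} {T m : ℝ}

theorem strictAntiOn (S : Sol c f q T m v) {J : Set ℝ} (hJc : OrdConnected J)
    (hJT : J ⊆ Ioi T) (hneg : ∀ t ∈ J, deriv v t < 0) : StrictAntiOn v J :=
  strictAntiOn_of_deriv_neg hJc.convex
    (fun t ht => (S.diff t (hJT ht)).continuousAt.continuousWithinAt)
    (fun t ht => hneg t (interior_subset ht))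

/-- A time interval from the start on which `v' < 0` gives a branch; `r` is the inverse of `v`. -/
theorem exists_falls (S : Sol c f q T m v) (W : Weight q Hinf linf) (N : Nonlin c b β f)
    {J : Set ℝ} {a : ℝ} (hJo : IsOpen J) (hJc : OrdConnected J) (hJT : J ⊆ Ioi T)
    (hJl : ∃ R > T, Ioo T R ⊆ J) (hneg : ∀ t ∈ J, deriv v t < 0) (himg : v '' J = Ioo a m) :
    ∃ r V, Falls c f q T m v J a r V := by
  have hanti := S.strictAntiOn hJc hJT hneg
  obtain ⟨r, hr, hrd⟩ := exists_inverse hJo hanti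
    (fun t ht => (S.diff t (hJT ht)).hasDerivAt) (fun t ht => (hneg t ht).ne)
  have hsurj : ∀ s ∈ Ioo a m, ∃ t ∈ J, v t = s := fun s hs => by rwa [← himg] at hs
  have hmaps : ∀ t ∈ J, v t ∈ Ioo a m := fun t ht => himg ▸ mem_image_of_mem v ht
  set V : ℝ → ℝ := fun s => -(q (r s) * deriv v (r s)) with hV
  have hrlim : Tendsto r (𝓝[<] m) (𝓝[>] T) := by
    obtain ⟨R, hR, hRJ⟩ := hJl
    have hRT : T < R := hR
    obtain ⟨t₀, ht₀⟩ := exists_between hRT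
    have ham := hmaps t₀ (hRJ ht₀)
    refine tendsto_nhdsWithin_iff.2 ⟨tendsto_order.2 ⟨fun k hk => ?_, fun k hk => ?_⟩, ?_⟩
    · filter_upwards [Ioo_mem_nhdsLT (ham.1.trans ham.2)] with s hs
      obtain ⟨t, ht, rfl⟩ := hsurj s hs
      rw [hr t ht]
      exact hk.trans (hJT ht)
    · obtain ⟨t₁, h1, h2⟩ := exists_between (lt_min hk hRT)
      have ht1 : t₁ ∈ J := hRJ ⟨h1, h2.trans_le (min_le_right _ _)⟩
      have hv1 := hmaps t₁ ht1
      filter_upwards [Ioo_mem_nhdsLT hv1.2] with s hs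
      obtain ⟨t, ht, rfl⟩ := hsurj s ⟨hv1.1.trans hs.1, hs.2⟩
      rw [hr t ht]
      exact ((hanti.lt_iff_gt ht1 ht).1 hs.1).trans (h2.trans_le (min_le_left _ _))
    · filter_upwards [Ioo_mem_nhdsLT (ham.1.trans ham.2)] with s hs
      obtain ⟨t, ht, rfl⟩ := hsurj s hs
      rw [hr t ht]
      exact hJT ht
  have hslp : ∀ t ∈ J, slp q r V (v t) = -deriv v t := by
    intro t ht
    have := (W.pos (S.pos (hJT ht))).ne'
    simp only [slp, hV, hr t ht]
    field_simp
  refine ⟨r, V, ⟨?_, ?_, ?_, ?_, ?_, ?_⟩, ⟨?_, ?_, ?_⟩, ?_, ?_, fun s _ => rfl, hmaps, hr⟩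
  · intro s hs
    obtain ⟨t, ht, rfl⟩ := hsurj s hs
    exact S.mem t (le_of_lt (hJT ht))
  · intro s hs
    obtain ⟨t, ht, rfl⟩ := hsurj s hs
    rw [hr t ht]; exact S.pos (hJT ht)
  · intro s hs
    obtain ⟨t, ht, rfl⟩ := hsurj s hs
    simp only [hV, hr t ht]
    have := mul_neg_of_pos_of_neg (W.pos (S.pos (hJT ht))) (hneg t ht)
    linarith
  · intro s hs
    obtain ⟨t, ht, rfl⟩ := hsurj s hs
    refine (hrd t ht).congr_deriv ?_
    have := (W.pos (S.pos (hJT ht))).ne'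
    have := (hneg t ht).ne
    simp only [hV, hr t ht]
    field_simp
  · intro s hs
    obtain ⟨t, ht, rfl⟩ := hsurj s hs
    have h1 := S.eqn t (hJT ht)
    rw [← hr t ht] at h1
    have h2 := (h1.comp (v t) (hrd t ht)).neg
    refine HasDerivAt.congr_deriv (f := V) h2 ?_
    have := (W.pos (S.pos (hJT ht))).ne'
    have := (hneg t ht).ne
    simp only [hV, hr t ht]
    field_simp
  · intro s hs
    obtain ⟨t, ht, rfl⟩ := hsurj s hs
    have h1 := S.nrgT_pos W N (hJT ht) (hneg t ht).ne
    have h2 := hslp t ht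
    simp only [slp] at h2
    rw [h2]
    simpa [nrgT] using h1
  · exact tendsto_nhds_of_tendsto_nhdsWithin hrlim
  · simpa [hV] using (S.flux_lim.comp hrlim).neg
  · have h1 : Tendsto (fun s => -deriv v (r s)) (𝓝[<] m) (𝓝 0) := by
      simpa using (S.deriv_lim.comp hrlim).neg
    obtain ⟨R, hR, hRJ⟩ := hJl
    obtain ⟨t₀, ht₀⟩ := exists_between (show T < R from hR)
    have ham := hmaps t₀ (hRJ ht₀)
    refine h1.congr' ?_
    filter_upwards [Ioo_mem_nhdsLT (ham.1.trans ham.2)] with s hs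
    obtain ⟨t, ht, rfl⟩ := hsurj s hs
    rw [hslp t ht, hr t ht]
  · intro s hs
    obtain ⟨t, ht, rfl⟩ := hsurj s hs
    rwa [hr t ht]
  · intro s hs
    obtain ⟨t, ht, rfl⟩ := hsurj s hs
    rw [hr t ht]

/-- A nonnegative solution falls as long as it is positive. -/
theorem deriv_neg_of_pos (S : Sol c f q T m v) (W : Weight q Hinf linf) (N : Nonlin c b β f)
    (hm : b < m) (hv : ∀ t, T ≤ t → 0 ≤ v t) {r : ℝ} (hr : T < r) (hpos : 0 < v r) :
    deriv v r < 0 := by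
  by_contra! hcon
  obtain ⟨R, hTR, hRr, -, hd, hf⟩ := S.first_zero W N hm hr hcon
  have hb := N.le_of_nonpos (S.mem R hTR.le) hf
  have hF : primF f (v R) ≤ 0 := N.primF_nonpos (by
    rw [abs_of_nonneg (hv R hTR.le)]
    exact hb.trans N.c1.b_lt_β.le)
  have := (S.eq_zero_of_nrgT W N hTR (by simp only [nrgT, hd]; linarith) r hRr).1
  linarith

/-- A nonnegative solution is a branch of all levels below the initial one, and its slope
vanishes at the level `0`. -/
theorem falls_of_nonneg (S : Sol c f q T m v) (W : Weight q Hinf linf) (N : Nonlin c b β f)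
    (hm : 0 < m) (hv : ∀ t, T ≤ t → 0 ≤ v t) :
    ∃ r V, Falls c f q T m v {t | T < t ∧ 0 < v t} 0 r V ∧
      Tendsto (slp q r V) (𝓝[>] 0) (𝓝 0) := by
  have hbm : b < m := N.c1.b_lt_β.trans (S.β_lt W N hm)
  set J : Set ℝ := {t | T < t ∧ 0 < v t} with hJ
  have hneg : ∀ t ∈ J, deriv v t < 0 := fun t ht => S.deriv_neg_of_pos W N hbm hv ht.1 ht.2
  have hzero : ∀ t, T < t → v t = 0 → ∀ x, t ≤ x → v x = 0 := by
    intro t ht h0 x hx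
    -- a zero of a nonnegative function is a minimum
    have hmin : IsLocalMin v t := by
      filter_upwards [Ioi_mem_nhds ht] with y hy
      rw [h0]; exact hv y (le_of_lt hy)
    refine (S.eq_zero_of_nrgT W N ht ?_ x hx).1
    simp [nrgT, hmin.deriv_eq_zero, h0, Nonlin.primF_zero]
  have hdown : ∀ t ∈ J, Ioc T t ⊆ J := by
    intro t ht x hx
    refine ⟨hx.1, lt_of_le_of_ne (hv x hx.1.le) fun h => ?_⟩
    exact ht.2.ne' (hzero x hx.1 h.symm t hx.2)
  have hJo : IsOpen J := by
    rw [isOpen_iff_mem_nhds]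
    intro t ht
    exact inter_mem (Ioi_mem_nhds ht.1)
      ((S.diff t ht.1).continuousAt.eventually_const_lt ht.2)
  have hJc : OrdConnected J := ⟨fun x hx y hy z hz => hdown y hy ⟨hx.1.trans_le hz.1, hz.2⟩⟩
  have hlimv : Tendsto v (𝓝[>] T) (𝓝 m) := by
    have := S.cont.mono Ioi_subset_Ici_self
    rwa [ContinuousWithinAt, S.start] at this
  have hJl : ∃ R > T, Ioo T R ⊆ J := by
    obtain ⟨R, hR, hRs⟩ : ∃ R ∈ Ioi T, Ioo T R ⊆ {r | 0 < v r} :=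
      mem_nhdsGT_iff_exists_Ioo_subset.1 (hlimv.eventually_const_lt hm)
    exact ⟨R, hR, fun t ht => ⟨ht.1, hRs ht⟩⟩
  have hanti := S.strictAntiOn hJc (fun t ht => ht.1) hneg
  have hlt : ∀ t ∈ J, v t < m := by
    intro t ht
    obtain ⟨x, hx⟩ := exists_between ht.1
    have h1 := hanti (hdown t ht ⟨hx.1, hx.2.le⟩) ht hx.2
    refine h1.trans_le (ge_of_tendsto hlimv ?_)
    filter_upwards [Ioo_mem_nhdsGT hx.1] with y hy
    exact (hanti (hdown t ht ⟨hy.1, (hy.2.trans hx.2).le⟩)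
      (hdown t ht ⟨hx.1, hx.2.le⟩) hy.2).le
  have himg : v '' J = Ioo 0 m := by
    ext s
    constructor
    · rintro ⟨t, ht, rfl⟩
      exact ⟨ht.2, hlt t ht⟩
    · intro hs
      obtain ⟨t₁, ht₁, hT₁⟩ : ∃ t, v t < s ∧ T < t :=
        ((S.lim.eventually_lt_const hs.1).and (eventually_gt_atTop T)).exists
      obtain ⟨x, hx, rfl⟩ := intermediate_value_Icc' hT₁.le
        (S.continuousOn.mono Icc_subset_Ici_self) ⟨ht₁.le, by rw [S.start]; exact hs.2.le⟩
      refine ⟨x, ⟨lt_of_le_of_ne hx.1 ?_, hs.1⟩, rfl⟩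
      rintro rfl
      exact hs.2.ne S.start
  obtain ⟨r, V, hF⟩ := S.exists_falls W N hJo hJc (fun t ht => ht.1) hJl hneg himg
  refine ⟨r, V, hF, ?_⟩
  have hslp : ∀ s ∈ Ioo 0 m, slp q r V s = -deriv v (r s) := by
    intro s hs
    have := (hF.branch.q_pos W hs).ne'
    simp only [slp, hF.V_eq s hs]
    field_simp
  -- the energy has limit `0` along the branch, as otherwise the slope would stay away from `0`
  have hEmono : ∀ s t, 0 < s → s ≤ t → t < m → nrg f q r V s ≤ nrg f q r V t := by
    intro s t hs hst ht
    refine monotoneOn_Icc_of_hasDerivAt (fun x hx => hF.branch.hasDerivAt_nrg W N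
      ⟨hs.trans_le hx.1, hx.2.trans_lt ht⟩) ?_ (left_mem_Icc.2 hst) (right_mem_Icc.2 hst) hst
    intro x hx
    have hx' : x ∈ Ioo 0 m := ⟨hs.trans hx.1, hx.2.trans ht⟩
    have := hF.branch.slp_pos W hx'
    have := div_pos (W.c1.deriv_pos _ (hF.branch.r_pos x hx')) (hF.branch.q_pos W hx')
    positivity
  have hF0 : Tendsto (fun s => 2 * primF f s) (𝓝[>] 0) (𝓝 0) := by
    have h := ((N.hasDerivAt_primF N.zero_mem).continuousAt.tendsto).const_mul 2
    rw [Nonlin.primF_zero, mul_zero] at h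
    exact tendsto_nhdsWithin_of_tendsto_nhds h
  have hEsmall : ∀ e > 0, ∃ s ∈ Ioo 0 m, nrg f q r V s < e := by
    intro e he
    by_contra! hcon
    by_cases hz : ∃ R, T < R ∧ v R = 0
    · -- the solution reaches `0` in finite time, with vanishing energy
      obtain ⟨R, hTR, hvR⟩ := hz
      set R' := sInf {t | T < t ∧ v t = 0} with hR'
      have hne : {t | T < t ∧ v t = 0}.Nonempty := ⟨R, hTR, hvR⟩
      obtain ⟨R₀, hR₀, hR₀J⟩ := hJl
      have hbd : ∀ t ∈ {t | T < t ∧ v t = 0}, R₀ ≤ t := by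
        intro t ht
        by_contra! h
        exact (hR₀J ⟨ht.1, h⟩).2.ne' ht.2
      have hTR' : T < R' := lt_of_lt_of_le hR₀ (le_csInf hne hbd)
      have hcl : R' ∈ {t | T < t ∧ v t = 0} := by
        have h1 := csInf_mem_closure hne ⟨R₀, hbd⟩
        refine ⟨hTR', ?_⟩
        by_contra h
        have h2 := (S.diff R' hTR').continuousAt.eventually_ne h
        obtain ⟨x, hx1, hx2⟩ := ((mem_closure_iff_frequently.1 h1).and_eventually h2).exists
        exact hx2 hx1.2
      have hmin : IsLocalMin v R' := by
        filter_upwards [Ioi_mem_nhds hTR'] with y hy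
        rw [hcl.2]; exact hv y (le_of_lt hy)
      have hE0 : nrgT f v R' = 0 := by
        simp [nrgT, hmin.deriv_eq_zero, hcl.2, Nonlin.primF_zero]
      have hc := (S.hasDerivAt_nrgT W N hTR').continuousAt
      have hev : ∀ᶠ t in 𝓝[<] R', nrgT f v t < e := by
        have : Tendsto (nrgT f v) (𝓝[<] R') (𝓝 0) :=
          hE0 ▸ tendsto_nhdsWithin_of_tendsto_nhds hc
        exact this.eventually_lt_const he
      obtain ⟨t, ht1, ht2⟩ := (hev.and (Ioo_mem_nhdsLT hTR')).exists
      have htJ : t ∈ J := ⟨ht2.1, lt_of_le_of_ne (hv t ht2.1.le) fun h =>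
        absurd (csInf_le ⟨R₀, hbd⟩ (show t ∈ {t | T < t ∧ v t = 0} from ⟨ht2.1, h.symm⟩))
          (not_le.2 ht2.2)⟩
      have h3 := hcon (v t) (hF.v_mem t htJ)
      simp only [nrg, hslp _ (hF.v_mem t htJ), hF.r_v t htJ] at h3
      simp only [nrgT] at ht1
      nlinarith
    · -- otherwise the slope stays negative for all times
      push Not at hz
      have hallJ : ∀ t, T < t → t ∈ J := fun t ht =>
        ⟨ht, lt_of_le_of_ne (hv t ht.le) (hz t ht).symm⟩
      have hFv : ∀ᶠ t in atTop, 2 * primF f (v t) < e / 2 := by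
        have h := ((N.hasDerivAt_primF N.zero_mem).continuousAt.tendsto.comp S.lim).const_mul 2
        rw [Nonlin.primF_zero, mul_zero] at h
        exact h.eventually_lt_const (half_pos he)
      obtain ⟨A, hA⟩ := eventually_atTop.1 (hFv.and (eventually_gt_atTop T))
      set k := √(e / 2) with hk
      have hk0 : 0 < k := Real.sqrt_pos.2 (half_pos he)
      have hdv : ∀ t, A ≤ t → deriv v t < -k := by
        intro t ht
        obtain ⟨h1, h2⟩ := hA t ht
        have hJt := hallJ t h2
        have h3 := hcon (v t) (hF.v_mem t hJt)
        simp only [nrg, hslp _ (hF.v_mem t hJt), hF.r_v t hJt] at h3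
        have h4 := hneg t hJt
        have h5 : k ^ 2 = e / 2 := Real.sq_sqrt (half_pos he).le
        have h6 : k ^ 2 < (-deriv v t) ^ 2 := by linarith
        have := lt_of_pow_lt_pow_left₀ 2 (by linarith) h6
        linarith
      have hA0 := hA A le_rfl
      have hlow : ∀ t, A ≤ t → v t + k * t ≤ v A + k * A := by
        intro t ht
        refine antitoneOn_Icc_of_hasDerivAt (fun x hx => (S.diff x
          (hA0.2.trans_le hx.1)).hasDerivAt.add ((hasDerivAt_id x).const_mul k)) ?_
          (left_mem_Icc.2 ht) (right_mem_Icc.2 ht) ht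
        intro x hx
        have := hdv x hx.1.le
        linarith
      have h1 := hlow (A + (v A + 1) / k) (by
        have := (hallJ A hA0.2).2
        have : 0 < (v A + 1) / k := by positivity
        linarith)
      have h2 := (hallJ (A + (v A + 1) / k) (by
        have := (hallJ A hA0.2).2
        have : 0 < (v A + 1) / k := by positivity
        linarith [hA0.2])).2
      have h3 : k * (A + (v A + 1) / k) = k * A + v A + 1 := by field_simp; ring
      linarith
  have hElim : Tendsto (nrg f q r V) (𝓝[>] 0) (𝓝 0) := by
    refine tendsto_order.2 ⟨fun k hk => ?_, fun k hk => ?_⟩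
    · filter_upwards [Ioo_mem_nhdsGT hm] with s hs using hk.trans (hF.branch.nrg_pos hs)
    · obtain ⟨s, hs, hsk⟩ := hEsmall k hk
      filter_upwards [Ioo_mem_nhdsGT hs.1] with x hx
      exact (hEmono x s hx.1 hx.2.le hs.2).trans_lt hsk
  have hsq : Tendsto (fun s => √(slp q r V s ^ 2)) (𝓝[>] 0) (𝓝 0) := by
    have h1 : Tendsto (fun s => nrg f q r V s - 2 * primF f s) (𝓝[>] 0) (𝓝 (0 - 0)) :=
      hElim.sub hF0
    have h2 := h1.sqrt
    rw [sub_zero, Real.sqrt_zero] at h2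
    refine h2.congr fun s => ?_
    simp only [nrg]
    congr 1; ring
  refine hsq.congr' ?_
  filter_upwards [Ioo_mem_nhdsGT hm] with s hs
  exact Real.sqrt_sq (hF.branch.slp_pos W hs).le

end Sol

/-- A solution with one sign change: it falls from the level `α` through `0` to the level `-M`,
reached at the time `R`, and `-u` is nonnegative from then on. -/
structure FallsToMin (c : EReal) (f q : ℝ → ℝ) (α : ℝ) (u : ℝ → ℝ) (R M : ℝ)
    (r V : ℝ → ℝ) : Prop where
  R_pos : 0 < R
  falls : Falls c f q 0 α u (Ioo 0 R) (-M) r V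
  slp_lim : Tendsto (slp q r V) (𝓝[>] (-M)) (𝓝 0)
  V_lim : Tendsto V (𝓝[>] (-M)) (𝓝 0)
  r_lim : Tendsto r (𝓝[>] (-M)) (𝓝 R)
  sol : Sol c f q R M (fun t => -u t)
  nonneg : ∀ t, R ≤ t → 0 ≤ -u t

namespace Sol

variable {c : EReal} {b β Hinf linf : ℝ} {f q u v v₁ v₂ : ℝ → ℝ} {T m α : ℝ}

/-- As `f` is odd, `-v` restarts as a solution at a time at which the slope vanishes. -/
theorem neg_of_deriv_eq_zero (S : Sol c f q T m v) (W : Weight q Hinf linf)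
    (N : Nonlin c b β f) {R : ℝ} (hR : T < R) (hd : deriv v R = 0) :
    Sol c f q R (-v R) (fun t => -v t) := by
  have hder : deriv (fun t => -v t) = fun t => -deriv v t := by
    funext t; exact deriv.fun_neg
  refine ⟨S.T_nonneg.trans hR.le, fun r hr => neg_mem_dom (S.mem r (hR.le.trans hr)), rfl,
    (S.diff R hR).continuousAt.neg.continuousWithinAt, fun r hr => (S.diff r (hR.trans hr)).neg,
    ?_, ?_, ?_, ?_⟩
  · intro r hr
    have h := (S.eqn r (hR.trans hr)).neg
    rw [hder, N.odd (S.mem r (hR.trans hr).le)]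
    refine (h.congr_of_eventuallyEq (Eventually.of_forall fun t => ?_)).congr_deriv (by ring)
    exact mul_neg _ _
  · have h : Tendsto (fun t => -(q t * deriv v t)) (𝓝 R) (𝓝 (-(q R * deriv v R))) :=
      (S.eqn R hR).continuousAt.neg.tendsto
    simp only [hd, mul_zero, neg_zero] at h
    rw [hder]
    exact (tendsto_nhdsWithin_of_tendsto_nhds h).congr fun t => (mul_neg _ _).symm
  · have h : Tendsto (fun t => -deriv v t) (𝓝 R) (𝓝 (-deriv v R)) :=
      (S.hasDerivAt_deriv W hR).continuousAt.neg.tendsto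
    simp only [hd, neg_zero] at h
    rw [hder]
    exact tendsto_nhdsWithin_of_tendsto_nhds h
  · simpa using S.lim.neg

/-- The falling part of a solution with one sign change ends at a minimum below `-β`, since the
energy is positive there. -/
theorem exists_fallsToMin (S : Sol c f q 0 α u) (W : Weight q Hinf linf) (N : Nonlin c b β f)
    (hα : 0 < α) (hsc : ExactlyOneSignChange u) :
    ∃ R M r V, β < M ∧ FallsToMin c f q α u R M r V := by
  have hbα : b < α := N.c1.b_lt_β.trans (S.β_lt W N hα)
  obtain ⟨⟨r₀, r₁, hr0, hr01, hsign⟩, hno⟩ := hsc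
  -- the solution is not nonnegative, so its slope vanishes somewhere
  have hnonneg : ¬ ∀ t, 0 < t → 0 ≤ u t := by
    intro h
    have := mul_nonneg (h r₀ hr0) (h r₁ (hr0.trans hr01))
    linarith
  have hex : ∃ t, 0 < t ∧ 0 ≤ deriv u t := by
    by_contra! hcon
    apply hnonneg
    have hanti : StrictAntiOn u (Ioi 0) :=
      S.strictAntiOn ordConnected_Ioi Subset.rfl (fun t ht => hcon t ht)
    intro t ht
    refine le_of_tendsto S.lim ?_
    filter_upwards [eventually_gt_atTop t] with x hx
    exact (hanti ht (lt_trans ht hx) hx).le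
  obtain ⟨t, ht, htd⟩ := hex
  obtain ⟨R, hR, -, hneg, hdR, hfR⟩ := S.first_zero W N hbα ht htd
  have hanti : StrictAntiOn u (Icc 0 R) := by
    refine strictAntiOn_of_deriv_neg (convex_Icc 0 R)
      (S.continuousOn.mono Icc_subset_Ici_self) fun x hx => ?_
    rw [interior_Icc] at hx
    exact hneg x hx
  have huR : u R < 0 := by
    by_contra! hcon
    have hb := N.le_of_nonpos (S.mem R hR.le) hfR
    have hF : primF f (u R) ≤ 0 := N.primF_nonpos (by
      rw [abs_of_nonneg hcon]
      exact hb.trans N.c1.b_lt_β.le)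
    have h0 := S.eq_zero_of_nrgT W N hR (by simp only [nrgT, hdR]; linarith)
    apply hnonneg
    intro t ht
    rcases le_or_gt R t with h | h
    · rw [(h0 t h).1]
    · exact hcon.trans (hanti ⟨ht.le, h.le⟩ (right_mem_Icc.2 hR.le) h).le
  set M := -u R with hM
  have hS := S.neg_of_deriv_eq_zero W N hR hdR
  have hβM : β < M := hS.β_lt W N (by linarith)
  have hsub : Ioo 0 R ⊆ Icc 0 R := Ioo_subset_Icc_self
  have himg : u '' Ioo 0 R = Ioo (-M) α := by
    have e1 : -M = u R := by rw [hM, neg_neg]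
    rw [e1, ← S.start]
    refine Subset.antisymm ?_
      (intermediate_value_Ioo' hR.le (S.continuousOn.mono Icc_subset_Ici_self))
    rintro _ ⟨t, ht, rfl⟩
    exact ⟨hanti (hsub ht) (right_mem_Icc.2 hR.le) ht.2,
      hanti (left_mem_Icc.2 hR.le) (hsub ht) ht.1⟩
  obtain ⟨r, V, hF⟩ := S.exists_falls W N isOpen_Ioo ordConnected_Ioo (fun t ht => ht.1)
    ⟨R, hR, Subset.rfl⟩ hneg himg
  have hrlim : Tendsto r (𝓝[>] (-M)) (𝓝[<] R) := by
    have hMα : -M < α := by linarith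
    refine tendsto_nhdsWithin_iff.2 ⟨tendsto_order.2 ⟨fun k hk => ?_, fun k hk => ?_⟩, ?_⟩
    · obtain ⟨t₁, h1, h2⟩ := exists_between (max_lt hk hR)
      have ht1 : t₁ ∈ Ioo 0 R := ⟨(le_max_right _ _).trans_lt h1, h2⟩
      have hv1 := hF.v_mem t₁ ht1
      filter_upwards [Ioo_mem_nhdsGT hv1.1] with s hs
      have hs' : s ∈ Ioo (-M) α := ⟨hs.1, hs.2.trans hv1.2⟩
      have h3 := hs.2
      rw [← hF.v_r s hs'] at h3
      exact (le_max_left _ _).trans_lt (h1.trans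
        ((hanti.lt_iff_gt (hsub (hF.mem_J s hs')) (hsub ht1)).1 h3))
    · filter_upwards [Ioo_mem_nhdsGT hMα] with s hs using (hF.mem_J s hs).2.trans hk
    · filter_upwards [Ioo_mem_nhdsGT hMα] with s hs using (hF.mem_J s hs).2
  have hrlim' := tendsto_nhds_of_tendsto_nhdsWithin hrlim
  refine ⟨R, M, r, V, hβM, hR, hF, ?_, ?_, hrlim', hS, ?_⟩
  · have h := ((S.hasDerivAt_deriv W hR).continuousAt.tendsto.comp hrlim').neg
    rw [hdR, neg_zero] at h
    refine h.congr' ?_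
    filter_upwards [Ioo_mem_nhdsGT (show -M < α by linarith)] with s hs
    have := (hF.branch.q_pos W hs).ne'
    simp only [slp, hF.V_eq s hs, Function.comp]
    field_simp
  · have h := ((S.eqn R hR).continuousAt.tendsto.comp hrlim').neg
    rw [hdR, mul_zero, neg_zero] at h
    refine h.congr' ?_
    filter_upwards [Ioo_mem_nhdsGT (show -M < α by linarith)] with s hs
    rw [hF.V_eq s hs, Function.comp]
  · intro t ht
    by_contra! hcon
    have ht' : R < t := lt_of_le_of_ne ht (by rintro rfl; linarith)
    obtain ⟨s, hs⟩ := exists_between (show (0:ℝ) < α from hα)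
    have hs' : s ∈ Ioo (-M) α := ⟨by linarith [hs.1], hs.2⟩
    have hJ := hF.mem_J s hs'
    apply hno
    refine ⟨r s, R, t, hJ.1, hJ.2, ht', ?_, ?_⟩
    · rw [hF.v_r s hs']; exact mul_neg_of_pos_of_neg hs.1 huR
    · exact mul_neg_of_neg_of_pos huR (by linarith)

/-- Uniqueness near the start, by a contraction estimate for the integrated equation: `q` may
vanish at `T`, so the standard theory of differential equations does not apply. -/
theorem eqOn_start (S₁ : Sol c f q T m v₁) (S₂ : Sol c f q T m v₂) (W : Weight q Hinf linf)
    (N : Nonlin c b β f) (hm : 0 < m) : ∃ R > T, ∀ t ∈ Icc T R, v₁ t = v₂ t := by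
  have hmd : m ∈ dom c := S₁.start ▸ S₁.mem T le_rfl
  obtain ⟨K, U, hU, hL⟩ := N.exists_lipschitz hm hmd
  have hev : ∀ {v : ℝ → ℝ}, Sol c f q T m v → ∃ R > T, ∀ t ∈ Ico T R, v t ∈ U := by
    intro v S
    have h := S.cont
    rw [ContinuousWithinAt, S.start] at h
    obtain ⟨R, hR, hRs⟩ : ∃ R ∈ Ioi T, Ico T R ⊆ v ⁻¹' U :=
      mem_nhdsGE_iff_exists_Ico_subset.1 (h hU)
    exact ⟨R, hR, fun t ht => hRs ht⟩
  obtain ⟨R₁, hR₁, hU₁⟩ := hev S₁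
  obtain ⟨R₂, hR₂, hU₂⟩ := hev S₂
  set δ : ℝ := min (min ((R₁ - T) / 2) ((R₂ - T) / 2)) (1 / (K + 1)) with hδ
  have hK : (0:ℝ) < K + 1 := by positivity
  have hδ0 : 0 < δ := lt_min (lt_min (by linarith) (by linarith)) (by positivity)
  have hδ1 : δ ≤ (R₁ - T) / 2 := (min_le_left _ _).trans (min_le_left _ _)
  have hδ2 : δ ≤ (R₂ - T) / 2 := (min_le_left _ _).trans (min_le_right _ _)
  have hδ3 : δ * (K + 1) ≤ 1 := by
    rw [← le_div_iff₀ hK]; exact min_le_right _ _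
  have hδ4 : δ ≤ 1 := by
    have : (0:ℝ) ≤ K := K.coe_nonneg
    nlinarith
  set R := T + δ with hR
  have hTR : T ≤ R := by linarith
  have hUU : ∀ t ∈ Icc T R, v₁ t ∈ U ∧ v₂ t ∈ U := fun t ht =>
    ⟨hU₁ t ⟨ht.1, by linarith [ht.2]⟩, hU₂ t ⟨ht.1, by linarith [ht.2]⟩⟩
  -- the maximum `A` of `|v₁ - v₂|` satisfies `A ≤ K δ² A`
  obtain ⟨x, hx, hmax⟩ := isCompact_Icc.exists_isMaxOn (nonempty_Icc.2 hTR)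
    (((S₁.continuousOn.mono Icc_subset_Ici_self).sub
      (S₂.continuousOn.mono Icc_subset_Ici_self)).abs)
  set A := |v₁ x - v₂ x| with hA
  have hAmax : ∀ t ∈ Icc T R, |v₁ t - v₂ t| ≤ A := fun t ht => hmax ht
  have hA0 : 0 ≤ A := abs_nonneg _
  have hff : ∀ t ∈ Icc T R, |f (v₁ t) - f (v₂ t)| ≤ K * A := by
    intro t ht
    have h := hL.dist_le_mul _ (hUU t ht).1 _ (hUU t ht).2
    rw [Real.dist_eq, Real.dist_eq] at h
    exact h.trans (mul_le_mul_of_nonneg_left (hAmax t ht) K.coe_nonneg)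
  have hflux : ∀ t ∈ Ioc T R, |q t * deriv v₁ t - q t * deriv v₂ t| ≤ K * A * (t - T) * q t := by
    -- the function `σ q (v₁ - v₂)'` grows at most like `K A q (t) (· - T)`
    have key : ∀ σ : ℝ, |σ| = 1 → ∀ t ∈ Ioc T R,
        σ * (q t * deriv v₁ t - q t * deriv v₂ t) ≤ K * A * (t - T) * q t := by
      intro σ hσ t ht
      have hlim : Tendsto (fun s => σ * (q s * deriv v₁ s - q s * deriv v₂ s) + K * A * q t * (t - s))
          (𝓝[>] T) (𝓝 (σ * (0 - 0) + K * A * q t * (t - T))) :=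
        ((S₁.flux_lim.sub S₂.flux_lim).const_mul σ).add
          ((tendsto_const_nhds.sub (tendsto_nhdsWithin_of_tendsto_nhds tendsto_id)).const_mul _)
      have h1 : σ * (q t * deriv v₁ t - q t * deriv v₂ t) ≤
          σ * (0 - 0) + K * A * q t * (t - T) := by
        refine ge_of_tendsto hlim ?_
        filter_upwards [Ioo_mem_nhdsGT ht.1] with s hs
        have hanti := antitoneOn_Icc_of_hasDerivAt (x := s) (y := t)
          (fun y hy => (((S₁.eqn y (hs.1.trans_le hy.1)).sub
            (S₂.eqn y (hs.1.trans_le hy.1))).const_mul σ).add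
              (((hasDerivAt_id y).const_sub t).const_mul (K * A * q t))) (fun y hy => by
            have hy0 := hs.1.trans hy.1
            have hyR : y ∈ Icc T R := ⟨hy0.le, hy.2.le.trans ht.2⟩
            have h2 := hff y hyR
            have h3 : -(σ * (f (v₁ y) - f (v₂ y))) ≤ K * A := by
              have h4 := neg_abs_le (σ * (f (v₁ y) - f (v₂ y)))
              rw [abs_mul, hσ, one_mul] at h4
              linarith
            have h5 := W.le (S₁.pos hy0).le hy.2.le
            have h6 := W.pos (S₁.pos hy0)
            have h7 := mul_le_mul_of_nonneg_left h3 h6.le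
            have h8 := mul_le_mul_of_nonneg_right h5 (mul_nonneg K.coe_nonneg hA0)
            linarith)
          (left_mem_Icc.2 hs.2.le) (right_mem_Icc.2 hs.2.le) hs.2.le
        simp only [Pi.add_apply, Pi.sub_apply, id, sub_self, mul_zero, add_zero] at hanti
        linarith
      linarith
    intro t ht
    refine abs_le.2 ⟨?_, ?_⟩
    · have := key (-1) (by simp) t ht
      linarith
    · have := key 1 (by simp) t ht
      linarith
  have hder : ∀ t ∈ Ioc T R, |deriv v₁ t - deriv v₂ t| ≤ K * A * δ := by
    intro t ht
    have h1 := hflux t ht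
    have h2 := W.pos (S₁.pos ht.1)
    rw [← mul_sub, abs_mul, abs_of_pos h2] at h1
    have h3 : |deriv v₁ t - deriv v₂ t| ≤ K * A * (t - T) := by
      refine le_of_mul_le_mul_left ?_ h2
      linarith
    refine h3.trans (mul_le_mul_of_nonneg_left (by linarith [ht.2]) (mul_nonneg K.coe_nonneg hA0))
  have hAA : A ≤ K * A * δ * δ := by
    rcases hx.1.eq_or_lt with h | h
    · have : A = 0 := by rw [hA, ← h, S₁.start, S₂.start]; simp
      rw [this]; simp
    · obtain ⟨y, hy, hye⟩ := exists_deriv_eq_slope (fun t => v₁ t - v₂ t) h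
        ((S₁.continuousOn.mono Icc_subset_Ici_self).sub
          (S₂.continuousOn.mono Icc_subset_Ici_self))
        (fun y hy => ((S₁.diff y hy.1).sub (S₂.diff y hy.1)).differentiableWithinAt)
      rw [deriv_fun_sub (S₁.diff y hy.1) (S₂.diff y hy.1),
        eq_div_iff (by linarith), S₁.start, S₂.start, sub_self, sub_zero] at hye
      have e : A = |deriv v₁ y - deriv v₂ y| * (x - T) := by
        rw [hA, ← hye, abs_mul, abs_of_pos (sub_pos.2 h)]
      refine e.trans_le ?_
      exact mul_le_mul (hder y ⟨hy.1, hy.2.le.trans hx.2⟩) (by linarith [hx.2])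
        (sub_pos.2 h).le (mul_nonneg (mul_nonneg K.coe_nonneg hA0) hδ0.le)
  have hAz : A = 0 := by
    have hKn : (0:ℝ) ≤ K := K.coe_nonneg
    have h1 : (K:ℝ) * δ * δ < 1 := by
      have : (K:ℝ) * δ < 1 := by nlinarith
      have : 0 ≤ (K:ℝ) * δ := mul_nonneg hKn hδ0.le
      nlinarith
    nlinarith
  refine ⟨R, by linarith, fun t ht => ?_⟩
  have := hAmax t ht
  rw [hAz] at this
  exact sub_eq_zero.1 (abs_nonpos_iff.1 this)

/-- In the sublinear case `(v₁ - b) / (v₂ - b)` does not increase while `v₁ ≤ v₂`. -/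
theorem false_of_meet {m₁ m₂ : ℝ} (S₁ : Sol c f q T m₁ v₁) (S₂ : Sol c f q T m₂ v₂)
    (W : Weight q Hinf linf) (N : Nonlin c b β f) (h5 : CondF5 c b f)
    {R : ℝ} (hR : T < R) (hvb : ∀ t ∈ Ioc T R, b < v₁ t)
    (hlt : ∀ t ∈ Ioo T R, v₁ t < v₂ t) (heq : v₁ R = v₂ R) : False := by
  have hvb2 : ∀ t ∈ Ioc T R, b < v₂ t := by
    intro t ht
    rcases ht.2.eq_or_lt with h | h
    · rw [h, ← heq]; exact hvb R ⟨hR, le_rfl⟩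
    · exact (hvb t ht).trans (hlt t ⟨ht.1, h⟩)
  -- `f(s) / (s - b)` is nonincreasing
  have hfs : ∀ s t, b < s → s ≤ t → t ∈ dom c → f t * (s - b) ≤ f s * (t - b) := by
    intro s t hs hst ht
    have hmem : ∀ x ∈ Icc s t, x ∈ dom c := fun x hx => by
      refine mem_dom_of_abs_le ht ?_
      have := N.c1.b_pos
      rw [abs_of_pos (by linarith [hx.1]), abs_of_pos (by linarith)]
      exact hx.2
    have hb0 := N.c1.b_pos
    have h := antitoneOn_Icc_of_hasDerivAt (x := s) (y := t)
      (fun x hx => (N.hasDerivAt (by linarith [hx.1]) (hmem x hx)).div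
        ((hasDerivAt_id x).sub_const b) (by simp only [id]; linarith [hx.1])) (fun x hx => by
        have h1 := h5 x (by linarith [hx.1]) (lt_of_mem_dom (hmem x (Ioo_subset_Icc_self hx)))
        refine div_nonpos_of_nonpos_of_nonneg ?_ (sq_nonneg _)
        simp only [id]
        linarith)
      (left_mem_Icc.2 hst) (right_mem_Icc.2 hst) hst
    simp only [Pi.div_apply, id] at h
    rw [div_le_div_iff₀ (by linarith) (by linarith)] at h
    exact h
  set Y : ℝ → ℝ := fun t => q t * deriv v₁ t * (v₂ t - b) - q t * deriv v₂ t * (v₁ t - b) with hY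
  have hYd : ∀ t, T < t → HasDerivAt Y (-(q t * f (v₁ t)) * (v₂ t - b) +
      q t * deriv v₁ t * deriv v₂ t - (-(q t * f (v₂ t)) * (v₁ t - b) +
      q t * deriv v₂ t * deriv v₁ t)) t := fun t ht =>
    ((S₁.eqn t ht).mul ((S₂.diff t ht).hasDerivAt.sub_const b)).sub
      ((S₂.eqn t ht).mul ((S₁.diff t ht).hasDerivAt.sub_const b))
  have hlimv : ∀ {v : ℝ → ℝ} {m : ℝ}, Sol c f q T m v → Tendsto v (𝓝[>] T) (𝓝 m) := by
    intro v m S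
    have := S.cont.mono Ioi_subset_Ici_self
    rwa [ContinuousWithinAt, S.start] at this
  have hYlim : Tendsto Y (𝓝[>] T) (𝓝 (0 * (m₂ - b) - 0 * (m₁ - b))) :=
    (S₁.flux_lim.mul ((hlimv S₂).sub_const b)).sub (S₂.flux_lim.mul ((hlimv S₁).sub_const b))
  have hYle : ∀ t ∈ Ioo T R, Y t ≤ 0 := by
    intro t ht
    have : Y t ≤ 0 * (m₂ - b) - 0 * (m₁ - b) := by
      refine ge_of_tendsto hYlim ?_
      filter_upwards [Ioo_mem_nhdsGT ht.1] with x hx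
      refine antitoneOn_Icc_of_hasDerivAt (fun y hy => hYd y (hx.1.trans_le hy.1)) ?_
        (left_mem_Icc.2 hx.2.le) (right_mem_Icc.2 hx.2.le) hx.2.le
      intro y hy
      have hy1 : y ∈ Ioo T R := ⟨hx.1.trans hy.1, hy.2.trans ht.2⟩
      have h1 := hfs (v₁ y) (v₂ y) (hvb y ⟨hy1.1, hy1.2.le⟩) (hlt y hy1).le (S₂.mem y hy1.1.le)
      have h2 := mul_le_mul_of_nonneg_left h1 (W.pos (S₁.pos hy1.1)).le
      linarith
    linarith
  have hratio : ∀ t ∈ Ioo T R, 1 ≤ (v₁ t - b) / (v₂ t - b) := by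
    intro t ht
    have hd : ∀ y ∈ Icc t R, HasDerivAt (fun y => (v₁ y - b) / (v₂ y - b))
        ((deriv v₁ y * (v₂ y - b) - (v₁ y - b) * deriv v₂ y) / (v₂ y - b) ^ 2) y := fun y hy =>
      ((S₁.diff y (ht.1.trans_le hy.1)).hasDerivAt.sub_const b).div
        ((S₂.diff y (ht.1.trans_le hy.1)).hasDerivAt.sub_const b)
        (sub_pos.2 (hvb2 y ⟨ht.1.trans_le hy.1, hy.2⟩)).ne'
    have h := antitoneOn_Icc_of_hasDerivAt hd (fun y hy => by
      have hy1 : y ∈ Ioo T R := ⟨ht.1.trans hy.1, hy.2⟩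
      refine div_nonpos_of_nonpos_of_nonneg ?_ (sq_nonneg _)
      have h1 := hYle y hy1
      have h2 := W.pos (S₁.pos hy1.1)
      have h3 : Y y = q y * (deriv v₁ y * (v₂ y - b) - (v₁ y - b) * deriv v₂ y) := by
        simp only [hY]; ring
      by_contra! hcon
      have := mul_pos h2 hcon
      linarith)
      (left_mem_Icc.2 ht.2.le) (right_mem_Icc.2 ht.2.le) ht.2.le
    have h0 : (v₁ R - b) / (v₂ R - b) = 1 := by
      rw [heq, div_self]
      exact (sub_pos.2 (hvb2 R ⟨hR, le_rfl⟩)).ne'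
    simp only [h0] at h
    exact h
  obtain ⟨t, ht⟩ := exists_between hR
  have h1 := hratio t ht
  rw [le_div_iff₀ (sub_pos.2 (hvb2 t ⟨ht.1, ht.2.le⟩))] at h1
  linarith [hlt t ht]

end Sol

/-! ### The first crossing -/

namespace Branch

variable {c : EReal} {b β Hinf linf : ℝ} {f q : ℝ → ℝ} {r V r₁ V₁ r₂ V₂ : ℝ → ℝ}
  {a d α₁ α₂ : ℝ}

/-- Below a level at which the first branch is early and flatter, either this persists, or the
two branches cross transversally. -/
theorem first_crossing (B₁ : Branch c f q r₁ V₁ a d) (B₂ : Branch c f q r₂ V₂ a d)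
    (W : Weight q Hinf linf) (N : Nonlin c b β f) {s₁ : ℝ} (hs₁ : s₁ ∈ Ioo a d)
    (hr : r₁ s₁ < r₂ s₁) (hp : slp q r₁ V₁ s₁ < slp q r₂ V₂ s₁) :
    (∀ s ∈ Ioc a s₁, r₁ s < r₂ s ∧ slp q r₁ V₁ s < slp q r₂ V₂ s) ∨
    ∃ s₀ ∈ Ioo a s₁, r₁ s₀ = r₂ s₀ ∧ slp q r₁ V₁ s₀ < slp q r₂ V₂ s₀ ∧
      ∀ s ∈ Ioc s₀ s₁, r₁ s < r₂ s ∧ slp q r₁ V₁ s < slp q r₂ V₂ s := by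
  by_cases hall : ∀ s ∈ Ioc a s₁, r₁ s < r₂ s
  · left
    intro s hs
    exact ⟨hall s hs, B₁.slp_lt_of_r_lt B₂ W hs.1 hs₁.2
      (fun t ht => hall t ⟨hs.1.trans_le ht.1, ht.2.le⟩) hp s (left_mem_Icc.2 hs.2)⟩
  right
  push Not at hall
  obtain ⟨t, ht, htr⟩ := hall
  have hsub : Icc t s₁ ⊆ Ioo a d := Icc_subset_Ioo ht.1 hs₁.2
  have hc : ContinuousOn (fun s => r₁ s - r₂ s) (Icc t s₁) := fun s hs =>
    ((B₁.deriv_r s (hsub hs)).continuousAt.sub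
      (B₂.deriv_r s (hsub hs)).continuousAt).continuousWithinAt
  have hcomp : IsCompact (Icc t s₁ ∩ (fun s => r₁ s - r₂ s) ⁻¹' Ici 0) :=
    isCompact_Icc.of_isClosed_subset (hc.preimage_isClosed_of_isClosed isClosed_Icc isClosed_Ici)
      inter_subset_left
  obtain ⟨s₀, hs₀, hmax⟩ := hcomp.exists_isGreatest ⟨t, left_mem_Icc.2 ht.2, sub_nonneg.2 htr⟩
  have h0 : r₂ s₀ ≤ r₁ s₀ := sub_nonneg.1 hs₀.2
  have hlt : s₀ < s₁ := lt_of_le_of_ne hs₀.1.2 (by rintro rfl; linarith)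
  have hrr : ∀ s ∈ Ioc s₀ s₁, r₁ s < r₂ s := by
    intro s hs
    by_contra! hcon
    exact absurd (hmax ⟨⟨hs₀.1.1.trans hs.1.le, hs.2⟩, sub_nonneg.2 hcon⟩) (not_le.2 hs.1)
  have hpp : ∀ s ∈ Ioc s₀ s₁, slp q r₁ V₁ s < slp q r₂ V₂ s := by
    intro s hs
    exact B₁.slp_lt_of_r_lt B₂ W (ht.1.trans_le (hs₀.1.1.trans hs.1.le)) hs₁.2
      (fun t ht => hrr t ⟨hs.1.trans_le ht.1, ht.2.le⟩) hp s (left_mem_Icc.2 hs.2)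
  have hm : s₀ ∈ Ioo a d := hsub hs₀.1
  have heq : r₁ s₀ = r₂ s₀ := by
    refine le_antisymm ?_ h0
    have c1 : Tendsto r₁ (𝓝[>] s₀) (𝓝 (r₁ s₀)) :=
      tendsto_nhdsWithin_of_tendsto_nhds (B₁.deriv_r s₀ hm).continuousAt
    have c2 : Tendsto r₂ (𝓝[>] s₀) (𝓝 (r₂ s₀)) :=
      tendsto_nhdsWithin_of_tendsto_nhds (B₂.deriv_r s₀ hm).continuousAt
    refine le_of_tendsto_of_tendsto c1 c2 ?_
    filter_upwards [Ioc_mem_nhdsGT hlt] with s hs using (hrr s hs).le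
  have hple : slp q r₁ V₁ s₀ ≤ slp q r₂ V₂ s₀ := by
    have c1 : Tendsto (slp q r₁ V₁) (𝓝[>] s₀) (𝓝 (slp q r₁ V₁ s₀)) :=
      tendsto_nhdsWithin_of_tendsto_nhds (B₁.continuousAt_slp W hm)
    have c2 : Tendsto (slp q r₂ V₂) (𝓝[>] s₀) (𝓝 (slp q r₂ V₂ s₀)) :=
      tendsto_nhdsWithin_of_tendsto_nhds (B₂.continuousAt_slp W hm)
    refine le_of_tendsto_of_tendsto c1 c2 ?_
    filter_upwards [Ioc_mem_nhdsGT hlt] with s hs using (hpp s hs).le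
  refine ⟨s₀, ⟨ht.1.trans_le hs₀.1.1, hlt⟩, heq, lt_of_le_of_ne hple fun h => ?_,
    fun s hs => ⟨hrr s hs, hpp s hs⟩⟩
  have hV : V₁ s₀ = V₂ s₀ := by rw [B₁.V_eq W hm, B₂.V_eq W hm, heq, h]
  exact hr.ne (B₁.eqOn B₂ W N hm heq hV s₁ hs₁).1

/-- Near its top the lower branch is early and flat. -/
theorem exists_top (B₂ : Branch c f q r₂ V₂ a d) (W : Weight q Hinf linf) {T : ℝ}
    (T₁ : StartsAt q r₁ V₁ α₁ T) (hα : α₁ ∈ Ioo a d) (hT : T < r₂ α₁) :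
    ∃ s₁ ∈ Ioo a α₁, ∀ s ∈ Ico s₁ α₁, r₁ s < r₂ s ∧ slp q r₁ V₁ s < slp q r₂ V₂ s := by
  have hr2 : Tendsto r₂ (𝓝[<] α₁) (𝓝 (r₂ α₁)) :=
    tendsto_nhdsWithin_of_tendsto_nhds (B₂.deriv_r α₁ hα).continuousAt
  have hp2 : Tendsto (slp q r₂ V₂) (𝓝[<] α₁) (𝓝 (slp q r₂ V₂ α₁)) :=
    tendsto_nhdsWithin_of_tendsto_nhds (B₂.continuousAt_slp W hα)
  have h := (T₁.r_lim.eventually_lt hr2 hT).and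
    (T₁.slp_lim.eventually_lt hp2 (B₂.slp_pos W hα))
  obtain ⟨m, hm, hmx⟩ := (mem_nhdsLT_iff_exists_mem_Ico_Ioo_subset hα.1).1 h
  obtain ⟨s₁, h1, h2⟩ := exists_between hm.2
  exact ⟨s₁, ⟨hm.1.trans_lt h1, h2⟩, fun s hs => hmx ⟨h1.trans_le hs.1, hs.2⟩⟩

/-- What is needed of a crossing above the level `β`: below it, down to `β`, the first branch is
flatter, and at `β` it has the smaller flux. -/
def GoodCrossing (β : ℝ) (q r₁ V₁ r₂ V₂ : ℝ → ℝ) (α₁ : ℝ) : Prop :=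
  ∀ s₀ ∈ Ioo β α₁, r₁ s₀ = r₂ s₀ → slp q r₁ V₁ s₀ < slp q r₂ V₂ s₀ →
    (∀ s ∈ Ioo s₀ α₁, r₁ s < r₂ s) →
    (∀ s ∈ Icc β s₀, slp q r₁ V₁ s < slp q r₂ V₂ s) ∧ V₁ β ≤ V₂ β

/-- At the level `β`, where the energy is `p²`, late and smaller flux give the smaller
`Q/q √E = (Q/q²) V`. -/
theorem tail_lt_at_β (B₁ : Branch c f q r₁ V₁ a d) (B₂ : Branch c f q r₂ V₂ a d)
    (W : Weight q Hinf linf) (N : Nonlin c b β f) (hβ : β ∈ Ioo a d) (hr : r₂ β < r₁ β)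
    (hV : V₁ β ≤ V₂ β) :
    primQ q (r₁ β) / q (r₁ β) * √(nrg f q r₁ V₁ β) <
      primQ q (r₂ β) / q (r₂ β) * √(nrg f q r₂ V₂ β) := by
  have e : ∀ {r V : ℝ → ℝ}, Branch c f q r V a d →
      primQ q (r β) / q (r β) * √(nrg f q r V β) = primQ q (r β) / q (r β) ^ 2 * V β := by
    intro r V B
    simp only [nrg, N.c1.primF_β, mul_zero, add_zero]
    rw [Real.sqrt_sq (B.slp_pos W hβ).le]
    have := (B.q_pos W hβ).ne'
    simp only [slp]; field_simp
  rw [e B₁, e B₂]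
  have h1 := W.div_sq_strictAntiOn (B₂.r_pos β hβ) (B₁.r_pos β hβ) hr
  simp only at h1
  have h2 : 0 < primQ q (r₁ β) / q (r₁ β) ^ 2 :=
    div_pos (W.primQ_pos (B₁.r_pos β hβ)) (pow_pos (B₁.q_pos W hβ) 2)
  exact mul_lt_mul h1 hV (B₁.V_pos β hβ) (h2.trans h1).le

/-- From a level in `(0, β]` at which the branches cross transversally, the first one being
flatter, the slopes cannot both vanish at `0`. -/
theorem false_of_low_crossing (B₁ : Branch c f q r₁ V₁ 0 d) (B₂ : Branch c f q r₂ V₂ 0 d)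
    (W : Weight q Hinf linf) (N : Nonlin c b β f) {s₀ : ℝ} (h0 : 0 < s₀) (h1 : s₀ < d)
    (hβ : s₀ ≤ β) (hr : r₁ s₀ = r₂ s₀) (hp : slp q r₁ V₁ s₀ < slp q r₂ V₂ s₀)
    (hlim : Tendsto (slp q r₂ V₂) (𝓝[>] 0) (𝓝 0)) : False := by
  refine B₁.false_of_tail B₂ W N h0 h1 hβ hr.ge ?_ hlim
  have hm : s₀ ∈ Ioo 0 d := ⟨h0, h1⟩
  rw [hr]
  refine mul_lt_mul_of_pos_left ?_ (div_pos (W.primQ_pos (B₂.r_pos s₀ hm)) (B₂.q_pos W hm))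
  refine Real.sqrt_lt_sqrt (B₁.nrg_pos hm).le ?_
  simp only [nrg]
  have := pow_lt_pow_left₀ hp (B₁.slp_pos W hm).le two_ne_zero
  linarith

/-- Two falling branches with slope vanishing at the level `0` start at the same level. -/
theorem false_of_lt (B₁ : Branch c f q r₁ V₁ 0 α₁) (B₂ : Branch c f q r₂ V₂ 0 α₂)
    (W : Weight q Hinf linf) (N : Nonlin c b β f) (hβα : β < α₁) (h12 : α₁ < α₂)
    (T₁ : StartsAt q r₁ V₁ α₁ 0)
    (hlim : Tendsto (slp q r₂ V₂) (𝓝[>] 0) (𝓝 0))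
    (hcr : GoodCrossing β q r₁ V₁ r₂ V₂ α₁) : False := by
  have hβ := N.β_pos
  have hα1 : α₁ ∈ Ioo 0 α₂ := ⟨hβ.trans hβα, h12⟩
  obtain ⟨s₁, hs₁, htop⟩ := B₂.exists_top W T₁ hα1 (B₂.r_pos α₁ hα1)
  have B₂' := B₂.mono le_rfl h12.le
  obtain ⟨hr1, hp1⟩ := htop s₁ ⟨le_rfl, hs₁.2⟩
  rcases B₁.first_crossing B₂' W N hs₁ hr1 hp1 with h | ⟨s₀, hs₀, heq, hp, habove⟩
  · exact B₁.false_of_r_lt B₂' W N hs₁.1 hs₁.2 (fun s hs => (h s ⟨hs.1, hs.2.le⟩).1)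
      (fun s hs => (h s ⟨hs.1, hs.2.le⟩).2) hlim
  · have hs0 : s₀ < α₁ := hs₀.2.trans hs₁.2
    rcases le_or_gt s₀ β with hle | hgt
    · exact B₁.false_of_low_crossing B₂' W N hs₀.1 hs0 hle heq hp hlim
    · obtain ⟨hpp, hV⟩ := hcr s₀ ⟨hgt, hs0⟩ heq hp (fun s hs => by
        rcases le_or_gt s s₁ with h | h
        · exact (habove s ⟨hs.1, h⟩).1
        · exact (htop s ⟨h.le, hs.2⟩).1)
      have hr := B₁.r_lt_of_slp_lt B₂' W hβ hs0 heq.ge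
        (fun s hs => hpp s (Ioo_subset_Icc_self hs)) β ⟨le_rfl, hgt⟩
      exact B₁.false_of_tail B₂' W N hβ hβα le_rfl hr.le
        (B₁.tail_lt_at_β B₂' W N ⟨hβ, hβα⟩ hr hV) hlim

/-- Below the level `-β` the first branch is early and flatter, until it possibly becomes late,
flatter and with smaller flux. -/
theorem low_alternative (B₁ : Branch c f q r₁ V₁ a α₁) (B₂ : Branch c f q r₂ V₂ a α₂)
    (W : Weight q Hinf linf) (N : Nonlin c b β f) (ha : a < -β) (hβα : β < α₁) (h12 : α₁ < α₂)
    (T₁ : StartsAt q r₁ V₁ α₁ 0) (hcr : GoodCrossing β q r₁ V₁ r₂ V₂ α₁) :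
    (∀ s ∈ Ioc a (-β), r₁ s < r₂ s ∧ slp q r₁ V₁ s < slp q r₂ V₂ s) ∨
    ∃ s₀ ∈ Ioc a (-β), r₂ s₀ ≤ r₁ s₀ ∧ V₁ s₀ ≤ V₂ s₀ ∧ slp q r₁ V₁ s₀ < slp q r₂ V₂ s₀ ∧
      ∀ s ∈ Ioc s₀ (-β), r₁ s < r₂ s ∧ slp q r₁ V₁ s < slp q r₂ V₂ s := by
  have hβ := N.β_pos
  have hα1 : α₁ ∈ Ioo a α₂ := ⟨by linarith, h12⟩
  obtain ⟨s₁, hs₁, htop⟩ := B₂.exists_top W T₁ hα1 (B₂.r_pos α₁ hα1)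
  have B₂' := B₂.mono le_rfl h12.le
  obtain ⟨hr1, hp1⟩ := htop s₁ ⟨le_rfl, hs₁.2⟩
  have hmβ : -β ∈ Ioo a α₁ := ⟨ha, by linarith⟩
  -- conversion of the weighted energy at the level `-β`, where `F = 0`
  have atβ : ∀ s' : ℝ, -β < s' → s' ≤ β → r₂ s' ≤ r₁ s' →
      q (r₁ s') ^ 2 * nrg f q r₁ V₁ s' ≤ q (r₂ s') ^ 2 * nrg f q r₂ V₂ s' →
      slp q r₁ V₁ s' < slp q r₂ V₂ s' →
      r₂ (-β) ≤ r₁ (-β) ∧ V₁ (-β) ≤ V₂ (-β) ∧ slp q r₁ V₁ (-β) < slp q r₂ V₂ (-β) := by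
    intro s' h1 h2 h3 h4 h5
    obtain ⟨k1, k2⟩ := B₁.sq_mul_nrg_compare B₂' W N ha (h2.trans_lt hβα) le_rfl h2 h3 h4 h5
    have k3 := B₁.r_lt_of_slp_lt B₂' W ha (h2.trans_lt hβα) h3
      (fun s hs => k1 s (Ioo_subset_Icc_self hs)) (-β) ⟨le_rfl, h1⟩
    refine ⟨k3.le, ?_, k1 _ (left_mem_Icc.2 h1.le)⟩
    have k4 := k2 _ (left_mem_Icc.2 h1.le)
    simp only [nrg, N.primF_neg N.β_mem, N.c1.primF_β, mul_zero, add_zero, ← mul_pow] at k4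
    rw [← B₁.V_eq W hmβ, ← B₂'.V_eq W hmβ] at k4
    exact le_of_sq_le_sq k4 (B₂'.V_pos _ hmβ).le
  rcases B₁.first_crossing B₂' W N hs₁ hr1 hp1 with h | ⟨s₀, hs₀, heq, hp, habove⟩
  · left
    intro s hs
    rcases le_or_gt s s₁ with h' | h'
    · exact h s ⟨hs.1, h'⟩
    · exact htop s ⟨h'.le, by linarith [hs.2]⟩
  · right
    have hs0 : s₀ < α₁ := hs₀.2.trans hs₁.2
    rcases le_or_gt s₀ (-β) with hle | hgt
    · refine ⟨s₀, ⟨hs₀.1, hle⟩, heq.ge, ?_, hp, fun s hs => ?_⟩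
      · have hm : s₀ ∈ Ioo a α₁ := ⟨hs₀.1, hs0⟩
        rw [B₁.V_eq W hm, B₂'.V_eq W hm, heq]
        exact mul_le_mul_of_nonneg_left hp.le (B₂'.q_pos W hm).le
      · rcases le_or_gt s s₁ with h' | h'
        · exact habove s ⟨hs.1, h'⟩
        · exact htop s ⟨h'.le, by linarith [hs.2]⟩
    · refine ⟨-β, ⟨ha, le_rfl⟩, ?_⟩
      have hend : ∀ s ∈ Ioc (-β) (-β), r₁ s < r₂ s ∧ slp q r₁ V₁ s < slp q r₂ V₂ s :=
        fun s hs => absurd hs.1 (not_lt.2 hs.2)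
      rcases le_or_gt s₀ β with hle' | hgt'
      · have hm : s₀ ∈ Ioo a α₁ := ⟨hs₀.1, hs0⟩
        obtain ⟨k1, k2, k3⟩ := atβ s₀ hgt hle' heq.ge (by
          rw [heq]
          refine mul_le_mul_of_nonneg_left ?_ (sq_nonneg _)
          simp only [nrg]
          have := pow_lt_pow_left₀ hp (B₁.slp_pos W hm).le two_ne_zero
          linarith) hp
        exact ⟨k1, k2, k3, hend⟩
      · obtain ⟨hpp, hV⟩ := hcr s₀ ⟨hgt', hs0⟩ heq hp (fun s hs => by
          rcases le_or_gt s s₁ with h | h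
          · exact (habove s ⟨hs.1, h⟩).1
          · exact (htop s ⟨h.le, hs.2⟩).1)
        have haβ : a < β := by linarith
        have hr := B₁.r_lt_of_slp_lt B₂' W haβ hs0 heq.ge
          (fun s hs => hpp s (Ioo_subset_Icc_self hs)) β ⟨le_rfl, hgt'⟩
        have hm : β ∈ Ioo a α₁ := ⟨haβ, hβα⟩
        obtain ⟨k1, k2, k3⟩ := atβ β (by linarith) le_rfl hr.le (by
          simp only [nrg, N.c1.primF_β, mul_zero, add_zero, ← mul_pow]
          rw [← B₁.V_eq W hm, ← B₂'.V_eq W hm]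
          have := B₁.V_pos β hm
          gcongr) (hpp β (left_mem_Icc.2 hgt'.le))
        exact ⟨k1, k2, k3, hend⟩

/-- The second branch does not end before the first one. -/
theorem lt_of_low_alternative (B₁ : Branch c f q r₁ V₁ a α₁) (B₂ : Branch c f q r₂ V₂ a α₂)
    (W : Weight q Hinf linf) (N : Nonlin c b β f) (ha : a < -β) (hβα : β < α₁) (h12 : α₁ < α₂)
    (halt : (∀ s ∈ Ioc a (-β), r₁ s < r₂ s ∧ slp q r₁ V₁ s < slp q r₂ V₂ s) ∨
      ∃ s₀ ∈ Ioc a (-β), r₂ s₀ ≤ r₁ s₀ ∧ V₁ s₀ ≤ V₂ s₀ ∧ slp q r₁ V₁ s₀ < slp q r₂ V₂ s₀ ∧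
        ∀ s ∈ Ioc s₀ (-β), r₁ s < r₂ s ∧ slp q r₁ V₁ s < slp q r₂ V₂ s)
    (hV : Tendsto V₂ (𝓝[>] a) (𝓝 0)) (hs : Tendsto (slp q r₂ V₂) (𝓝[>] a) (𝓝 0)) : False := by
  have hβ := N.β_pos
  have B₂' := B₂.mono (le_refl a) h12.le
  have hmβ : -β ∈ Ioo a α₁ := ⟨ha, by linarith⟩
  rcases halt with h | ⟨s₀, hs₀, hr, hVV, hp, -⟩
  · set δ := q (r₁ (-β)) * (slp q r₂ V₂ (-β) ^ 2 - slp q r₁ V₁ (-β) ^ 2) with hδ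
    have hδ0 : 0 < δ := by
      apply mul_pos (B₁.q_pos W hmβ)
      have := pow_lt_pow_left₀ (h _ ⟨ha, le_rfl⟩).2 (B₁.slp_pos W hmβ).le two_ne_zero
      linarith
    have hlim := hV.mul hs
    rw [mul_zero] at hlim
    obtain ⟨s, h1, h2⟩ := ((hlim.eventually_lt_const hδ0).and (Ioo_mem_nhdsGT ha)).exists
    have hm : s ∈ Ioo a α₁ := ⟨h2.1, h2.2.trans hmβ.2⟩
    have h3 := B₁.gap_antitoneOn B₂' W h2.1 hmβ.2
      (fun t ht => (h t ⟨h2.1.trans ht.1, ht.2.le⟩).1)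
      (fun t ht => (h t ⟨h2.1.trans ht.1, ht.2.le⟩).2)
      (left_mem_Icc.2 h2.2.le) (right_mem_Icc.2 h2.2.le) h2.2.le
    simp only at h3
    have h4 := W.lt (B₁.r_pos s hm).le (h s ⟨h2.1, h2.2.le⟩).1
    have h5 := B₁.q_pos W hm
    rw [B₂'.V_eq W hm] at h1
    nlinarith [mul_nonneg h5.le (sq_nonneg (slp q r₁ V₁ s)),
      mul_le_mul_of_nonneg_right h4.le (sq_nonneg (slp q r₂ V₂ s))]
  · have hm0 : s₀ ∈ Ioo a α₁ := ⟨hs₀.1, hs₀.2.trans_lt hmβ.2⟩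
    obtain ⟨s', h1, h2⟩ := exists_between hs₀.1
    have hanti : ∀ s, a < s → s < s₀ → StrictAntiOn (fun s => V₂ s ^ 2 - V₁ s ^ 2) (Icc s s₀) :=
      fun s hs1 hs2 => (B₁.V_compare B₂' W N hs1 hm0.2
        (hs₀.2.trans (neg_le_neg N.c1.b_lt_β.le)) hr hVV hp).2
    set δ := V₂ s' ^ 2 - V₁ s' ^ 2 with hδ
    have hδ0 : 0 < δ := by
      have h3 := hanti s' h1 h2 (left_mem_Icc.2 h2.le) (right_mem_Icc.2 h2.le) h2
      simp only at h3
      have := (B₁.V_pos s₀ hm0).le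
      have h4 : V₁ s₀ ^ 2 ≤ V₂ s₀ ^ 2 := by gcongr
      linarith
    have hlim := hV.pow 2
    rw [zero_pow two_ne_zero] at hlim
    obtain ⟨s, h3, h4⟩ := ((hlim.eventually_lt_const hδ0).and (Ioo_mem_nhdsGT h1)).exists
    have h5 := hanti s h4.1 (h4.2.trans h2) (left_mem_Icc.2 (h4.2.trans h2).le)
      ⟨h4.2.le, h2.le⟩ h4.2
    simp only at h5
    nlinarith [sq_nonneg (V₁ s)]

end Branch

/-! ### The return to zero after the minimum -/

/-- The Pohozaev-type functional `Q (u'² + 2 F(u)) + 2 q u' F(u) / f(u)` at a given level. -/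
noncomputable def poh (f q r V : ℝ → ℝ) (s : ℝ) : ℝ :=
  primQ q (r s) * nrg f q r V s - 2 * (V s * (primF f s / f s))

/-- The coefficient `2 (F / f)' - 1 + 2 H` in the derivative of the Pohozaev-type functional. -/
noncomputable def pohK (f q r : ℝ → ℝ) (s : ℝ) : ℝ :=
  2 * deriv (fun t => primF f t / f t) |s| - 1 + 2 * funH q (r s)

theorem Nonlin.hasDerivAt_div_abs {c : EReal} {b β : ℝ} {f : ℝ → ℝ} (N : Nonlin c b β f) {s : ℝ}
    (hb : b < |s|) (hs : s ∈ dom c) :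
    HasDerivAt (fun t => primF f t / f t) (deriv (fun t => primF f t / f t) |s|) s := by
  rcases abs_cases s with ⟨h, h0⟩ | ⟨h, h0⟩
  · rw [h] at hb ⊢
    exact (N.hasDerivAt_div hb hs).1
  · rw [h] at hb ⊢
    have h1 := (N.hasDerivAt_div hb (neg_mem_dom hs)).1
    have h2 := (h1.comp s (hasDerivAt_neg s)).neg
    refine (h2.congr_of_eventuallyEq ?_).congr_deriv (by ring)
    filter_upwards [(isOpen_dom c).mem_nhds hs] with t ht
    simp only [Pi.neg_apply, Function.comp, N.primF_neg ht, N.odd ht]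
    rw [div_neg, neg_neg]

theorem Nonlin.f_ne_zero {c : EReal} {b β : ℝ} {f : ℝ → ℝ} (N : Nonlin c b β f) {s : ℝ}
    (hb : b < |s|) (hs : s ∈ dom c) : f s ≠ 0 := by
  rcases abs_cases s with ⟨h, h0⟩ | ⟨h, h0⟩
  · rw [h] at hb
    exact (N.pos hb hs).ne'
  · rw [h] at hb
    have := N.pos hb (neg_mem_dom hs)
    rw [N.odd hs] at this
    linarith

namespace Branch

variable {c : EReal} {b β Hinf linf : ℝ} {f q : ℝ → ℝ} {r V r₁ V₁ r₂ V₂ : ℝ → ℝ}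
  {a d : ℝ}

theorem hasDerivAt_poh (B : Branch c f q r V a d) (W : Weight q Hinf linf)
    (N : Nonlin c b β f) {s : ℝ} (hs : s ∈ Ioo a d) (hb : b < |s|) :
    HasDerivAt (poh f q r V) (-(V s * pohK f q r s)) s := by
  have hr := B.r_pos s hs
  have h1 : HasDerivAt (fun s => primQ q (r s)) _ s :=
    (W.hasDerivAt_primQ hr).comp s (B.hasDerivAt_r hs)
  have h := (h1.mul (B.hasDerivAt_nrg W N hs)).sub
    (((B.deriv_V s hs).mul (N.hasDerivAt_div_abs hb (B.mem s hs))).const_mul 2)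
  refine HasDerivAt.congr_deriv (f := poh f q r V) h ?_
  have hH := (W.hasDerivAt_div hr).2
  have hp := (B.slp_pos W hs).ne'
  have hq := (B.q_pos W hs).ne'
  have hf := N.f_ne_zero hb (B.mem s hs)
  simp only [pohK, nrg]
  rw [B.V_eq W hs, hH]
  field_simp
  ring

theorem pohK_nonneg (B : Branch c f q r V a d) (W : Weight q Hinf linf)
    (h3 : CondF3 c β Hinf f) {s : ℝ} (hs : s ∈ Ioo a d) (hβ : β < |s|) : 0 ≤ pohK f q r s := by
  have h1 := h3 |s| hβ (B.mem s hs)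
  have h2 := W.le_funH (B.r_pos s hs)
  simp only [pohK]
  linarith

/-- The monotonicity of `H` and of `q (H - H_∞)` compares the derivatives of the functionals. -/
theorem V_mul_pohK_le (B₁ : Branch c f q r₁ V₁ a d) (B₂ : Branch c f q r₂ V₂ a d)
    (W : Weight q Hinf linf) (h3 : CondF3 c β Hinf f) {s k : ℝ} (hs : s ∈ Ioo a d)
    (hβ : β < |s|) (hk : 1 ≤ k) (hp : slp q r₁ V₁ s < slp q r₂ V₂ s)
    (h : r₁ s < r₂ s ∨ V₁ s ≤ k * V₂ s) :
    V₁ s * pohK f q r₁ s ≤ k * (V₂ s * pohK f q r₂ s) := by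
  have hK1 := B₁.pohK_nonneg W h3 hs hβ
  have hK2 := B₂.pohK_nonneg W h3 hs hβ
  have hV1 := B₁.V_pos s hs
  have hV2 := B₂.V_pos s hs
  rcases lt_or_ge (r₁ s) (r₂ s) with hr | hr
  · have hmono := W.c3.mono (B₁.r_pos s hs) (B₂.r_pos s hs) hr.le
    simp only at hmono
    have hq := W.lt (B₁.r_pos s hs).le hr
    have hp1 := B₁.slp_pos W hs
    have hHi := W.le_funH (B₂.r_pos s hs)
    have hq2 := B₂.q_pos W hs
    have hk0 := h3 |s| hβ (B₁.mem s hs)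
    have step : V₁ s * pohK f q r₁ s ≤ V₂ s * pohK f q r₂ s := by
      have e : ∀ r V : ℝ → ℝ, V s = q (r s) * slp q r V s → V s * pohK f q r s =
          q (r s) * slp q r V s *
            (2 * deriv (fun t => primF f t / f t) |s| - 1 + 2 * Hinf) +
          2 * slp q r V s * (q (r s) * (funH q (r s) - Hinf)) := by
        intro r V h
        simp only [pohK]
        rw [h]; ring
      rw [e r₁ V₁ (B₁.V_eq W hs), e r₂ V₂ (B₂.V_eq W hs)]
      have hc : 0 ≤ 2 * deriv (fun t => primF f t / f t) |s| - 1 + 2 * Hinf := by linarith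
      have h1 : q (r₁ s) * slp q r₁ V₁ s ≤ q (r₂ s) * slp q r₂ V₂ s :=
        mul_le_mul hq.le hp.le hp1.le hq2.le
      have h2 : 2 * slp q r₁ V₁ s * (q (r₁ s) * (funH q (r₁ s) - Hinf)) ≤
          2 * slp q r₂ V₂ s * (q (r₂ s) * (funH q (r₂ s) - Hinf)) :=
        (mul_le_mul_of_nonneg_left hmono (by linarith)).trans
          (mul_le_mul_of_nonneg_right (by linarith) (mul_nonneg hq2.le (by linarith)))
      exact add_le_add (mul_le_mul_of_nonneg_right h1 hc) h2
    refine step.trans ?_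
    have := mul_nonneg hV2.le hK2
    nlinarith
  · have hV : V₁ s ≤ k * V₂ s := h.resolve_left (not_lt.2 hr)
    have hH := W.c3.anti (B₂.r_pos s hs) (B₁.r_pos s hs) hr
    have hKK : pohK f q r₁ s ≤ pohK f q r₂ s := by
      simp only [pohK]; linarith
    calc V₁ s * pohK f q r₁ s ≤ V₁ s * pohK f q r₂ s := by gcongr
      _ ≤ (k * V₂ s) * pohK f q r₂ s := by gcongr
      _ = _ := by ring

theorem poh_anti (B : Branch c f q r V a d) (W : Weight q Hinf linf)
    (N : Nonlin c b β f) (h3 : CondF3 c β Hinf f) {s t : ℝ} (hs : a < s) (hst : s ≤ t)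
    (ht : t < d) (hβ : ∀ x ∈ Icc s t, b < |x|) (hβ' : ∀ x ∈ Ioo s t, β < |x|) :
    poh f q r V t ≤ poh f q r V s := by
  have hsub : Icc s t ⊆ Ioo a d := Icc_subset_Ioo hs ht
  refine antitoneOn_Icc_of_hasDerivAt (fun x hx => B.hasDerivAt_poh W N (hsub hx) (hβ x hx)) ?_
    (left_mem_Icc.2 hst) (right_mem_Icc.2 hst) hst
  intro x hx
  have hx' := hsub (Ioo_subset_Icc_self hx)
  exact neg_nonpos.2 (mul_nonneg (B.V_pos x hx').le (B.pohK_nonneg W h3 hx' (hβ' x hx)))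

/-- The functional at a turning point of level `m`. -/
theorem _root_.WeightedBoundState.tendsto_poh {l : Filter ℝ} {m T : ℝ} (W : Weight q Hinf linf)
    (N : Nonlin c b β f) (hl : Tendsto (fun s : ℝ => s) l (𝓝 m)) (hm : m ∈ dom c)
    (hb : b < |m|) (hT : 0 < T) (hr : Tendsto r l (𝓝 T)) (hV : Tendsto V l (𝓝 0))
    (hs : Tendsto (slp q r V) l (𝓝 0)) :
    Tendsto (poh f q r V) l (𝓝 (primQ q T * (2 * primF f m))) := by
  have hF : Tendsto (primF f) l (𝓝 (primF f m)) :=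
    (N.hasDerivAt_primF hm).continuousAt.tendsto.comp hl
  have hf : Tendsto f l (𝓝 (f m)) := (N.continuousAt hm).tendsto.comp hl
  have hQ : Tendsto (fun s => primQ q (r s)) l (𝓝 (primQ q T)) :=
    (W.hasDerivAt_primQ hT).continuousAt.tendsto.comp hr
  have h : Tendsto (poh f q r V) l (𝓝 (primQ q T * (0 ^ 2 + 2 * primF f m) -
      2 * (0 * (primF f m / f m)))) :=
    (hQ.mul ((hs.pow 2).add (hF.const_mul 2))).sub
      ((hV.mul (hF.div hf (N.f_ne_zero hb hm))).const_mul 2)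
  simpa using h

/-- On rising levels `k P₂ - P₁` does not decrease in time. -/
theorem poh_gap_antitoneOn (B₁ : Branch c f q r₁ V₁ a d) (B₂ : Branch c f q r₂ V₂ a d)
    (W : Weight q Hinf linf) (N : Nonlin c b β f) (h3 : CondF3 c β Hinf f) {s t k : ℝ}
    (hs : a < s) (ht : t < d) (hk : 1 ≤ k) (hβ : ∀ x ∈ Icc s t, b < |x|)
    (hβ' : ∀ x ∈ Ioo s t, β < |x|)
    (hp : ∀ x ∈ Ioo s t, slp q r₁ V₁ x < slp q r₂ V₂ x)
    (h : ∀ x ∈ Ioo s t, r₁ x < r₂ x ∨ V₁ x ≤ k * V₂ x) :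
    AntitoneOn (fun x => k * poh f q r₂ V₂ x - poh f q r₁ V₁ x) (Icc s t) := by
  have hsub : Icc s t ⊆ Ioo a d := Icc_subset_Ioo hs ht
  refine antitoneOn_Icc_of_hasDerivAt (fun x hx =>
    ((B₂.hasDerivAt_poh W N (hsub hx) (hβ x hx)).const_mul k).sub
      (B₁.hasDerivAt_poh W N (hsub hx) (hβ x hx))) ?_
  intro x hx
  have hx' := hsub (Ioo_subset_Icc_self hx)
  have := B₁.V_mul_pohK_le B₂ W h3 hx' (hβ' x hx) hk (hp x hx) (h x hx)
  linarith

/-- Where the second branch is steeper and `f > 0`, the ratio of the fluxes decreases with the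
level. -/
theorem V_ratio (B₁ : Branch c f q r₁ V₁ a d) (B₂ : Branch c f q r₂ V₂ a d)
    (W : Weight q Hinf linf) (N : Nonlin c b β f) {s t k : ℝ} (hs : a < s) (hst : s ≤ t)
    (ht : t < d) (hb : b ≤ s) (hp : ∀ x ∈ Ioo s t, slp q r₁ V₁ x < slp q r₂ V₂ x)
    (hk : V₁ s ≤ k * V₂ s) : V₁ t ≤ k * V₂ t := by
  have hsub : Icc s t ⊆ Ioo a d := Icc_subset_Ioo hs ht
  have hd : ∀ x ∈ Icc s t, HasDerivAt (fun x => V₁ x / V₂ x)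
      ((-(q (r₁ x) ^ 2 * f x / V₁ x) * V₂ x - V₁ x * -(q (r₂ x) ^ 2 * f x / V₂ x)) / V₂ x ^ 2) x :=
    fun x hx => (B₁.deriv_V x (hsub hx)).div (B₂.deriv_V x (hsub hx))
      (B₂.V_pos x (hsub hx)).ne'
  have h := antitoneOn_Icc_of_hasDerivAt hd (fun x hx => by
    have hx' := hsub (Ioo_subset_Icc_self hx)
    refine div_nonpos_of_nonpos_of_nonneg ?_ (sq_nonneg _)
    have hp1 := B₁.slp_pos W hx'
    have hp2 := B₂.slp_pos W hx'
    have hq1 := B₁.q_pos W hx'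
    have hq2 := B₂.q_pos W hx'
    have hf := N.pos (hb.trans_lt hx.1) (B₁.mem x hx')
    have hpp := hp x hx
    rw [B₁.V_eq W hx', B₂.V_eq W hx']
    have e : -(q (r₁ x) ^ 2 * f x / (q (r₁ x) * slp q r₁ V₁ x)) * (q (r₂ x) * slp q r₂ V₂ x) -
        q (r₁ x) * slp q r₁ V₁ x * -(q (r₂ x) ^ 2 * f x / (q (r₂ x) * slp q r₂ V₂ x)) =
        -(q (r₁ x) * q (r₂ x) * f x / (slp q r₁ V₁ x * slp q r₂ V₂ x) *
          (slp q r₂ V₂ x ^ 2 - slp q r₁ V₁ x ^ 2)) := by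
      field_simp
      ring
    rw [e]
    refine neg_nonpos.2 (mul_nonneg (by positivity) ?_)
    have := pow_lt_pow_left₀ hpp hp1.le two_ne_zero
    linarith) (left_mem_Icc.2 hst) (right_mem_Icc.2 hst) hst
  have hV1 := B₂.V_pos s (hsub (left_mem_Icc.2 hst))
  have hV2 := B₂.V_pos t (hsub (right_mem_Icc.2 hst))
  simp only at h
  rw [← div_le_iff₀ hV2]
  exact h.trans ((div_le_iff₀ hV1).2 hk)

end Branch

/-- Two solutions with one sign change, described by their falling branches down to the minima
`-M₁ > -M₂` and the returning branches. -/
structure ReturnPair (c : EReal) (f q : ℝ → ℝ) (β : ℝ) (M₁ M₂ T₁ T₂ α₁ α₂ : ℝ)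
    (r₁ V₁ r₂ V₂ R₁ U₁ R₂ U₂ : ℝ → ℝ) : Prop where
  β_lt_M₁ : β < M₁
  M₁_lt : M₁ < M₂
  β_lt_α₁ : β < α₁
  α₁_lt : α₁ < α₂
  T₁_pos : 0 < T₁
  T₂_pos : 0 < T₂
  M₂_mem : M₂ ∈ dom c
  B₁ : Branch c f q r₁ V₁ (-M₁) α₁
  B₂ : Branch c f q r₂ V₂ (-M₂) α₂
  C₁ : Branch c f q R₁ U₁ 0 M₁
  C₂ : Branch c f q R₂ U₂ 0 M₂
  r₁_lim : Tendsto r₁ (𝓝[>] (-M₁)) (𝓝 T₁)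
  V₁_lim : Tendsto V₁ (𝓝[>] (-M₁)) (𝓝 0)
  p₁_lim : Tendsto (slp q r₁ V₁) (𝓝[>] (-M₁)) (𝓝 0)
  r₂_lim : Tendsto r₂ (𝓝[>] (-M₂)) (𝓝 T₂)
  V₂_lim : Tendsto V₂ (𝓝[>] (-M₂)) (𝓝 0)
  p₂_lim : Tendsto (slp q r₂ V₂) (𝓝[>] (-M₂)) (𝓝 0)
  S₁ : StartsAt q R₁ U₁ M₁ T₁
  S₂ : StartsAt q R₂ U₂ M₂ T₂
  end₂ : Tendsto (slp q R₂ U₂) (𝓝[>] 0) (𝓝 0)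
  low : ∀ s ∈ Ioc (-M₁) (-β), slp q r₁ V₁ s < slp q r₂ V₂ s ∧
    (r₁ s < r₂ s ∨ (r₂ s ≤ r₁ s ∧ V₁ s ≤ V₂ s))

namespace ReturnPair

variable {c : EReal} {b β Hinf linf : ℝ} {f q : ℝ → ℝ} {M₁ M₂ T₁ T₂ α₁ α₂ : ℝ}
  {r₁ V₁ r₂ V₂ R₁ U₁ R₂ U₂ : ℝ → ℝ}

/-- Along the second solution the functional increases between the two passages through the
level of the first minimum. -/
theorem poh_turn (P : ReturnPair c f q β M₁ M₂ T₁ T₂ α₁ α₂ r₁ V₁ r₂ V₂ R₁ U₁ R₂ U₂)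
    (W : Weight q Hinf linf) (N : Nonlin c b β f) (h3 : CondF3 c β Hinf f) :
    poh f q r₂ V₂ (-M₁) ≤ poh f q R₂ U₂ M₁ := by
  have hβ := N.β_pos
  have hb := N.c1.b_lt_β
  have h1 := P.β_lt_M₁
  have h12 := P.M₁_lt
  have hα := P.β_lt_α₁
  have hα2 := P.α₁_lt
  have hM0 : 0 < M₂ := by linarith
  have l1 := tendsto_poh W N (tendsto_nhdsWithin_of_tendsto_nhds tendsto_id)
    (neg_mem_dom P.M₂_mem) (by rw [abs_neg, abs_of_pos hM0]; linarith) P.T₂_pos P.r₂_lim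
    P.V₂_lim P.p₂_lim
  have l2 := tendsto_poh W N (tendsto_nhdsWithin_of_tendsto_nhds tendsto_id)
    P.M₂_mem (by rw [abs_of_pos hM0]; linarith) P.T₂_pos P.S₂.r_lim P.S₂.V_lim P.S₂.slp_lim
  rw [N.primF_neg P.M₂_mem] at l1
  refine (ge_of_tendsto l1 ?_).trans (le_of_tendsto l2 ?_)
  · filter_upwards [Ioo_mem_nhdsGT (show -M₂ < -M₁ by linarith)] with s hs
    refine P.B₂.poh_anti W N h3 hs.1 hs.2.le (by linarith) (fun x hx => ?_) (fun x hx => ?_)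
    · rw [abs_of_neg (by linarith [hx.2])]; linarith [hx.2]
    · rw [abs_of_neg (by linarith [hx.2])]; linarith [hx.2]
  · filter_upwards [Ioo_mem_nhdsLT h12] with s hs
    refine P.C₂.poh_anti W N h3 (by linarith) hs.1.le hs.2 (fun x hx => ?_) (fun x hx => ?_)
    · rw [abs_of_pos (by linarith [hx.1])]; linarith [hx.1]
    · rw [abs_of_pos (by linarith [hx.1])]; linarith [hx.1]

/-- At the level `-β` the functional of the second solution is larger. -/
theorem poh_at_neg_β (P : ReturnPair c f q β M₁ M₂ T₁ T₂ α₁ α₂ r₁ V₁ r₂ V₂ R₁ U₁ R₂ U₂)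
    (W : Weight q Hinf linf) (N : Nonlin c b β f) :
    poh f q r₁ V₁ (-β) < poh f q r₂ V₂ (-β) := by
  have hβ := N.β_pos
  have h1 := P.β_lt_M₁
  have h12 := P.M₁_lt
  have hα := P.β_lt_α₁
  have hα2 := P.α₁_lt
  have m1 : -β ∈ Ioo (-M₁) α₁ := ⟨by linarith, by linarith⟩
  have m2 : -β ∈ Ioo (-M₂) α₂ := ⟨by linarith, by linarith⟩
  simp only [poh, nrg, N.primF_neg N.β_mem, N.c1.primF_β, mul_zero, add_zero, zero_div, sub_zero]
  obtain ⟨hp, h⟩ := P.low (-β) ⟨by linarith, le_rfl⟩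
  have r1 := P.B₁.r_pos _ m1
  have r2 := P.B₂.r_pos _ m2
  have p1 := P.B₁.slp_pos W m1
  have q1 := P.B₁.q_pos W m1
  have q2 := P.B₂.q_pos W m2
  have hpp := pow_lt_pow_left₀ hp p1.le two_ne_zero
  have Qmono : ∀ {x y : ℝ}, 0 < x → x ≤ y → primQ q x ≤ primQ q y := by
    intro x y hx hxy
    exact monotoneOn_Icc_of_hasDerivAt (fun z hz => W.hasDerivAt_primQ (hx.trans_le hz.1))
      (fun z hz => (W.pos (hx.trans hz.1)).le) (left_mem_Icc.2 hxy) (right_mem_Icc.2 hxy) hxy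
  rcases le_or_gt (r₁ (-β)) (r₂ (-β)) with hr | hr
  · exact mul_lt_mul' (Qmono r1 hr) hpp (sq_nonneg _) (W.primQ_pos r2)
  · have hV := (h.resolve_left (not_lt.2 hr.le)).2
    have hy := W.div_sq_strictAntiOn r2 r1 hr
    simp only at hy
    have e : ∀ r V : ℝ → ℝ, 0 < q (r (-β)) → primQ q (r (-β)) * slp q r V (-β) ^ 2 =
        primQ q (r (-β)) / q (r (-β)) ^ 2 * V (-β) ^ 2 := by
      intro r V h
      simp only [slp]; field_simp
    rw [e _ _ q1, e _ _ q2]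
    have hV1 := P.B₁.V_pos _ m1
    have hy1 : 0 < primQ q (r₁ (-β)) / q (r₁ (-β)) ^ 2 := div_pos (W.primQ_pos r1) (by positivity)
    exact mul_lt_mul hy (by gcongr) (by positivity) (hy1.trans hy).le

/-- The comparison of the functionals carried through the minima to a level of the return. -/
theorem poh_lt (P : ReturnPair c f q β M₁ M₂ T₁ T₂ α₁ α₂ r₁ V₁ r₂ V₂ R₁ U₁ R₂ U₂)
    (W : Weight q Hinf linf) (N : Nonlin c b β f) (h3 : CondF3 c β Hinf f) {s₀ k : ℝ}
    (hs₀ : s₀ ∈ Ico β M₁) (hp : ∀ s ∈ Ioo s₀ M₁, slp q R₁ U₁ s < slp q R₂ U₂ s)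
    (hk : 1 ≤ k) (hV : U₁ s₀ ≤ k * U₂ s₀) :
    poh f q R₁ U₁ s₀ < k * poh f q R₂ U₂ s₀ := by
  have hβ := N.β_pos
  have hb := N.c1.b_lt_β
  have h1 := P.β_lt_M₁
  have h12 := P.M₁_lt
  have hα := P.β_lt_α₁
  have hα2 := P.α₁_lt
  have hM1 : M₁ ∈ dom c := mem_dom_of_abs_le P.M₂_mem (by
    rw [abs_of_pos (by linarith), abs_of_pos (by linarith)]; exact h12.le)
  have B₂' := P.B₂.mono (show -M₂ ≤ -M₁ by linarith) hα2.le
  have C₂' := P.C₂.mono (le_refl 0) h12.le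
  set δ := k * poh f q r₂ V₂ (-β) - poh f q r₁ V₁ (-β) with hδ
  have hp0 : 0 ≤ poh f q r₂ V₂ (-β) := by
    simp only [poh, nrg, N.primF_neg N.β_mem, N.c1.primF_β, mul_zero, add_zero, zero_div,
      sub_zero]
    exact mul_nonneg (W.primQ_pos (P.B₂.r_pos _ ⟨by linarith, by linarith⟩)).le (sq_nonneg _)
  have hδ0 : 0 < δ := by
    have := P.poh_at_neg_β W N
    nlinarith
  -- on the way to the minimum
  have hrise : ∀ s ∈ Ioo (-M₁) (-β), δ ≤ k * poh f q r₂ V₂ s - poh f q r₁ V₁ s := by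
    intro s hs
    refine P.B₁.poh_gap_antitoneOn B₂' W N h3 hs.1 (by linarith) hk (fun x hx => ?_)
      (fun x hx => ?_) (fun x hx => ?_) (fun x hx => ?_)
      (left_mem_Icc.2 hs.2.le) (right_mem_Icc.2 hs.2.le) hs.2.le
    · rw [abs_of_neg (by linarith [hx.2])]; linarith [hx.2]
    · rw [abs_of_neg (by linarith [hx.2])]; linarith [hx.2]
    · exact (P.low x ⟨hs.1.trans hx.1, hx.2.le⟩).1
    · refine (P.low x ⟨hs.1.trans hx.1, hx.2.le⟩).2.imp_right fun h => h.2.trans ?_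
      have := B₂'.V_pos x ⟨hs.1.trans hx.1, by linarith [hx.2]⟩
      nlinarith
  have l1 := tendsto_poh W N (tendsto_nhdsWithin_of_tendsto_nhds tendsto_id)
    (neg_mem_dom hM1) (by rw [abs_neg, abs_of_pos (by linarith)]; linarith) P.T₁_pos P.r₁_lim
    P.V₁_lim P.p₁_lim
  rw [N.primF_neg hM1] at l1
  have l2 : Tendsto (poh f q r₂ V₂) (𝓝[>] (-M₁)) (𝓝 (poh f q r₂ V₂ (-M₁))) := by
    refine tendsto_nhdsWithin_of_tendsto_nhds (P.B₂.hasDerivAt_poh W N ⟨by linarith, by linarith⟩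
      ?_).continuousAt
    rw [abs_neg, abs_of_pos (by linarith)]; linarith
  have hmin : δ ≤ k * poh f q r₂ V₂ (-M₁) - primQ q T₁ * (2 * primF f M₁) := by
    refine ge_of_tendsto ((l2.const_mul k).sub l1) ?_
    filter_upwards [Ioo_mem_nhdsGT (show -M₁ < -β by linarith)] with s hs using hrise s hs
  -- on the return
  have l3 := tendsto_poh W N (tendsto_nhdsWithin_of_tendsto_nhds tendsto_id)
    hM1 (by rw [abs_of_pos (by linarith)]; linarith) P.T₁_pos P.S₁.r_lim P.S₁.V_lim P.S₁.slp_lim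
  have l4 : Tendsto (poh f q R₂ U₂) (𝓝[<] M₁) (𝓝 (poh f q R₂ U₂ M₁)) := by
    refine tendsto_nhdsWithin_of_tendsto_nhds (P.C₂.hasDerivAt_poh W N ⟨by linarith, by linarith⟩
      ?_).continuousAt
    rw [abs_of_pos (by linarith)]; linarith
  have hs0 : 0 < s₀ := hβ.trans_le hs₀.1
  have hret : ∀ s ∈ Ioo s₀ M₁, k * poh f q R₂ U₂ s - poh f q R₁ U₁ s ≤
      k * poh f q R₂ U₂ s₀ - poh f q R₁ U₁ s₀ := by
    intro s hs
    refine P.C₁.poh_gap_antitoneOn C₂' W N h3 hs0 hs.2 hk (fun x hx => ?_)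
      (fun x hx => ?_) (fun x hx => hp x ⟨hx.1, hx.2.trans hs.2⟩) (fun x hx => Or.inr ?_)
      (left_mem_Icc.2 hs.1.le) (right_mem_Icc.2 hs.1.le) hs.1.le
    · rw [abs_of_pos (by linarith [hx.1])]; linarith [hx.1, hs₀.1]
    · rw [abs_of_pos (by linarith [hx.1])]; linarith [hx.1, hs₀.1]
    · exact P.C₁.V_ratio C₂' W N hs0 hx.1.le (hx.2.trans hs.2) (hb.le.trans hs₀.1)
        (fun y hy => hp y ⟨hy.1, hy.2.trans (hx.2.trans hs.2)⟩) hV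
  have hfin : k * poh f q R₂ U₂ M₁ - primQ q T₁ * (2 * primF f M₁) ≤
      k * poh f q R₂ U₂ s₀ - poh f q R₁ U₁ s₀ := by
    refine le_of_tendsto ((l4.const_mul k).sub l3) ?_
    filter_upwards [Ioo_mem_nhdsLT hs₀.2] with s hs using hret s hs
  have hturn := mul_le_mul_of_nonneg_left (P.poh_turn W N h3) (show 0 ≤ k by linarith)
  linarith

/-- On the return the first solution stays flatter down to the level `β`. -/
theorem slp_lt (P : ReturnPair c f q β M₁ M₂ T₁ T₂ α₁ α₂ r₁ V₁ r₂ V₂ R₁ U₁ R₂ U₂)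
    (W : Weight q Hinf linf) (N : Nonlin c b β f) (h3 : CondF3 c β Hinf f) :
    ∀ s ∈ Ico β M₁, slp q R₁ U₁ s < slp q R₂ U₂ s := by
  have hβ := N.β_pos
  have hb := N.c1.b_lt_β
  have h1 := P.β_lt_M₁
  have h12 := P.M₁_lt
  have C₂' := P.C₂.mono (le_refl 0) h12.le
  have hm : M₁ ∈ Ioo 0 M₂ := ⟨by linarith, h12⟩
  have hev : ∀ᶠ s in 𝓝[<] M₁, slp q R₁ U₁ s < slp q R₂ U₂ s :=
    P.S₁.slp_lim.eventually_lt (tendsto_nhdsWithin_of_tendsto_nhds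
      (P.C₂.continuousAt_slp W hm)) (P.C₂.slp_pos W hm)
  obtain ⟨m, hmm, hmx⟩ := (mem_nhdsLT_iff_exists_mem_Ico_Ioo_subset h1).1 hev
  intro s hs
  rcases lt_or_ge m s with h | h
  · exact hmx ⟨h, hs.2⟩
  obtain ⟨t, ht1, ht2⟩ := exists_between hmm.2
  have hsub : Icc s t ⊆ Ioo 0 M₁ := Icc_subset_Ioo (hβ.trans_le hs.1) ht2
  have := backward_barrier (D := fun s => slp q R₂ U₂ s - slp q R₁ U₁ s) (s₀ := s) (s₁ := t)
    (fun x hx => ((C₂'.continuousAt_slp W (hsub hx)).sub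
      (P.C₁.continuousAt_slp W (hsub hx))).continuousWithinAt)
    (sub_pos.2 (hmx ⟨ht1, ht2⟩)) ?_ s (left_mem_Icc.2 (h.trans ht1.le))
  · exact sub_pos.1 this
  intro x hx hx0 hpos
  have hx' := hsub ⟨hx.1, hx.2.le⟩
  have heq : slp q R₁ U₁ x = slp q R₂ U₂ x := by linarith
  have hp : ∀ y ∈ Ioo x M₁, slp q R₁ U₁ y < slp q R₂ U₂ y := by
    intro y hy
    rcases le_or_gt y t with h' | h'
    · exact sub_pos.1 (hpos y ⟨hy.1, h'⟩)
    · exact hmx ⟨ht1.trans h', hy.2⟩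
  rcases lt_or_ge (R₁ x) (R₂ x) with hr | hr
  · -- being early, the first branch is strictly flatter
    have hanti := P.C₁.sub_r_strictAntiOn C₂' W hx'.1 ht2
      (fun y hy => hp y ⟨hy.1, hy.2.trans ht2⟩)
    have := P.C₁.slp_lt_of_r_lt C₂' W hx'.1 ht2 (fun y hy => by
      have := hanti.antitoneOn (left_mem_Icc.2 hx.2.le) ⟨hy.1, hy.2.le⟩ hy.1
      linarith) (hmx ⟨ht1, ht2⟩) x (left_mem_Icc.2 hx.2.le)
    linarith
  · -- otherwise compare the functionals with the factor `k = q(r₁) / q(r₂)`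
    have hr1 := P.C₁.r_pos x hx'
    have hr2 := C₂'.r_pos x hx'
    have hq1 := W.pos hr1
    have hq2 := W.pos hr2
    have hk : 1 ≤ q (R₁ x) / q (R₂ x) := (one_le_div hq2).2 (W.le hr2.le hr)
    have hlt := P.poh_lt W N h3 ⟨hs.1.trans hx.1, hx.2.trans ht2⟩ hp hk (by
      rw [P.C₁.V_eq W hx', C₂'.V_eq W hx', heq]
      apply le_of_eq
      field_simp)
    have hE := C₂'.nrg_pos hx'
    have hEE : nrg f q R₁ U₁ x = nrg f q R₂ U₂ x := by simp only [nrg, heq]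
    simp only [poh, hEE] at hlt
    rw [P.C₁.V_eq W hx', C₂'.V_eq W hx', heq] at hlt
    have e : q (R₁ x) / q (R₂ x) * (primQ q (R₂ x) * nrg f q R₂ U₂ x -
        2 * (q (R₂ x) * slp q R₂ U₂ x * (primF f x / f x))) =
        q (R₁ x) / q (R₂ x) * primQ q (R₂ x) * nrg f q R₂ U₂ x -
        2 * (q (R₁ x) * slp q R₂ U₂ x * (primF f x / f x)) := by
      field_simp
    rw [e] at hlt
    have h5 : primQ q (R₁ x) * nrg f q R₂ U₂ x <
        q (R₁ x) / q (R₂ x) * primQ q (R₂ x) * nrg f q R₂ U₂ x := by linarith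
    have h6 := lt_of_mul_lt_mul_right h5 hE.le
    have h7 : primQ q (R₁ x) / q (R₁ x) < primQ q (R₂ x) / q (R₂ x) := by
      rw [div_lt_iff₀ hq1]
      calc _ < _ := h6
        _ = _ := by field_simp
    have := W.div_strictMonoOn.monotoneOn hr2 hr1 hr
    linarith

/-- The two returns cannot both end at the level `0` with vanishing slope. -/
theorem false (P : ReturnPair c f q β M₁ M₂ T₁ T₂ α₁ α₂ r₁ V₁ r₂ V₂ R₁ U₁ R₂ U₂)
    (W : Weight q Hinf linf) (N : Nonlin c b β f) (h3 : CondF3 c β Hinf f) : False := by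
  have hβ := N.β_pos
  have h1 := P.β_lt_M₁
  have C₂' := P.C₂.mono (le_refl 0) P.M₁_lt.le
  have hp := P.slp_lt W N h3
  have hm : β ∈ Ioo 0 M₁ := ⟨hβ, h1⟩
  have hpβ := hp β ⟨le_rfl, h1⟩
  rcases lt_trichotomy (R₁ β) (R₂ β) with hr | hr | hr
  · rcases P.C₁.first_crossing C₂' W N hm hr hpβ with h | ⟨s₀, hs₀, heq, hps, -⟩
    · exact P.C₁.false_of_r_lt C₂' W N hβ h1 (fun s hs => (h s ⟨hs.1, hs.2.le⟩).1)
        (fun s hs => (h s ⟨hs.1, hs.2.le⟩).2) P.end₂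
    · exact P.C₁.false_of_low_crossing C₂' W N hs₀.1 (hs₀.2.trans h1) hs₀.2.le heq hps P.end₂
  · exact P.C₁.false_of_low_crossing C₂' W N hβ h1 le_rfl hr hpβ P.end₂
  · refine P.C₁.false_of_tail C₂' W N hβ h1 le_rfl hr.le ?_ P.end₂
    rcases le_or_gt (U₁ β) (U₂ β) with hU | hU
    · exact P.C₁.tail_lt_at_β C₂' W N hm hr hU
    · -- here the factor is the ratio of the fluxes
      have hU2 := C₂'.V_pos β hm
      have hU1 := P.C₁.V_pos β hm
      have hlt := P.poh_lt W N h3 ⟨le_rfl, h1⟩ (fun s hs => hp s ⟨hs.1.le, hs.2⟩)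
        (k := U₁ β / U₂ β) ((one_le_div hU2).2 hU.le) (by field_simp; exact le_rfl)
      simp only [poh, nrg, N.c1.primF_β, mul_zero, add_zero, zero_div, sub_zero] at hlt
      simp only [nrg, N.c1.primF_β, mul_zero, add_zero]
      rw [Real.sqrt_sq (P.C₁.slp_pos W hm).le, Real.sqrt_sq (C₂'.slp_pos W hm).le]
      have hq1 := P.C₁.q_pos W hm
      have hq2 := C₂'.q_pos W hm
      simp only [slp] at hlt ⊢
      have e1 : primQ q (R₁ β) * (U₁ β / q (R₁ β)) ^ 2 =
          U₁ β * (primQ q (R₁ β) / q (R₁ β) * (U₁ β / q (R₁ β))) := by field_simp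
      have e2 : U₁ β / U₂ β * (primQ q (R₂ β) * (U₂ β / q (R₂ β)) ^ 2) =
          U₁ β * (primQ q (R₂ β) / q (R₂ β) * (U₂ β / q (R₂ β))) := by field_simp
      rw [e1, e2] at hlt
      exact lt_of_mul_lt_mul_left hlt hU1.le

end ReturnPair

/-! ### Comparison of solutions through their branches -/

namespace Falls

variable {c : EReal} {b β Hinf linf : ℝ} {f q v v₁ v₂ : ℝ → ℝ} {T m α α₁ α₂ a a₁ a₂ : ℝ}
  {J J₁ J₂ : Set ℝ} {r V r₁ V₁ r₂ V₂ : ℝ → ℝ}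

theorem lt_r (F : Falls c f q T m v J a r V) (W : Weight q Hinf linf) {s : ℝ}
    (hs : s ∈ Ioo a m) : T < r s := by
  obtain ⟨s', h1, h2⟩ := exists_between hs.2
  have hs' : s' ∈ Ioo a m := ⟨hs.1.trans h1, h2⟩
  have hanti := F.branch.strictAntiOn_r W
  refine lt_of_le_of_lt ?_ (hanti hs hs' h1)
  refine le_of_tendsto F.starts.r_lim ?_
  filter_upwards [Ioo_mem_nhdsLT h2] with x hx
  exact (hanti hs' ⟨hs'.1.trans hx.1, hx.2⟩ hx.1).le

/-- Every time before `r s₀` is the time of some level above `s₀`. -/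
theorem exists_level (F : Falls c f q T m v J a r V) {s₀ t : ℝ} (hs₀ : s₀ ∈ Ioo a m)
    (ht : t ∈ Ioo T (r s₀)) : ∃ s ∈ Ioo s₀ m, r s = t := by
  obtain ⟨s', h1, h2⟩ := ((F.starts.r_lim.eventually_lt_const ht.1).and
    (Ioo_mem_nhdsLT hs₀.2)).exists
  have hc : ContinuousOn r (Icc s₀ s') := fun x hx =>
    (F.branch.deriv_r x ⟨hs₀.1.trans_le hx.1, hx.2.trans_lt h2.2⟩).continuousAt.continuousWithinAt
  obtain ⟨s, hs, hst⟩ := intermediate_value_Icc' h2.1.le hc ⟨h1.le, ht.2.le⟩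
  refine ⟨s, ⟨hs.1.lt_of_ne ?_, hs.2.trans_lt h2.2⟩, hst⟩
  rintro rfl
  exact ht.2.ne hst.symm

/-- For a sublinear `f` two falling branches do not cross above `β` at all. -/
theorem goodCrossing_of_sublinear (F₁ : Falls c f q 0 α₁ v₁ J₁ a₁ r₁ V₁)
    (F₂ : Falls c f q 0 α₂ v₂ J₂ a₂ r₂ V₂) (S₁ : Sol c f q 0 α₁ v₁) (S₂ : Sol c f q 0 α₂ v₂)
    (W : Weight q Hinf linf) (N : Nonlin c b β f) (h5 : CondF5 c b f) (ha₁ : a₁ < β)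
    (ha₂ : a₂ < β) (h12 : α₁ < α₂) : Branch.GoodCrossing β q r₁ V₁ r₂ V₂ α₁ := by
  intro s₀ hs₀ hr _ hlt
  exfalso
  have hs1 : s₀ ∈ Ioo a₁ α₁ := ⟨ha₁.trans hs₀.1, hs₀.2⟩
  have hs2 : s₀ ∈ Ioo a₂ α₂ := ⟨ha₂.trans hs₀.1, hs₀.2.trans h12⟩
  refine S₁.false_of_meet S₂ W N h5 (F₁.branch.r_pos s₀ hs1) ?_ ?_ ?_
  · intro t ht
    rcases ht.2.lt_or_eq with h | h
    · obtain ⟨s, hs, rfl⟩ := F₁.exists_level hs1 ⟨ht.1, h⟩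
      rw [F₁.v_r s ⟨hs1.1.trans hs.1, hs.2⟩]
      linarith [N.c1.b_lt_β, hs₀.1, hs.1]
    · rw [h, F₁.v_r s₀ hs1]
      linarith [N.c1.b_lt_β, hs₀.1]
  · intro t ht
    obtain ⟨s, hs, rfl⟩ := F₁.exists_level hs1 ht
    rw [F₁.v_r s ⟨hs1.1.trans hs.1, hs.2⟩]
    obtain ⟨s', hs', h'⟩ := F₂.exists_level (s₀ := s) ⟨hs2.1.trans hs.1, hs.2.trans h12⟩
      ⟨ht.1, hlt s hs⟩
    rw [← h', F₂.v_r s' ⟨(hs2.1.trans hs.1).trans hs'.1, hs'.2⟩]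
    exact hs'.1
  · rw [F₁.v_r s₀ hs1, hr, F₂.v_r s₀ hs2]

/-- For a nonlinearity with decreasing elasticity crossings above `β` are harmless. -/
theorem goodCrossing_of_elasticity (F₁ : Falls c f q 0 α₁ v₁ J₁ a₁ r₁ V₁)
    (F₂ : Falls c f q 0 α₂ v₂ J₂ a₂ r₂ V₂) (S₁ : Sol c f q 0 α₁ v₁) (S₂ : Sol c f q 0 α₂ v₂)
    (W : Weight q Hinf linf) (N : Nonlin c b β f) (h4 : CondF4 c b f) (h6 : CondF6 β linf f)
    (ha₁ : a₁ < β) (ha₂ : a₂ < β) (h12 : α₁ < α₂) : Branch.GoodCrossing β q r₁ V₁ r₂ V₂ α₁ := by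
  intro s₀ hs₀ hr hp _
  exact (F₁.branch.mono (le_max_left a₁ a₂) le_rfl).crossing_above
    (F₂.branch.mono (le_max_right a₁ a₂) le_rfl) W N h4 h6 (max_lt ha₁ ha₂) h12.le
    (S₁.start ▸ S₁.mem 0 le_rfl) (S₂.start ▸ S₂.mem 0 le_rfl) F₁.starts F₂.starts hs₀ hr hp

/-- Falling branches with the same initial time and level agree. -/
theorem eqOn (F₁ : Falls c f q T m v₁ J₁ a₁ r₁ V₁) (F₂ : Falls c f q T m v₂ J₂ a₂ r₂ V₂)
    (S₁ : Sol c f q T m v₁) (S₂ : Sol c f q T m v₂) (W : Weight q Hinf linf)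
    (N : Nonlin c b β f) (hm : 0 < m) (ha₁ : a₁ < m) (ha₂ : a₂ < m) :
    ∀ s ∈ Ioo (max a₁ a₂) m, r₁ s = r₂ s ∧ V₁ s = V₂ s := by
  obtain ⟨R, hR, heq⟩ := S₁.eqOn_start S₂ W N hm
  obtain ⟨s₁, hs₁⟩ := exists_between (max_lt ha₁ ha₂)
  have hs₁' : s₁ ∈ Ioo a₁ m := ⟨(le_max_left _ _).trans_lt hs₁.1, hs₁.2⟩
  obtain ⟨s₀, h0, hs₀⟩ := ((F₂.starts.r_lim.eventually_lt_const
    (lt_min hR (F₁.lt_r W hs₁'))).and (Ioo_mem_nhdsLT hs₁.2)).exists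
  have hs1 : s₀ ∈ Ioo a₁ m := ⟨hs₁'.1.trans hs₀.1, hs₀.2⟩
  have hs2 : s₀ ∈ Ioo a₂ m := ⟨(le_max_right a₁ a₂).trans_lt (hs₁.1.trans hs₀.1), hs₀.2⟩
  have hT2 := F₂.lt_r W hs2
  have hlt : r₂ s₀ < R := h0.trans_le (min_le_left _ _)
  obtain ⟨s, hs, hst⟩ := F₁.exists_level hs₁' ⟨hT2, h0.trans_le (min_le_right _ _)⟩
  have hss : s = s₀ := by
    rw [← F₁.v_r s ⟨hs₁'.1.trans hs.1, hs.2⟩, hst, heq _ ⟨hT2.le, hlt.le⟩, F₂.v_r s₀ hs2]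
  rw [hss] at hst
  have hd : deriv v₁ (r₂ s₀) = deriv v₂ (r₂ s₀) := by
    refine Filter.EventuallyEq.deriv_eq ?_
    filter_upwards [Ioo_mem_nhds hT2 hlt] with t ht using heq t ⟨ht.1.le, ht.2.le⟩
  refine (F₁.branch.mono (le_max_left _ _) le_rfl).eqOn
    (F₂.branch.mono (le_max_right _ _) le_rfl) W N
    ⟨hs₁.1.trans hs₀.1, hs₀.2⟩ hst ?_
  rw [F₁.V_eq s₀ hs1, F₂.V_eq s₀ hs2, hst, hd]

end Falls

namespace Sol

variable {c : EReal} {b β Hinf linf : ℝ} {f q v₁ v₂ : ℝ → ℝ} {T m α₁ α₂ : ℝ}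

/-- A nonnegative solution is determined by its initial time and level. -/
theorem eqOn_of_nonneg (S₁ : Sol c f q T m v₁) (S₂ : Sol c f q T m v₂) (W : Weight q Hinf linf)
    (N : Nonlin c b β f) (hm : 0 < m) (h₁ : ∀ t, T ≤ t → 0 ≤ v₁ t)
    (h₂ : ∀ t, T ≤ t → 0 ≤ v₂ t) : EqOn v₁ v₂ (Ici T) := by
  obtain ⟨r₁, V₁, F₁, -⟩ := S₁.falls_of_nonneg W N hm h₁
  obtain ⟨r₂, V₂, F₂, -⟩ := S₂.falls_of_nonneg W N hm h₂
  have h := F₁.eqOn F₂ S₁ S₂ W N hm hm hm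
  rw [max_self] at h
  intro t ht
  rcases (mem_Ici.1 ht).eq_or_lt with rfl | ht
  · rw [S₁.start, S₂.start]
  rcases (h₁ t ht.le).eq_or_lt with h1 | h1
  · rcases (h₂ t ht.le).eq_or_lt with h2 | h2
    · rw [← h1, ← h2]
    · have hs := F₂.v_mem t ⟨ht, h2⟩
      have := F₁.v_r _ hs
      rwa [(h _ hs).1, F₂.r_v t ⟨ht, h2⟩] at this
  · have hs := F₁.v_mem t ⟨ht, h1⟩
    have := F₂.v_r _ hs
    rw [← (h _ hs).1, F₁.r_v t ⟨ht, h1⟩] at this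
    exact this.symm

end Sol

namespace FallsToMin

variable {c : EReal} {b β Hinf linf : ℝ} {f q u u₁ u₂ : ℝ → ℝ} {α α₁ α₂ R R₁ R₂ M M₁ M₂ : ℝ}
  {r V r₁ V₁ r₂ V₂ : ℝ → ℝ}

theorem M_mem (G : FallsToMin c f q α u R M r V) : M ∈ dom c := by
  have := G.sol.mem R le_rfl
  rwa [G.sol.start] at this

/-- Two solutions with one sign change and the same initial level have the same minimum. -/
theorem M_le (G₁ : FallsToMin c f q α u₁ R₁ M₁ r₁ V₁) (G₂ : FallsToMin c f q α u₂ R₂ M₂ r₂ V₂)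
    (S₁ : Sol c f q 0 α u₁) (S₂ : Sol c f q 0 α u₂) (W : Weight q Hinf linf)
    (N : Nonlin c b β f) (hα : 0 < α) (h₁ : 0 < M₁) : M₂ ≤ M₁ := by
  by_contra! hlt
  have h := G₁.falls.eqOn G₂.falls S₁ S₂ W N hα (by linarith) (by linarith)
  rw [max_eq_left (by linarith)] at h
  have hmem : -M₁ ∈ Ioo (-M₂) α := ⟨by linarith, by linarith⟩
  have hlim : Tendsto (slp q r₂ V₂) (𝓝[>] (-M₁)) (𝓝 0) := by
    refine G₁.slp_lim.congr' ?_
    filter_upwards [Ioo_mem_nhdsGT (show -M₁ < α by linarith)] with s hs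
    simp only [slp, (h s hs).1, (h s hs).2]
  have := tendsto_nhds_unique hlim
    ((G₂.falls.branch.continuousAt_slp W hmem).tendsto.mono_left nhdsWithin_le_nhds)
  exact (G₂.falls.branch.slp_pos W hmem).ne this

/-- A solution with one sign change is determined by its initial level. -/
theorem eqOn (G₁ : FallsToMin c f q α u₁ R₁ M₁ r₁ V₁) (G₂ : FallsToMin c f q α u₂ R₂ M₂ r₂ V₂)
    (S₁ : Sol c f q 0 α u₁) (S₂ : Sol c f q 0 α u₂) (W : Weight q Hinf linf)
    (N : Nonlin c b β f) (hα : 0 < α) (h₁ : 0 < M₁) (h₂ : 0 < M₂) : EqOn u₁ u₂ (Ici 0) := by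
  obtain rfl : M₁ = M₂ := le_antisymm (G₂.M_le G₁ S₂ S₁ W N hα h₂)
    (G₁.M_le G₂ S₁ S₂ W N hα h₁)
  have h := G₁.falls.eqOn G₂.falls S₁ S₂ W N hα (by linarith) (by linarith)
  rw [max_self] at h
  obtain rfl : R₁ = R₂ := by
    refine tendsto_nhds_unique (G₁.r_lim.congr' ?_) G₂.r_lim
    filter_upwards [Ioo_mem_nhdsGT (show -M₁ < α by linarith)] with s hs using (h s hs).1
  intro t ht
  rcases (mem_Ici.1 ht).eq_or_lt with rfl | ht
  · rw [S₁.start, S₂.start]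
  rcases lt_or_ge t R₁ with htR | htR
  · have hs := G₁.falls.v_mem t ⟨ht, htR⟩
    have := G₂.falls.v_r _ hs
    rw [← (h _ hs).1, G₁.falls.r_v t ⟨ht, htR⟩] at this
    exact this.symm
  · have := G₁.sol.eqOn_of_nonneg G₂.sol W N h₁ G₁.nonneg G₂.nonneg (mem_Ici.2 htR)
    simpa using this

/-- The solution with the higher initial level has the deeper minimum. -/
theorem M_lt (G₁ : FallsToMin c f q α₁ u₁ R₁ M₁ r₁ V₁)
    (G₂ : FallsToMin c f q α₂ u₂ R₂ M₂ r₂ V₂) (W : Weight q Hinf linf) (N : Nonlin c b β f)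
    (h₂ : β < M₂) (hβ : β < α₁) (h12 : α₁ < α₂) (hcr : Branch.GoodCrossing β q r₁ V₁ r₂ V₂ α₁) :
    M₁ < M₂ := by
  by_contra! hle
  have B₁ := G₁.falls.branch.mono (neg_le_neg hle) le_rfl
  have B₂ := G₂.falls.branch
  exact B₁.lt_of_low_alternative B₂ W N (neg_lt_neg h₂) hβ h12
    (B₁.low_alternative B₂ W N (neg_lt_neg h₂) hβ h12 G₁.falls.starts hcr) G₂.V_lim G₂.slp_lim

/-- Below `-β` the solution with the lower initial level is flatter, and it is either earlier or
later with smaller flux. -/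
theorem low (G₁ : FallsToMin c f q α₁ u₁ R₁ M₁ r₁ V₁)
    (G₂ : FallsToMin c f q α₂ u₂ R₂ M₂ r₂ V₂) (W : Weight q Hinf linf) (N : Nonlin c b β f)
    (h₁ : β < M₁) (hM : M₁ < M₂) (hβ : β < α₁) (h12 : α₁ < α₂)
    (hcr : Branch.GoodCrossing β q r₁ V₁ r₂ V₂ α₁) :
    ∀ s ∈ Ioc (-M₁) (-β), slp q r₁ V₁ s < slp q r₂ V₂ s ∧
      (r₁ s < r₂ s ∨ (r₂ s ≤ r₁ s ∧ V₁ s ≤ V₂ s)) := by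
  have B₁ := G₁.falls.branch
  have B₂ := G₂.falls.branch.mono (neg_le_neg hM.le) le_rfl
  intro s hs
  rcases B₁.low_alternative B₂ W N (neg_lt_neg h₁) hβ h12 G₁.falls.starts hcr with h | h
  · exact ⟨(h s hs).2, Or.inl (h s hs).1⟩
  obtain ⟨s₀, hs₀, hr, hV, hp, h⟩ := h
  rcases lt_or_ge s₀ s with hlt | hle
  · exact ⟨(h s ⟨hlt, hs.2⟩).2, Or.inl (h s ⟨hlt, hs.2⟩).1⟩
  have hβ0 := N.β_pos
  have hd : s₀ < α₁ := by linarith [hs₀.2]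
  have B₂' := B₂.mono le_rfl h12.le
  obtain ⟨hpp, hanti⟩ := B₁.V_compare B₂' W N hs.1 hd (by linarith [hs₀.2, N.c1.b_lt_β])
    hr hV hp
  refine ⟨hpp s ⟨le_rfl, hle⟩, Or.inr ⟨?_, ?_⟩⟩
  · rcases hle.eq_or_lt with rfl | hlt
    · exact hr
    · exact (B₁.r_lt_of_slp_lt B₂' W hs.1 hd hr
        (fun t ht => hpp t (Ioo_subset_Icc_self ht)) s ⟨le_rfl, hlt⟩).le
  · have h1 := hanti.antitoneOn (left_mem_Icc.2 hle) (right_mem_Icc.2 hle) hle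
    have hs' : s ∈ Ioo (-M₁) α₁ := ⟨hs.1, hle.trans_lt hd⟩
    have hs₀' : s₀ ∈ Ioo (-M₁) α₁ := ⟨hs₀.1, hd⟩
    have hsq := pow_le_pow_left₀ (B₁.V_pos s₀ hs₀').le hV 2
    exact le_of_sq_le_sq (by linarith) (B₂'.V_pos s hs').le

/-- Two solutions with one sign change cannot have different initial levels. -/
theorem false_of_lt (G₁ : FallsToMin c f q α₁ u₁ R₁ M₁ r₁ V₁)
    (G₂ : FallsToMin c f q α₂ u₂ R₂ M₂ r₂ V₂) (W : Weight q Hinf linf) (N : Nonlin c b β f)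
    (h3 : CondF3 c β Hinf f) (h₁ : β < M₁) (h₂ : β < M₂) (hβ : β < α₁) (h12 : α₁ < α₂)
    (hcr : Branch.GoodCrossing β q r₁ V₁ r₂ V₂ α₁) : False := by
  have hM := G₁.M_lt G₂ W N h₂ hβ h12 hcr
  obtain ⟨ρ₁, U₁, F₁, -⟩ := G₁.sol.falls_of_nonneg W N (N.β_pos.trans h₁) G₁.nonneg
  obtain ⟨ρ₂, U₂, F₂, hend⟩ := G₂.sol.falls_of_nonneg W N (N.β_pos.trans h₂) G₂.nonneg
  have P : ReturnPair c f q β M₁ M₂ R₁ R₂ α₁ α₂ r₁ V₁ r₂ V₂ ρ₁ U₁ ρ₂ U₂ :=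
    { β_lt_M₁ := h₁
      M₁_lt := hM
      β_lt_α₁ := hβ
      α₁_lt := h12
      T₁_pos := G₁.R_pos
      T₂_pos := G₂.R_pos
      M₂_mem := G₂.M_mem
      B₁ := G₁.falls.branch
      B₂ := G₂.falls.branch
      C₁ := F₁.branch
      C₂ := F₂.branch
      r₁_lim := G₁.r_lim
      V₁_lim := G₁.V_lim
      p₁_lim := G₁.slp_lim
      r₂_lim := G₂.r_lim
      V₂_lim := G₂.V_lim
      p₂_lim := G₂.slp_lim
      S₁ := F₁.starts
      S₂ := F₂.starts
      end₂ := hend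
      low := G₁.low G₂ W N h₁ hM hβ h12 hcr }
  exact P.false W N h3

end FallsToMin

/-! ### Uniqueness -/

/-- Crossings of the falling branches of any two solutions above the level `β` are harmless. -/
def CrossingsGood (c : EReal) (β : ℝ) (f q : ℝ → ℝ) : Prop :=
  ∀ (α₁ α₂ a₁ a₂ : ℝ) (v₁ v₂ : ℝ → ℝ) (J₁ J₂ : Set ℝ) (r₁ V₁ r₂ V₂ : ℝ → ℝ),
    Sol c f q 0 α₁ v₁ → Sol c f q 0 α₂ v₂ →
    Falls c f q 0 α₁ v₁ J₁ a₁ r₁ V₁ → Falls c f q 0 α₂ v₂ J₂ a₂ r₂ V₂ →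
    a₁ < β → a₂ < β → α₁ < α₂ → Branch.GoodCrossing β q r₁ V₁ r₂ V₂ α₁

section

variable {c : EReal} {b β Hinf linf : ℝ} {f q : ℝ → ℝ}

/-- Nonnegative solutions are unique when crossings are harmless. -/
theorem atMostOne_nonneg (W : Weight q Hinf linf) (N : Nonlin c b β f)
    (hcr : CrossingsGood c β f q) :
    AtMostOneSolution c f q (fun u => 0 < u 0 ∧ ∀ r : ℝ, 0 ≤ r → 0 ≤ u r) := by
  have no_lt : ∀ u v : ℝ → ℝ, IsSolution c f q u → (0 < u 0 ∧ ∀ r : ℝ, 0 ≤ r → 0 ≤ u r) →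
      IsSolution c f q v → (0 < v 0 ∧ ∀ r : ℝ, 0 ≤ r → 0 ≤ v r) → ¬ u 0 < v 0 := by
    intro u v hu hu' hv hv' hlt
    have S₁ := Sol.of_isSolution W N hu
    have S₂ := Sol.of_isSolution W N hv
    obtain ⟨r₁, V₁, F₁, -⟩ := S₁.falls_of_nonneg W N hu'.1 hu'.2
    obtain ⟨r₂, V₂, F₂, hlim⟩ := S₂.falls_of_nonneg W N hv'.1 hv'.2
    exact F₁.branch.false_of_lt F₂.branch W N (S₁.β_lt W N hu'.1) hlt F₁.starts hlim
      (hcr _ _ _ _ _ _ _ _ _ _ _ _ S₁ S₂ F₁ F₂ N.β_pos N.β_pos hlt)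
  intro u v hu hu' hv hv'
  have heq : u 0 = v 0 := le_antisymm (not_lt.1 (no_lt v u hv hv' hu hu'))
    (not_lt.1 (no_lt u v hu hu' hv hv'))
  have S₂ := Sol.of_isSolution W N hv
  rw [← heq] at S₂
  exact (Sol.of_isSolution W N hu).eqOn_of_nonneg S₂ W N hu'.1 hu'.2 hv'.2

/-- Solutions with one sign change are unique when crossings are harmless and the
Pohozaev-type functional is monotone. -/
theorem atMostOne_oneSignChange (W : Weight q Hinf linf) (N : Nonlin c b β f)
    (h3 : CondF3 c β Hinf f) (hcr : CrossingsGood c β f q) :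
    AtMostOneSolution c f q (fun u => 0 < u 0 ∧ ExactlyOneSignChange u) := by
  have no_lt : ∀ u v : ℝ → ℝ, IsSolution c f q u → (0 < u 0 ∧ ExactlyOneSignChange u) →
      IsSolution c f q v → (0 < v 0 ∧ ExactlyOneSignChange v) → ¬ u 0 < v 0 := by
    intro u v hu hu' hv hv' hlt
    have S₁ := Sol.of_isSolution W N hu
    have S₂ := Sol.of_isSolution W N hv
    obtain ⟨R₁, M₁, r₁, V₁, hM₁, G₁⟩ := S₁.exists_fallsToMin W N hu'.1 hu'.2
    obtain ⟨R₂, M₂, r₂, V₂, hM₂, G₂⟩ := S₂.exists_fallsToMin W N hv'.1 hv'.2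
    have hβ := N.β_pos
    exact G₁.false_of_lt G₂ W N h3 hM₁ hM₂ (S₁.β_lt W N hu'.1) hlt
      (hcr _ _ _ _ _ _ _ _ _ _ _ _ S₁ S₂ G₁.falls G₂.falls (by linarith) (by linarith) hlt)
  intro u v hu hu' hv hv'
  have heq : u 0 = v 0 := le_antisymm (not_lt.1 (no_lt v u hv hv' hu hu'))
    (not_lt.1 (no_lt u v hu hu' hv hv'))
  have S₁ := Sol.of_isSolution W N hu
  have S₂ := Sol.of_isSolution W N hv
  rw [← heq] at S₂
  obtain ⟨R₁, M₁, r₁, V₁, hM₁, G₁⟩ := S₁.exists_fallsToMin W N hu'.1 hu'.2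
  obtain ⟨R₂, M₂, r₂, V₂, hM₂, G₂⟩ := S₂.exists_fallsToMin W N hu'.1 hv'.2
  exact G₁.eqOn G₂ S₁ S₂ W N hu'.1 (N.β_pos.trans hM₁) (N.β_pos.trans hM₂)

end

end WeightedBoundState

theorem theorem3 (c : EReal) (b β Hinf linf : ℝ) (f q : ℝ → ℝ)
    (hf1 : CondF1 c b β f) (hf2 : CondF2 c f)
    (hq1 : CondQ1 q) (hq2 : CondQ2 q) (hq3 : CondQ3 q Hinf) (hq4 : CondQ4 q linf)
    (hq5 : CondQ5 q) :
    (CondF3 c β Hinf f → CondF5 c b f →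
      AtMostOneSolution c f q (fun u => 0 < u 0 ∧ ∀ r : ℝ, 0 ≤ r → 0 ≤ u r) ∧
      AtMostOneSolution c f q (fun u => 0 < u 0 ∧ ExactlyOneSignChange u)) ∧
    (CondF4 c b f → CondF6 β linf f →
      AtMostOneSolution c f q (fun u => 0 < u 0 ∧ ∀ r : ℝ, 0 ≤ r → 0 ≤ u r) ∧
      AtMostOneSolution c f q (fun u => 0 < u 0 ∧ ExactlyOneSignChange u)) := by
  have W : Weight q Hinf linf := ⟨hq1, hq2, hq3, hq4, hq5⟩
  have N : Nonlin c b β f := ⟨hf1, hf2⟩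
  refine ⟨fun h3 h5 => ?_, fun h4 h6 => ?_⟩
  · have hcr : CrossingsGood c β f q := fun _ _ _ _ _ _ _ _ _ _ _ _ S₁ S₂ F₁ F₂ ha₁ ha₂ h12 =>
      F₁.goodCrossing_of_sublinear F₂ S₁ S₂ W N h5 ha₁ ha₂ h12
    exact ⟨atMostOne_nonneg W N hcr, atMostOne_oneSignChange W N h3 hcr⟩
  · have hcr : CrossingsGood c β f q := fun _ _ _ _ _ _ _ _ _ _ _ _ S₁ S₂ F₁ F₂ ha₁ ha₂ h12 =>
      F₁.goodCrossing_of_elasticity F₂ S₁ S₂ W N h4 h6 ha₁ ha₂ h12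
    exact ⟨atMostOne_nonneg W N hcr, atMostOne_oneSignChange W N
      (N.condF3_of_elasticity W.c4.linf_pos W.le_Hinf h4 h6) hcr⟩
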